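/- Let $\mathfrak h$ be a separable complex Hilbert space with orthonormal basis $\{\varphi_k\}$, let $\mathcal F=\bigoplus_{N\ge0}\bigwedge^N\mathfrak h$ be the fermion Fock space over $\mathfrak h$, with creation operators $c^*(f)$ (where $c^*(f)(g_1\wedge\dots\wedge g_N)=f\wedge g_1\wedge\dots\wedge g_N$), annihilation operators $c(f)=(c^*(f))^*$, and number operator $\hat N$. Write $c_k^*=c^*(\varphi_k)$ and $c_k=c(\varphi_k)$. Let $\rho$ be a trace-class operator on $\mathcal F$, not necessarily positive, with $\mathrm{tr}\,\rho=1$, $\mathrm{tr}(|\rho|^{1/2}\hat N^2|\rho|^{1/2})<\infty$ and $[\hat N,\rho]=0$. Then there are unique bounded operators $\gamma_\rho$ on $\mathfrak h$ and $\Gamma_\rho$ on $\mathfrak h\otimes\mathfrak h$ with $$\langle f|\gamma_\rho g\rangle=\mathrm{tr}(\rho\,c^*(g)c(f)),\qquad \langle f_1\otimes f_2|\Gamma_\rho(g_1\otimes g_2)\rangle=\mathrm{tr}(\rho\,c^*(g_2)c^*(g_1)c(f_1)c(f_2))$$ for all vectors in $\mathfrak h$, and the following two statements are equivalent. (i) $\mathrm{tr}(\rho\,\mathcal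 P^*\mathcal P)\ge0$ for every polynomial $\mathcal P$ of degree at most $2$ in the operators $c_k^*,c_k$. (ii) The pair $(\gamma,\Gamma)=(\gamma_\rho,\Gamma_\rho)$ has the following properties, where $\mathrm{Ex}(f\otimes g)=g\otimes f$. - Admissibility: $\gamma$ is trace class, $0\le\gamma\le1$, $\mathrm{tr}\,\gamma=\langle\hat N\rangle_\rho:=\mathrm{tr}(\hat N\rho)=\sum_n n\,\mathrm{tr}(P_n\rho)$ (with $P_n$ the projection onto $\bigwedge^n\mathfrak h$), $\Gamma$ is trace class, and $\mathrm{Ex}\,\Gamma=\Gamma\,\mathrm{Ex}=-\Gamma$. - P-Condition: $\Gamma\ge0$. - G-Condition: $\mathrm{tr}\big((A^*\otimes A)(\Gamma+\mathrm{Ex}(\gamma\otimes1))\big)\ge|\mathrm{tr}(A\gamma)|^2$ for every bounded operator $A$ on $\mathfrak h$. Here the trace on the left is the limit of $\sum_{k,l\in S}\langle e_k\otimes e_l|\,\cdot\,(e_k\otimes e_l)\rangle$ as the finite set $S$ exhausts the index set of an orthonormal basis $\{e_k\}$ of $\mathfrak h$; it is required to exist and to be the same for every such basis. - Q-Condition: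 $\Gamma+(1-\mathrm{Ex})(1\otimes1-\gamma\otimes1-1\otimes\gamma)\ge0$. Moreover, if $\hat N\rho=N\rho$ for some $N\in\mathbb N_0$, then $\langle\hat N\rangle_\rho=N$, so that $\mathrm{tr}\,\gamma=N$ in the admissibility condition. -/

import Mathlib

noncomputable section

namespace FermionFock

open scoped TensorProduct ComplexOrder ENNReal
open UniformSpace

universe u

/-- A complex inner product space, bundled (used only to define tensor powers by recursion). -/
structure PreHilbert where
  carrier : Type u
  [group : NormedAddCommGroup carrier]
  [space : InnerProductSpace ℂ carrier]

section Tensor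

variable (H : Type u) [NormedAddCommGroup H] [InnerProductSpace ℂ H]

/-- The algebraic tensor powers of `H` with their inner products: `ℂ`, then `H ⊗ H^{⊗n}`. -/
def tensorPowAux : ℕ → PreHilbert.{u}
  | 0 => ⟨EuclideanSpace ℂ PUnit.{u + 1}⟩
  | n + 1 =>
    letI := (tensorPowAux n).group
    letI := (tensorPowAux n).space
    ⟨H ⊗[ℂ] (tensorPowAux n).carrier⟩

/-- The algebraic tensor power `H^{⊗n}`; its completion is the Hilbert space tensor power. -/
def TensorPow (n : ℕ) : Type u := (tensorPowAux H n).carrier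

instance instTensorPowGroup (n : ℕ) : NormedAddCommGroup (TensorPow H n) :=
  (tensorPowAux H n).group

instance instTensorPowSpace (n : ℕ) : InnerProductSpace ℂ (TensorPow H n) :=
  (tensorPowAux H n).space

variable {H}

/-- The map `x ↦ f ⊗ x`. -/
def consTensor (n : ℕ) (f : H) : TensorPow H n →L[ℂ] TensorPow H (n + 1) :=
  (TensorProduct.mkL ℂ H (TensorPow H n) f : TensorPow H n →L[ℂ] (H ⊗[ℂ] TensorPow H n))

/-- The elementary tensor `f₁ ⊗ ⋯ ⊗ fₙ`. -/
def elemTensor : (n : ℕ) → (Fin n → H) → TensorPow H n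
  | 0, _ => (EuclideanSpace.single PUnit.unit 1 : EuclideanSpace ℂ PUnit.{u + 1})
  | n + 1, f => consTensor n (f 0) (elemTensor n (Fin.tail f))

theorem inner_consTensor {n : ℕ} (f g : H) (x y : TensorPow H n) :
    inner ℂ (consTensor n f x) (consTensor n g y) = inner ℂ f g * inner ℂ x y :=
  TensorProduct.inner_tmul ℂ f g x y

theorem inner_elemTensor {n : ℕ} (f g : Fin n → H) :
    inner ℂ (elemTensor n f) (elemTensor n g) = ∏ i, inner ℂ (f i) (g i) := by
  induction n with
  | zero =>
    have : inner ℂ (EuclideanSpace.single PUnit.unit 1 : EuclideanSpace ℂ PUnit.{u + 1})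
      (EuclideanSpace.single PUnit.unit 1) = (1 : ℂ) := by simp
    exact this.trans (by simp)
  | succ n ih =>
    rw [elemTensor, elemTensor, inner_consTensor, ih, Fin.prod_univ_succ]
    rfl

/-- `f₁ ∧ ⋯ ∧ fₙ = (n!)^{-1/2} ∑_σ sign(σ) f_{σ(1)} ⊗ ⋯ ⊗ f_{σ(n)}`. -/
def wedge (n : ℕ) (f : Fin n → H) : Completion (TensorPow H n) :=
  ((Real.sqrt n.factorial : ℂ)⁻¹) •
    ∑ σ : Equiv.Perm (Fin n), ((Equiv.Perm.sign σ : ℤ) : ℂ) •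
      (elemTensor n (f ∘ σ) : Completion (TensorPow H n))

theorem inner_elemTensor_wedge {n : ℕ} (f g : Fin n → H) :
    inner ℂ (elemTensor n f : Completion (TensorPow H n)) (wedge n g) =
      (Real.sqrt n.factorial : ℂ)⁻¹ * (Matrix.of fun i j => inner ℂ (f i) (g j)).det := by
  rw [wedge, inner_smul_right, inner_sum, ← Matrix.det_transpose, Matrix.det_apply']
  congr 1
  refine Finset.sum_congr rfl fun σ _ => ?_
  rw [inner_smul_right, Completion.inner_coe, inner_elemTensor]
  simp [Matrix.transpose_apply]

theorem sqrt_factorial_mul_self (n : ℕ) :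
    (Real.sqrt n.factorial : ℂ) * (Real.sqrt n.factorial : ℂ) = n.factorial := by
  rw [← Complex.ofReal_mul, Real.mul_self_sqrt (by positivity)]; simp

theorem sqrt_factorial_ne_zero (n : ℕ) : (Real.sqrt n.factorial : ℂ) ≠ 0 := by
  have : (0:ℝ) < n.factorial := by exact_mod_cast n.factorial_pos
  exact_mod_cast (Real.sqrt_pos.2 this).ne'

theorem wedge_comp_perm {n : ℕ} (f : Fin n → H) (σ : Equiv.Perm (Fin n)) :
    wedge n (f ∘ σ) = ((Equiv.Perm.sign σ : ℤ) : ℂ) • wedge n f := by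
  rw [wedge, wedge, smul_comm]
  congr 1
  rw [Finset.smul_sum, ← Equiv.sum_comp (Equiv.mulLeft σ) (fun π =>
    ((Equiv.Perm.sign σ : ℤ) : ℂ) • ((Equiv.Perm.sign π : ℤ) : ℂ) •
      (elemTensor n (f ∘ π) : Completion (TensorPow H n)))]
  refine Finset.sum_congr rfl fun π _ => ?_
  rw [smul_smul, Equiv.coe_mulLeft, Equiv.Perm.sign_mul, Equiv.Perm.coe_mul, Function.comp_assoc]
  congr 1
  push_cast
  rw [← mul_assoc, ← Int.cast_mul, ← Units.val_mul, Int.units_mul_self]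
  simp

theorem inner_wedge {n : ℕ} (f g : Fin n → H) :
    inner ℂ (wedge n f) (wedge n g) = (Matrix.of fun i j => inner ℂ (f i) (g j)).det := by
  have key : ∀ σ : Equiv.Perm (Fin n),
      inner ℂ (elemTensor n (f ∘ σ) : Completion (TensorPow H n)) (wedge n g) =
        ((Equiv.Perm.sign σ : ℤ) : ℂ) * ((Real.sqrt n.factorial : ℂ)⁻¹ *
          (Matrix.of fun i j => inner ℂ (f i) (g j)).det) := by
    intro σ
    rw [inner_elemTensor_wedge, mul_left_comm, ← Matrix.det_permute]
    rfl
  conv_lhs => rw [wedge, inner_smul_left, sum_inner]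
  simp_rw [inner_smul_left, key, ← mul_assoc]
  have h1 : ∀ σ : Equiv.Perm (Fin n), (starRingEnd ℂ) ((Equiv.Perm.sign σ : ℤ) : ℂ) *
      ((Equiv.Perm.sign σ : ℤ) : ℂ) = 1 := by
    intro σ
    rw [map_intCast, ← Int.cast_mul, ← Units.val_mul, Int.units_mul_self]
    simp
  simp_rw [h1]
  simp only [one_mul, Finset.sum_const, Finset.card_univ, Fintype.card_perm, Fintype.card_fin,
    nsmul_eq_mul, map_inv₀, Complex.conj_ofReal]
  rw [← sqrt_factorial_mul_self]
  have := sqrt_factorial_ne_zero n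
  field_simp

variable (H) in
/-- The antisymmetric `n`-particle space: the closed span of the wedge products, which is the range
of the antisymmetrizing orthogonal projection of the `n`-fold Hilbert space tensor power. -/
def FockSector (n : ℕ) : Submodule ℂ (Completion (TensorPow H n)) :=
  (Submodule.span ℂ (Set.range (wedge (H := H) n))).topologicalClosure

instance instFockSectorComplete (n : ℕ) : CompleteSpace (FockSector H n) :=
  (Submodule.isClosed_topologicalClosure _).completeSpace_coe

theorem wedge_mem (n : ℕ) (f : Fin n → H) : wedge n f ∈ FockSector H n :=
  Submodule.le_topologicalClosure _ (Submodule.subset_span ⟨f, rfl⟩)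

/-- `c*(f)` on the `n`-particle space: `ψ ↦ √(n+1) A_{n+1} (f ⊗ ψ)`, with `A_{n+1}` the orthogonal
projection onto the antisymmetric subspace. See `createSector_wedge`. -/
def createSector (n : ℕ) (f : H) : FockSector H n →L[ℂ] FockSector H (n + 1) :=
  (Real.sqrt (n + 1) : ℂ) •
    ((FockSector H (n + 1)).orthogonalProjectionOnto ∘L (consTensor n f).completion ∘L
      (FockSector H n).subtypeL)

theorem projection_elemTensor {n : ℕ} (f : Fin n → H) :
    (FockSector H n).starProjection (elemTensor n f : Completion (TensorPow H n)) =
      (Real.sqrt n.factorial : ℂ)⁻¹ • wedge n f := by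
  refine Submodule.eq_starProjection_of_mem_of_inner_eq_zero
    (Submodule.smul_mem _ _ (wedge_mem n f)) ?_
  have hc : IsClosed {w : Completion (TensorPow H n) |
      inner ℂ ((elemTensor n f : Completion (TensorPow H n)) -
        (Real.sqrt n.factorial : ℂ)⁻¹ • wedge n f) w = 0} :=
    isClosed_eq (by fun_prop) continuous_const
  intro w hw
  refine (closure_minimal ?_ hc) hw
  intro w hw
  refine Submodule.span_induction ?_ (by simp) ?_ ?_ hw
  · rintro _ ⟨g, rfl⟩
    rw [Set.mem_ofPred_eq, inner_sub_left, inner_smul_left, inner_elemTensor_wedge, inner_wedge]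
    simp
  · intro x y _ _ hx hy
    simp only [Set.mem_ofPred_eq] at hx hy ⊢
    rw [inner_add_right, hx, hy, add_zero]
  · intro a x _ hx
    simp only [Set.mem_ofPred_eq] at hx ⊢
    rw [inner_smul_right, hx, mul_zero]

/-- `c*(f) (g₁ ∧ ⋯ ∧ gₙ) = f ∧ g₁ ∧ ⋯ ∧ gₙ`. -/
theorem createSector_wedge {n : ℕ} (f : H) (g : Fin n → H) :
    (createSector n f ⟨wedge n g, wedge_mem n g⟩ : Completion (TensorPow H (n + 1))) =
      wedge (n + 1) (Fin.cons f g) := by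
  have h1 : (consTensor n f).completion (wedge n g) =
      (Real.sqrt n.factorial : ℂ)⁻¹ • ∑ σ : Equiv.Perm (Fin n), ((Equiv.Perm.sign σ : ℤ) : ℂ) •
        (elemTensor (n + 1) (Fin.cons f (g ∘ σ)) : Completion (TensorPow H (n + 1))) := by
    rw [wedge, map_smul, map_sum]
    congr 1
    refine Finset.sum_congr rfl fun σ _ => ?_
    rw [map_smul, ContinuousLinearMap.completion_apply_coe]
    rfl
  have h2 : (createSector n f ⟨wedge n g, wedge_mem n g⟩ : Completion (TensorPow H (n + 1))) =
      (Real.sqrt (n + 1) : ℂ) • (FockSector H (n + 1)).starProjection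
        ((consTensor n f).completion (wedge n g)) := rfl
  have h3 : ∀ σ : Equiv.Perm (Fin n), wedge (n + 1) (Fin.cons f (g ∘ σ)) =
      ((Equiv.Perm.sign σ : ℤ) : ℂ) • wedge (n + 1) (Fin.cons f g) := by
    intro σ
    have : (Fin.cons f (g ∘ σ) : Fin (n + 1) → H) =
        (Fin.cons f g : Fin (n + 1) → H) ∘ (Equiv.Perm.decomposeFin.symm (0, σ)) := by
      funext i
      refine Fin.cases ?_ (fun j => ?_) i <;> simp
    rw [this, wedge_comp_perm]
    simp
  rw [h2, h1, map_smul, map_sum]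
  simp_rw [map_smul, projection_elemTensor, h3, smul_comm _ (Real.sqrt (n + 1).factorial : ℂ)⁻¹,
    smul_smul, ← Int.cast_mul, ← Units.val_mul, Int.units_mul_self, ← Finset.smul_sum]
  simp only [Units.val_one, Int.cast_one, Finset.sum_const, Finset.card_univ,
    Fintype.card_perm, Fintype.card_fin, ← Nat.cast_smul_eq_nsmul ℂ, smul_smul]
  convert one_smul ℂ _ using 2
  have h4 : (Real.sqrt (n + 1).factorial : ℂ) = Real.sqrt (n + 1) * Real.sqrt n.factorial := by
    rw [← Complex.ofReal_mul, ← Real.sqrt_mul (by positivity), Nat.factorial_succ]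
    push_cast; rfl
  have h5 := sqrt_factorial_ne_zero (n + 1)
  rw [h4] at h5 ⊢
  have h6 := left_ne_zero_of_mul h5
  have h7 := right_ne_zero_of_mul h5
  rw [← sqrt_factorial_mul_self]
  field_simp

/-- Contraction of `g₁ ∧ ⋯ ∧ gₙ₊₁` with `f`. -/
def contract (n : ℕ) (f : H) (g : Fin (n + 1) → H) : Completion (TensorPow H n) :=
  ∑ j : Fin (n + 1), ((-1 : ℂ) ^ (j : ℕ) * inner ℂ f (g j)) • wedge n (g ∘ j.succAbove)

theorem inner_wedge_cons {n : ℕ} (f : H) (g h : Fin (n + 1) → H) :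
    inner ℂ (wedge (n + 2) (Fin.cons f g)) (wedge (n + 2) (Fin.cons f h)) =
      inner ℂ f f * inner ℂ (wedge (n + 1) g) (wedge (n + 1) h) -
        inner ℂ (contract n f g) (contract n f h) := by
  rw [inner_wedge, inner_wedge, Matrix.det_succ_row_zero, Fin.sum_univ_succ, sub_eq_add_neg]
  congr 1
  · simp only [Fin.val_zero, pow_zero, one_mul, Matrix.of_apply, Fin.cons_zero, Fin.succAbove_zero]
    rfl
  · rw [contract, contract, inner_sum, ← Finset.sum_neg_distrib]
    refine Finset.sum_congr rfl fun j _ => ?_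
    rw [Matrix.det_succ_column_zero, sum_inner, Finset.mul_sum, ← Finset.sum_neg_distrib]
    refine Finset.sum_congr rfl fun i _ => ?_
    rw [inner_smul_left, inner_smul_right, inner_wedge]
    have : ((Matrix.of fun i j => inner ℂ ((Fin.cons f g : Fin (n + 2) → H) i)
        ((Fin.cons f h : Fin (n + 2) → H) j)).submatrix Fin.succ j.succ.succAbove).submatrix
        i.succAbove Fin.succ =
        Matrix.of fun a b => inner ℂ ((g ∘ i.succAbove) a) ((h ∘ j.succAbove) b) := by
      ext a b
      simp
    rw [this]
    simp [pow_succ]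
    ring

theorem norm_createSector_le (n : ℕ) (f : H) (ψ : FockSector H n) :
    ‖createSector n f ψ‖ ≤ ‖f‖ * ‖ψ‖ := by
  have hsum : ∀ c : (Fin n → H) →₀ ℂ, ∀ hψ : (c.sum fun g a => a • wedge n g) ∈ FockSector H n,
      ‖createSector n f ⟨c.sum fun g a => a • wedge n g, hψ⟩‖ ≤
        ‖f‖ * ‖c.sum fun g a => a • wedge n g‖ := by
    intro c hψ
    have h1 : (createSector n f ⟨c.sum fun g a => a • wedge n g, hψ⟩ :
        Completion (TensorPow H (n + 1))) = c.sum fun g a => a • wedge (n + 1) (Fin.cons f g) := by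
      have : (⟨c.sum fun g a => a • wedge n g, hψ⟩ : FockSector H n) =
          c.sum fun g a => a • ⟨wedge n g, wedge_mem n g⟩ := by
        apply Subtype.ext
        simp [Finsupp.sum]
      rw [this, map_finsuppSum]
      simp only [Finsupp.sum, map_smul, Submodule.coe_sum, Submodule.coe_smul, createSector_wedge]
    rw [← Submodule.norm_coe, h1]
    refine le_of_sq_le_sq ?_ (by positivity)
    rw [mul_pow]
    have hre : ∀ (m : ℕ) (v : (Fin n → H) → Completion (TensorPow H m)),
        ((‖c.sum fun g a => a • v g‖ ^ 2 : ℝ) : ℂ) = c.sum fun g a => c.sum fun h b =>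
          starRingEnd ℂ a * b * inner ℂ (v g) (v h) := by
      intro m v
      rw [Complex.ofReal_pow]
      refine (inner_self_eq_norm_sq_to_K (𝕜 := ℂ) (c.sum fun g a => a • v g)).symm.trans ?_
      simp only [Finsupp.sum, sum_inner, inner_sum, inner_smul_left, inner_smul_right,
        Finset.mul_sum]
      rw [Finset.sum_comm' (t' := c.support) (s' := fun _ => c.support) (by simp)]
      refine Finset.sum_congr rfl fun g _ => Finset.sum_congr rfl fun h _ => by ring
    have hf : ((‖f‖ ^ 2 : ℝ) : ℂ) = inner ℂ f f := by
      rw [Complex.ofReal_pow, inner_self_eq_norm_sq_to_K (𝕜 := ℂ)]; rfl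
    cases n with
    | zero =>
      refine le_of_eq ?_
      have : ((‖c.sum fun g a => a • wedge (0 + 1) (Fin.cons f g : Fin (0 + 1) → H)‖ ^ 2 : ℝ) : ℂ) =
          ((‖f‖ ^ 2 * ‖c.sum fun g a => a • wedge 0 g‖ ^ 2 : ℝ) : ℂ) := by
        rw [Complex.ofReal_mul, hre, hre, hf]
        simp only [Finsupp.sum, Finset.mul_sum, inner_wedge]
        refine Finset.sum_congr rfl fun g _ => Finset.sum_congr rfl fun h _ => ?_
        simp
        ring
      exact_mod_cast this
    | succ n =>
      have : ((‖c.sum fun g a => a • wedge (n + 1 + 1) (Fin.cons f g : Fin (n + 1 + 1) → H)‖ ^ 2 :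
          ℝ) : ℂ) = ((‖f‖ ^ 2 * ‖c.sum fun g a => a • wedge (n + 1) g‖ ^ 2 -
            ‖c.sum fun g a => a • contract n f g‖ ^ 2 : ℝ) : ℂ) := by
        rw [Complex.ofReal_sub, Complex.ofReal_mul, hre, hre, hre, hf]
        simp only [Finsupp.sum, Finset.mul_sum, ← Finset.sum_sub_distrib, inner_wedge_cons]
        refine Finset.sum_congr rfl fun g _ => Finset.sum_congr rfl fun h _ => by ring
      have h2 := Complex.ofReal_injective this
      rw [h2]
      exact sub_le_self _ (sq_nonneg _)
  obtain ⟨ψ, hψ⟩ := ψ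
  have hmem : ψ ∈ closure (Submodule.span ℂ (Set.range (wedge (H := H) n)) :
      Set (Completion (TensorPow H n))) := hψ
  obtain ⟨u, hu, hlim⟩ := mem_closure_iff_seq_limit.1 hmem
  have hu' : ∀ k, u k ∈ FockSector H n := fun k => Submodule.le_topologicalClosure _ (hu k)
  have hlim' : Filter.Tendsto (fun k => (⟨u k, hu' k⟩ : FockSector H n)) Filter.atTop
      (nhds ⟨ψ, hψ⟩) := tendsto_subtype_rng.2 hlim
  refine le_of_tendsto_of_tendsto' (((createSector n f).continuous.tendsto _).comp hlim').norm
    (hlim'.norm.const_mul ‖f‖) fun k => ?_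
  obtain ⟨c, hc⟩ := Finsupp.mem_span_range_iff_exists_finsupp.1 (hu k)
  have := hsum c (hc ▸ hu' k)
  simp only [hc] at this
  exact this

end Tensor

section Fock

variable (H : Type u) [NormedAddCommGroup H] [InnerProductSpace ℂ H]

/-- Fermion Fock space: the Hilbert space direct sum of the antisymmetric `n`-particle spaces. -/
abbrev Fock : Type u := lp (fun n : ℕ => FockSector H n) 2

variable {H}

/-- `c*(f)` on sequences of `n`-particle components. -/
def createFun (f : H) (ψ : (n : ℕ) → FockSector H n) : (n : ℕ) → FockSector H n
  | 0 => 0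
  | n + 1 => createSector n f (ψ n)

theorem hasSum_norm_sq (ψ : Fock H) : HasSum (fun n => ‖ψ n‖ ^ 2) (‖ψ‖ ^ 2) := by
  have := lp.hasSum_norm (p := 2) (by norm_num) ψ
  simpa using this

theorem summable_createFun (f : H) (ψ : Fock H) :
    Summable fun n => ‖createFun f ψ n‖ ^ 2 := by
  rw [← summable_nat_add_iff 1]
  refine Summable.of_nonneg_of_le (fun n => by positivity) (fun n => ?_)
    ((hasSum_norm_sq ψ).summable.mul_left (‖f‖ ^ 2))
  rw [← mul_pow]
  exact pow_le_pow_left₀ (norm_nonneg _) (norm_createSector_le n f (ψ n)) 2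

theorem memℓp_createFun (f : H) (ψ : Fock H) : Memℓp (createFun f ψ) 2 :=
  memℓp_gen (by simpa using summable_createFun f ψ)

theorem norm_createFun_le (f : H) (ψ : Fock H) :
    ‖(⟨createFun f ψ, memℓp_createFun f ψ⟩ : Fock H)‖ ≤ ‖f‖ * ‖ψ‖ := by
  have h1 := hasSum_norm_sq (⟨createFun f ψ, memℓp_createFun f ψ⟩ : Fock H)
  have h2 : HasSum (fun n => ‖createFun f ψ (n + 1)‖ ^ 2)
      (‖(⟨createFun f ψ, memℓp_createFun f ψ⟩ : Fock H)‖ ^ 2) := by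
    rw [hasSum_nat_add_iff (f := fun n => ‖createFun f ψ n‖ ^ 2) 1]
    have h0 : ‖createFun f ψ 0‖ ^ 2 = 0 := by simp [createFun]
    rw [Finset.sum_range_one, h0, add_zero]
    exact h1
  have h3 := (hasSum_norm_sq ψ).mul_left (‖f‖ ^ 2)
  rw [← mul_pow] at h3
  refine le_of_sq_le_sq (hasSum_le (fun n => ?_) h2 h3) (by positivity)
  rw [← mul_pow]
  exact pow_le_pow_left₀ (norm_nonneg _) (norm_createSector_le n f (ψ n)) 2

/-- The creation operator `c*(f)` as a bounded operator on Fock space. -/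
def create (f : H) : Fock H →L[ℂ] Fock H :=
  LinearMap.mkContinuous
    { toFun := fun ψ => ⟨createFun f ψ, memℓp_createFun f ψ⟩
      map_add' := fun ψ χ => by
        ext n : 2
        cases n with
        | zero => exact (add_zero _).symm
        | succ n => exact map_add (createSector n f) (ψ n) (χ n)
      map_smul' := fun a ψ => by
        ext n : 2
        cases n with
        | zero => exact (smul_zero a).symm
        | succ n => exact map_smul (createSector n f) a (ψ n) }
    ‖f‖ (norm_createFun_le f)

/-- The annihilation operator `c(f) = (c*(f))*`. -/
def annihilate (f : H) : Fock H →L[ℂ] Fock H :=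
  ContinuousLinearMap.adjoint (create f)

variable (H) in
/-- The number operator, multiplication by `n` on the `n`-particle space, on its maximal domain. -/
def numberOp : Fock H →ₗ.[ℂ] Fock H where
  domain :=
    { carrier := {ψ | Memℓp (fun n : ℕ => (n : ℂ) • ψ n) 2}
      zero_mem' := by
        have : (fun n : ℕ => (n : ℂ) • (0 : Fock H) n) = 0 := funext fun n => smul_zero _
        change Memℓp (fun n : ℕ => (n : ℂ) • (0 : Fock H) n) 2
        rw [this]
        exact zero_memℓp
      add_mem' := fun {ψ χ} hψ hχ => by
        have : (fun n : ℕ => (n : ℂ) • (ψ + χ) n) =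
            (fun n : ℕ => (n : ℂ) • ψ n) + fun n : ℕ => (n : ℂ) • χ n :=
          funext fun n => smul_add _ _ _
        change Memℓp (fun n : ℕ => (n : ℂ) • (ψ + χ) n) 2
        rw [this]
        exact Memℓp.add hψ hχ
      smul_mem' := fun a ψ hψ => by
        have : (fun n : ℕ => (n : ℂ) • (a • ψ) n) = a • fun n : ℕ => (n : ℂ) • ψ n :=
          funext fun n => smul_comm (n : ℂ) a (ψ n)
        change Memℓp (fun n : ℕ => (n : ℂ) • (a • ψ) n) 2
        rw [this]
        exact Memℓp.const_smul hψ a }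
  toFun :=
    { toFun := fun ψ => ⟨fun n => (n : ℂ) • (ψ : Fock H) n, ψ.2⟩
      map_add' := fun ψ χ => by
        ext n : 2
        exact smul_add _ _ _
      map_smul' := fun a ψ => by
        ext n : 2
        exact smul_comm (n : ℂ) a ((ψ : Fock H) n) }

variable (H) in
/-- The orthogonal projection of Fock space onto the `n`-particle space. -/
def sectorProj (n : ℕ) : Fock H →L[ℂ] Fock H :=
  lp.singleContinuousLinearMap ℂ (fun n : ℕ => FockSector H n) 2 n ∘L
    lp.evalCLM ℂ (fun n : ℕ => FockSector H n) 2 n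

end Fock

section TraceClass

variable (E : Type u) [NormedAddCommGroup E] [InnerProductSpace ℂ E] [CompleteSpace E]

/-- The index set of a fixed orthonormal basis of `E`. -/
def onbIndex : Set E := (exists_hilbertBasis ℂ E).choose

/-- A fixed orthonormal basis of `E`. Traces do not depend on this choice. -/
def onb : HilbertBasis (onbIndex E) ℂ E := (exists_hilbertBasis ℂ E).choose_spec.choose

variable {E}

/-- `T` is trace class: `tr |T| = ∑ᵢ ⟨eᵢ, |T| eᵢ⟩ < ∞`, where `|T| = (T* T)^{1/2}`. -/
def IsTraceClass (T : E →L[ℂ] E) : Prop :=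
  Summable fun i => ‖inner ℂ (onb E i) (CFC.abs T (onb E i))‖

/-- `|T|^{1/2}`. -/
def sqrtAbs (T : E →L[ℂ] E) : E →L[ℂ] E := CFC.sqrt (CFC.abs T)

/-- The trace of a trace class operator. -/
def trace (T : E →L[ℂ] E) : ℂ :=
  ∑' i, inner ℂ (onb E i) (T (onb E i))

end TraceClass

section States

variable {H : Type u} [NormedAddCommGroup H] [InnerProductSpace ℂ H]

/-- `[N̂, ρ] = 0` for the unbounded operator `N̂` and the bounded operator `ρ`, that is,
`ρ N̂ ⊆ N̂ ρ`. -/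
def CommutesWithNumber (ρ : Fock H →L[ℂ] Fock H) : Prop :=
  ∀ ψ : (numberOp H).domain, ∃ h : ρ ψ ∈ (numberOp H).domain,
    numberOp H ⟨ρ ψ, h⟩ = ρ (numberOp H ψ)

/-- `N̂ ρ = N ρ`. -/
def HasParticleNumber (ρ : Fock H →L[ℂ] Fock H) (N : ℕ) : Prop :=
  ∀ ψ : Fock H, ∃ h : ρ ψ ∈ (numberOp H).domain, numberOp H ⟨ρ ψ, h⟩ = (N : ℂ) • ρ ψ

/-- `tr (|ρ|^{1/2} N̂² |ρ|^{1/2}) < ∞`, the trace being `∑ᵢ ‖N̂ |ρ|^{1/2} eᵢ‖²`. -/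
def FiniteNumberSq (ρ : Fock H →L[ℂ] Fock H) : Prop :=
  ∃ h : ∀ i, sqrtAbs ρ (onb (Fock H) i) ∈ (numberOp H).domain,
    Summable fun i => ‖numberOp H ⟨sqrtAbs ρ (onb (Fock H) i), h i⟩‖ ^ 2

/-- `tr (N̂ ρ) = ∑ₙ n tr (Pₙ ρ)`, with `Pₙ` the projection onto the `n`-particle space. -/
def numberExpectation (ρ : Fock H →L[ℂ] Fock H) : ℂ :=
  ∑' n : ℕ, (n : ℂ) * trace (sectorProj H n * ρ)

/-- The polynomials of degree at most `r` in the operators `c*(φ_k)` and `c(φ_k)`. -/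
def ladderPolynomials {ι : Type*} (φ : ι → H) (r : ℕ) :
    Submodule ℂ (Fock H →L[ℂ] Fock H) :=
  Submodule.span ℂ
    ({1} ∪ Set.range (fun k => create (φ k)) ∪ Set.range (fun k => annihilate (φ k))) ^ r

variable (H) in
/-- The Hilbert space tensor product of `H` with itself. -/
abbrev HTensor : Type u := Completion (H ⊗[ℂ] H)

/-- The elementary tensor `f ⊗ g` in the Hilbert space tensor product. -/
def pairTensor (f g : H) : HTensor H := ((f ⊗ₜ[ℂ] g : H ⊗[ℂ] H) : HTensor H)

/-- The bounded operator `A ⊗ B`. -/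
def opTensor (A B : H →L[ℂ] H) : HTensor H →L[ℂ] HTensor H :=
  (TensorProduct.mapL A B).completion

variable (H) in
/-- The exchange operator `f ⊗ g ↦ g ⊗ f`. -/
def exchange : HTensor H →L[ℂ] HTensor H :=
  ((TensorProduct.commIsometry ℂ H H : (H ⊗[ℂ] H) ≃ₗᵢ[ℂ] (H ⊗[ℂ] H)) :
    (H ⊗[ℂ] H) →L[ℂ] (H ⊗[ℂ] H)).completion

theorem opTensor_pairTensor (A B : H →L[ℂ] H) (f g : H) :
    opTensor A B (pairTensor f g) = pairTensor (A f) (B g) :=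
  ContinuousLinearMap.completion_apply_coe _ _

theorem exchange_pairTensor (f g : H) : exchange H (pairTensor f g) = pairTensor g f :=
  ContinuousLinearMap.completion_apply_coe _ _

/-- `γ` is the one-particle density matrix of `ρ`. -/
def IsOnePDM (ρ : Fock H →L[ℂ] Fock H) (γ : H →L[ℂ] H) : Prop :=
  ∀ f g : H, inner ℂ f (γ g) = trace (ρ * (create g * annihilate f))

/-- `Γ` is the two-particle density matrix of `ρ`. -/
def IsTwoPDM (ρ : Fock H →L[ℂ] Fock H) (Γ : HTensor H →L[ℂ] HTensor H) : Prop :=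
  ∀ f₁ f₂ g₁ g₂ : H, inner ℂ (pairTensor f₁ f₂) (Γ (pairTensor g₁ g₂)) =
    trace (ρ * (create g₂ * create g₁ * annihilate f₁ * annihilate f₂))

/-- `t` is the trace of `T` over the tensor product, computed along product bases `e_k ⊗ e_l` with
`k, l` in a common finite set that exhausts the index set, whatever the orthonormal basis `e`. For
a trace class `T` this is the usual trace; it also gives a meaning to the trace of bounded
operators such as `(A* ⊗ A) Ex (γ ⊗ 1)` with `γ` trace class, which need not be trace class. -/
def HasPairTrace (T : HTensor H →L[ℂ] HTensor H) (t : ℂ) : Prop :=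
  ∀ (w : Set H) (e : HilbertBasis w ℂ H),
    Filter.Tendsto (fun s : Finset w => ∑ k ∈ s, ∑ l ∈ s,
      inner ℂ (pairTensor (e k) (e l)) (T (pairTensor (e k) (e l)))) Filter.atTop (nhds t)

variable [CompleteSpace H]

/-- Admissible pairs `(γ, Γ)` with `tr γ = N`. -/
def IsAdmissible (N : ℂ) (γ : H →L[ℂ] H) (Γ : HTensor H →L[ℂ] HTensor H) : Prop :=
  IsTraceClass γ ∧ 0 ≤ γ ∧ γ ≤ 1 ∧ trace γ = N ∧
    IsTraceClass Γ ∧ exchange H * Γ = -Γ ∧ Γ * exchange H = -Γ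

/-- The P-Condition. -/
def PCondition (Γ : HTensor H →L[ℂ] HTensor H) : Prop := 0 ≤ Γ

/-- The G-Condition. The order on `ℂ` is used: the trace is real and bounded below. -/
def GCondition (γ : H →L[ℂ] H) (Γ : HTensor H →L[ℂ] HTensor H) : Prop :=
  ∀ A : H →L[ℂ] H, ∃ t : ℂ,
    HasPairTrace (opTensor (star A) A * (Γ + exchange H * opTensor γ 1)) t ∧
      ((‖trace (A * γ)‖ ^ 2 : ℝ) : ℂ) ≤ t

/-- The Q-Condition. -/
def QCondition (γ : H →L[ℂ] H) (Γ : HTensor H →L[ℂ] HTensor H) : Prop :=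
  0 ≤ Γ + (1 - exchange H) * (opTensor 1 1 - opTensor γ 1 - opTensor 1 γ)

end States

end FermionFock

end

noncomputable section

namespace FermionFock

open scoped TensorProduct ComplexOrder InnerProductSpace
open UniformSpace Filter Topology

universe u

/-! ### Creation and annihilation operators on Fock space: contraction formula and anticommutation
relations. -/

section Ladder

variable {H : Type u} [NormedAddCommGroup H] [InnerProductSpace ℂ H]

/-! Write `ω X = tr (ρ X)`. Since `ρ` commutes with the number operator and has a finite second
number moment, the polar decomposition of `ρ` yields a series `ω X = ∑ₐ ⟨yₐ, X xₐ⟩` in which `xₐ`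
and `yₐ` lie in the same `nₐ`-particle space and `∑ₐ (nₐ + 1)² ‖xₐ‖ ‖yₐ‖ < ∞`
(`exists_numberExpansion`). Everything else uses only this series, the anticommutation relations and
the grading.

The weight `(n + 1)²` controls two-body quantities. The second quantization `dΓ(A)` has norm at most
`n ‖A‖` on the `n`-particle space, so the expectations `tau A` of `dΓ(A)` and `kappa A B` of `dΓ(A)
dΓ(B)` are defined for all bounded `A`, `B`, and they are continuous under bounded strong
convergence (`tendsto_tau`, `tendsto_kappa`). A pair annihilator with amplitude `ξ` has norm at most
`n ‖ξ‖` there, so the form defining `Γ` is bounded.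

A polynomial of degree at most two has a normal form `(a + D) + c(f) + c*(g) + (pair annihilator) +
(pair creator)`, with `D` a finite sum of terms `c*(u) c(v)`. The five parts change the particle
number by `0, -1, 1, -2, 2`, and `ω` sees only number-conserving operators, so `ω(P* P)` is the sum
of the five diagonal terms. Nonnegativity of the last four means `γ ≥ 0`, `γ ≤ 1`, `Γ ≥ 0` and the
Q-Condition, by normal ordering. For the first, completing the square in `a` leaves `ω(D* D) ≥
|ω(D)|²`; with `D = dΓ(A)` for a finite rank `A`, this is the G-Condition for `A`.

For general `A`, the partial sums of the trace in the G-Condition are, by normal ordering, exactly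
`kappa (P_s A*) (P_s A)` with finite rank projections `P_s` (`pair_sum_eq`), so they converge to
`kappa A* A` in every basis, and `tr (A γ) = tau A`. The inequality passes from the compressions
`P_s A P_s` to `A` by continuity. Trace class of `γ` and `Γ` follows from positivity and convergence
of the diagonal sums; for `Γ` these are bounded by `kappa 1 1`. -/

/-- The vector `g₁ ∧ ⋯ ∧ gₙ` of Fock space. -/
def fockWedge (n : ℕ) (g : Fin n → H) : Fock H :=
  lp.single 2 n ⟨wedge n g, wedge_mem n g⟩

variable (H) in
/-- The `n`-particle subspace of Fock space. -/
def sector (n : ℕ) : Submodule ℂ (Fock H) := 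
  LinearMap.eqLocus (sectorProj H n : Fock H →ₗ[ℂ] Fock H) LinearMap.id

theorem sectorProj_apply (n : ℕ) (ψ : Fock H) : sectorProj H n ψ = lp.single 2 n (ψ n) := rfl

theorem mem_sector {n : ℕ} {ψ : Fock H} : ψ ∈ sector H n ↔ sectorProj H n ψ = ψ := Iff.rfl

theorem single_mem_sector (n : ℕ) (x : FockSector H n) :
    (lp.single 2 n x : Fock H) ∈ sector H n := by
  rw [mem_sector, sectorProj_apply, lp.single_apply_self]

theorem fockWedge_mem_sector (n : ℕ) (g : Fin n → H) : fockWedge n g ∈ sector H n :=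
  single_mem_sector _ _

theorem sectorProj_mem_sector (n : ℕ) (ψ : Fock H) : sectorProj H n ψ ∈ sector H n :=
  single_mem_sector _ _

theorem apply_eq_zero_of_mem_sector {n m : ℕ} (h : m ≠ n) {ψ : Fock H} (hψ : ψ ∈ sector H n) :
    ψ m = 0 := by
  rw [← mem_sector.1 hψ, sectorProj_apply, lp.single_apply_ne _ _ _ h]

theorem sectorProj_eq_zero_of_mem_sector {n m : ℕ} (h : m ≠ n) {ψ : Fock H}
    (hψ : ψ ∈ sector H n) : sectorProj H m ψ = 0 := by
  rw [sectorProj_apply, apply_eq_zero_of_mem_sector h hψ, lp.single_zero]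

theorem inner_eq_zero_of_mem_sector {n m : ℕ} (h : m ≠ n) {ψ χ : Fock H} (hψ : ψ ∈ sector H m)
    (hχ : χ ∈ sector H n) : inner ℂ ψ χ = 0 := by
  rw [← mem_sector.1 hψ, sectorProj_apply, lp.inner_single_left,
    apply_eq_zero_of_mem_sector h hχ, inner_zero_right]

theorem mem_sector_of_apply_eq_zero {n : ℕ} {ψ : Fock H} (h : ∀ m, m ≠ n → ψ m = 0) :
    ψ ∈ sector H n := by
  rw [mem_sector, sectorProj_apply]
  ext m : 2
  by_cases hm : m = n
  · subst hm; exact lp.single_apply_self _ _ _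
  · rw [lp.single_apply_ne _ _ _ hm, h m hm]

theorem hasSum_sectorProj (ψ : Fock H) : HasSum (fun n => sectorProj H n ψ) ψ :=
  lp.hasSum_single (by norm_num) ψ

theorem isClosed_sector (n : ℕ) : IsClosed (sector H n : Set (Fock H)) :=
  isClosed_eq (sectorProj H n).continuous continuous_id

/-- This density lets identities between bounded operators on Fock space be tested on wedge
products, as in `eqOn_sector` and `ext_fockWedge`. -/
theorem sector_eq_closure (n : ℕ) :
    sector H n = (Submodule.span ℂ (Set.range (fockWedge (H := H) n))).topologicalClosure := by
  apply le_antisymm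
  · intro ψ hψ
    rw [← mem_sector.1 hψ, sectorProj_apply]
    obtain ⟨v, hv⟩ := ψ n
    have hmem : v ∈ closure (Submodule.span ℂ (Set.range (wedge (H := H) n)) :
      Set (Completion (TensorPow H n))) := hv
    obtain ⟨u, hu, hlim⟩ := mem_closure_iff_seq_limit.1 hmem
    have hu' : ∀ k, u k ∈ FockSector H n := fun k => Submodule.le_topologicalClosure _ (hu k)
    have hlim' : Tendsto (fun k => (⟨u k, hu' k⟩ : FockSector H n)) atTop (𝓝 ⟨v, hv⟩) :=
      tendsto_subtype_rng.2 hlim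
    refine mem_closure_of_tendsto (((lp.singleContinuousLinearMap ℂ
      (fun n : ℕ => FockSector H n) 2 n).continuous.tendsto _).comp hlim')
      (Eventually.of_forall fun k => ?_)
    -- Membership in `FockSector H n` is quantified inside the claim so that the span induction can
    -- supply it for each summand.
    have key : ∀ w, w ∈ Submodule.span ℂ (Set.range (wedge (H := H) n)) →
        ∀ hw : w ∈ FockSector H n, lp.singleContinuousLinearMap ℂ
      (fun n : ℕ => FockSector H n) 2 n ⟨w, hw⟩ ∈
          Submodule.span ℂ (Set.range (fockWedge (H := H) n)) := by
      intro w hw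
      refine Submodule.span_induction ?_ ?_ ?_ ?_ hw
      · rintro _ ⟨g, rfl⟩ _
        exact Submodule.subset_span ⟨g, rfl⟩
      · intro h0
        have : (⟨0, h0⟩ : FockSector H n) = 0 := rfl
        rw [this, map_zero]
        exact Submodule.zero_mem _
      · intro a b ha hb iha ihb hab
        have ha' : a ∈ FockSector H n := Submodule.le_topologicalClosure _ ha
        have hb' : b ∈ FockSector H n := Submodule.le_topologicalClosure _ hb
        have : (⟨a + b, hab⟩ : FockSector H n) = ⟨a, ha'⟩ + ⟨b, hb'⟩ := rfl
        rw [this, map_add]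
        exact Submodule.add_mem _ (iha ha') (ihb hb')
      · intro c a ha iha hca
        have ha' : a ∈ FockSector H n := Submodule.le_topologicalClosure _ ha
        have : (⟨c • a, hca⟩ : FockSector H n) = c • ⟨a, ha'⟩ := rfl
        rw [this, map_smul]
        exact Submodule.smul_mem _ _ (iha ha')
    exact key (u k) (hu k) (hu' k)
  · refine Submodule.topologicalClosure_minimal _ ?_ (isClosed_sector n)
    rw [Submodule.span_le]
    rintro _ ⟨g, rfl⟩
    exact fockWedge_mem_sector n g

theorem eqOn_sector {E : Type*} [NormedAddCommGroup E] [NormedSpace ℂ E] {n : ℕ}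
    {S T : Fock H →L[ℂ] E} (h : ∀ g, S (fockWedge n g) = T (fockWedge n g)) {ψ : Fock H}
    (hψ : ψ ∈ sector H n) : S ψ = T ψ := by
  have h1 : (sector H n) ≤ S.eqLocus T := by
    rw [sector_eq_closure]
    refine Submodule.topologicalClosure_minimal _ ?_ (isClosed_eq S.continuous T.continuous)
    rw [Submodule.span_le]
    rintro _ ⟨g, rfl⟩
    exact h g
  exact h1 hψ

theorem ext_sector {E : Type*} [NormedAddCommGroup E] [NormedSpace ℂ E]
    {S T : Fock H →L[ℂ] E} (h : ∀ n, ∀ ψ ∈ sector H n, S ψ = T ψ) : S = T := by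
  ext ψ
  have h1 := (hasSum_sectorProj ψ).mapL S
  have h2 := (hasSum_sectorProj ψ).mapL T
  refine h1.unique ?_
  convert h2 using 2 with n
  exact h n _ (sectorProj_mem_sector n ψ)

theorem ext_fockWedge {E : Type*} [NormedAddCommGroup E] [NormedSpace ℂ E]
    {S T : Fock H →L[ℂ] E} (h : ∀ n g, S (fockWedge n g) = T (fockWedge n g)) : S = T :=
  ext_sector fun n _ hψ => eqOn_sector (h n) hψ

theorem ext_inner_fockWedge {χ η : Fock H}
    (h : ∀ n g, inner ℂ χ (fockWedge n g) = inner ℂ η (fockWedge n g)) : χ = η := by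
  have : innerSL ℂ χ = innerSL ℂ η := ext_fockWedge h
  refine ext_inner_right ℂ fun v => ?_
  exact DFunLike.congr_fun this v

theorem create_single (f : H) (n : ℕ) (x : FockSector H n) :
    create f (lp.single 2 n x) = lp.single 2 (n + 1) (createSector n f x) := by
  ext m : 2
  change createFun f _ m = _
  cases m with
  | zero => rw [lp.single_apply_ne _ _ _ (by omega)]; rfl
  | succ m =>
    change createSector m f _ = _
    by_cases hm : m = n
    · subst hm; rw [lp.single_apply_self, lp.single_apply_self]
    · rw [lp.single_apply_ne _ _ _ hm, lp.single_apply_ne _ _ _ (by omega), map_zero]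

theorem create_fockWedge (f : H) {n : ℕ} (g : Fin n → H) :
    create f (fockWedge n g) = fockWedge (n + 1) (Fin.cons f g) := by
  rw [fockWedge, create_single, fockWedge]
  congr 1
  exact Subtype.ext (createSector_wedge f g)

theorem create_mem_sector (f : H) {n : ℕ} {ψ : Fock H} (hψ : ψ ∈ sector H n) :
    create f ψ ∈ sector H (n + 1) := by
  rw [← mem_sector.1 hψ, sectorProj_apply, create_single]
  exact single_mem_sector _ _

theorem norm_create_le (f : H) : ‖create f‖ ≤ ‖f‖ :=
  LinearMap.mkContinuous_norm_le _ (norm_nonneg f) _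

theorem inner_fockWedge {n : ℕ} (f g : Fin n → H) :
    inner ℂ (fockWedge n f) (fockWedge n g) =
      (Matrix.of fun i j => inner ℂ (f i) (g j)).det := by
  rw [fockWedge, fockWedge, lp.inner_single_left, lp.single_apply_self, Submodule.coe_inner,
    inner_wedge]

theorem fockWedge_comp_perm {n : ℕ} (f : Fin n → H) (σ : Equiv.Perm (Fin n)) :
    fockWedge n (f ∘ σ) = ((Equiv.Perm.sign σ : ℤ) : ℂ) • fockWedge n f := by
  rw [fockWedge, fockWedge, ← lp.single_smul]
  congr 1
  exact Subtype.ext (wedge_comp_perm f σ)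

theorem annihilate_fockWedge_zero (f : H) (g : Fin 0 → H) : annihilate f (fockWedge 0 g) = 0 := by
  refine ext_inner_fockWedge fun n h => ?_
  rw [annihilate, ContinuousLinearMap.adjoint_inner_left, inner_zero_left, create_fockWedge]
  exact inner_eq_zero_of_mem_sector (by omega) (fockWedge_mem_sector _ _)
    (fockWedge_mem_sector _ _)

/-- Pairing with `h` turns `c(f)` into the Gram determinant of `f ∧ h` against `g`; Laplace
expansion along the row of `f` gives the contraction. -/
theorem annihilate_fockWedge_succ (f : H) {n : ℕ} (g : Fin (n + 1) → H) :
    annihilate f (fockWedge (n + 1) g) = ∑ j : Fin (n + 1),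
      ((-1 : ℂ) ^ (j : ℕ) * inner ℂ f (g j)) • fockWedge n (g ∘ j.succAbove) := by
  refine ext_inner_fockWedge fun m h => ?_
  rw [annihilate, ContinuousLinearMap.adjoint_inner_left, create_fockWedge]
  by_cases hm : n = m
  · subst hm
    rw [← inner_conj_symm, inner_fockWedge, Matrix.det_succ_row_zero, sum_inner, map_sum]
    refine Finset.sum_congr rfl fun j _ => ?_
    rw [inner_smul_left, ← inner_conj_symm (fockWedge n _), inner_fockWedge, ← map_mul]
    congr 2
  · rw [inner_eq_zero_of_mem_sector (m := n + 1) (n := m + 1) (by omega)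
      (fockWedge_mem_sector _ _) (fockWedge_mem_sector _ _), sum_inner,
      Finset.sum_eq_zero fun j _ => ?_]
    rw [inner_smul_left, inner_eq_zero_of_mem_sector hm
      (fockWedge_mem_sector _ _) (fockWedge_mem_sector _ _), mul_zero]

theorem annihilate_eq_zero_of_mem_sector_zero (f : H) {ψ : Fock H} (hψ : ψ ∈ sector H 0) :
    annihilate f ψ = 0 :=
  eqOn_sector (T := (0 : Fock H →L[ℂ] Fock H)) (fun g => annihilate_fockWedge_zero f g) hψ

theorem annihilate_mem_sector (f : H) {n : ℕ} {ψ : Fock H} (hψ : ψ ∈ sector H (n + 1)) :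
    annihilate f ψ ∈ sector H n := by
  refine mem_sector.2 (eqOn_sector (S := sectorProj H n ∘L annihilate f) (fun g => mem_sector.1 ?_) hψ)
  change annihilate f (fockWedge (n + 1) g) ∈ sector H n
  rw [annihilate_fockWedge_succ]
  refine Submodule.sum_mem (sector H n) fun j _ => ?_
  exact Submodule.smul_mem _ _ (fockWedge_mem_sector _ _)

/-- The contraction formula displays the dependence on `f`, so linearity is proved for annihilation
and carried to `create` by the adjoint. -/
theorem annihilate_add (f g : H) : annihilate (f + g) = annihilate f + annihilate g := by
  refine ext_fockWedge fun n h => ?_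
  cases n with
  | zero => simp [annihilate_fockWedge_zero]
  | succ n =>
    simp only [_root_.add_apply, annihilate_fockWedge_succ, inner_add_left, mul_add,
      add_smul, Finset.sum_add_distrib]

theorem annihilate_smul (a : ℂ) (f : H) :
    annihilate (a • f) = (starRingEnd ℂ a) • annihilate f := by
  refine ext_fockWedge fun n h => ?_
  cases n with
  | zero => simp [annihilate_fockWedge_zero]
  | succ n =>
    simp only [_root_.smul_apply, annihilate_fockWedge_succ, inner_smul_left,
      Finset.smul_sum, smul_smul]
    refine Finset.sum_congr rfl fun j _ => ?_
    congr 1; ring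

theorem adjoint_annihilate (f : H) : ContinuousLinearMap.adjoint (annihilate f) = create f := by
  rw [annihilate, ContinuousLinearMap.adjoint_adjoint]

theorem create_add (f g : H) : create (f + g) = create f + create g := by
  have h := map_add (ContinuousLinearMap.adjoint (𝕜 := ℂ) (E := Fock H) (F := Fock H)) (annihilate f) (annihilate g)
  rw [adjoint_annihilate, adjoint_annihilate] at h
  exact (adjoint_annihilate (f + g)).symm.trans
    ((congrArg ContinuousLinearMap.adjoint (annihilate_add f g)).trans h)

theorem create_smul (a : ℂ) (f : H) : create (a • f) = a • create f := by
  have h := map_smulₛₗ (ContinuousLinearMap.adjoint (𝕜 := ℂ) (E := Fock H) (F := Fock H)) (starRingEnd ℂ a) (annihilate f)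
  rw [adjoint_annihilate, Complex.conj_conj] at h
  exact (adjoint_annihilate (a • f)).symm.trans
    ((congrArg ContinuousLinearMap.adjoint (annihilate_smul a f)).trans h)

variable (H) in
/-- `f ↦ c*(f)` as a linear map. -/
def createLM : H →ₗ[ℂ] Fock H →L[ℂ] Fock H where
  toFun := create
  map_add' := create_add
  map_smul' := create_smul

/-- The canonical anticommutation relation between annihilation and creation operators. -/
theorem annihilate_mul_create (f g : H) :
    annihilate f * create g = (inner ℂ f g : ℂ) • 1 - create g * annihilate f := by
  refine ext_fockWedge fun n h => ?_
  simp only [mul_apply_eq_comp, _root_.sub_apply, create_fockWedge,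
    annihilate_fockWedge_succ, Fin.sum_univ_succ, _root_.smul_apply,
    one_apply_eq_self]
  -- The head term of the contraction of `Fin.cons g h` is the scalar; every other term has passed
  -- `g` and acquired one extra sign.
  rw [sub_eq_add_neg]
  congr 1
  · simp
  · cases n with
    | zero => simp [annihilate_fockWedge_zero]
    | succ n =>
      rw [annihilate_fockWedge_succ, map_sum, ← Finset.sum_neg_distrib]
      refine Finset.sum_congr rfl fun j _ => ?_
      rw [map_smul, create_fockWedge, ← neg_smul]
      congr 1
      · simp [pow_succ]
      · congr 1
        funext i
        refine Fin.cases ?_ (fun i => ?_) i <;> simp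

theorem create_mul_create (f g : H) : create f * create g = -(create g * create f) := by
  refine ext_fockWedge fun n h => ?_
  simp only [mul_apply_eq_comp, _root_.neg_apply, create_fockWedge]
  have : (Fin.cons f (Fin.cons g h : Fin (n + 1) → H) : Fin (n + 1 + 1) → H) =
      (Fin.cons g (Fin.cons f h : Fin (n + 1) → H) : Fin (n + 1 + 1) → H) ∘
        (Equiv.swap (0 : Fin (n + 2)) 1) := by
    funext i
    refine Fin.cases ?_ (fun i => ?_) i
    · simp
    · refine Fin.cases ?_ (fun i => ?_) i
      · simp
      · rw [Function.comp_apply, Equiv.swap_apply_of_ne_of_ne (Fin.succ_ne_zero _)]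
        · simp
        · rw [Fin.ne_iff_vne]; simp
  rw [this, fockWedge_comp_perm, Equiv.Perm.sign_swap (by simp)]
  simp

end Ladder

/-! ### Second quantization of bounded one-particle operators, and the abstract fermion system. -/

section SecondQuantization

variable {H : Type u} [NormedAddCommGroup H] [InnerProductSpace ℂ H]

theorem norm_completion_apply_le {E F : Type*} [NormedAddCommGroup E] [InnerProductSpace ℂ E]
    [NormedAddCommGroup F] [InnerProductSpace ℂ F] (T : E →L[ℂ] F) {C : ℝ}
    (hT : ∀ x, ‖T x‖ ≤ C * ‖x‖) (x : Completion E) : ‖T.completion x‖ ≤ C * ‖x‖ := by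
  induction x using Completion.induction_on with
  | hp => exact isClosed_le (by fun_prop) (by fun_prop)
  | ih a =>
    rw [ContinuousLinearMap.completion_apply_coe, Completion.norm_coe, Completion.norm_coe]
    exact hT a

/-- The operator `∑ⱼ 1 ⊗ ⋯ ⊗ A ⊗ ⋯ ⊗ 1` on the algebraic tensor power. -/
def dGammaTensor (A : H →L[ℂ] H) : (n : ℕ) → TensorPow H n →L[ℂ] TensorPow H n
  | 0 => 0
  | n + 1 => (TensorProduct.mapL A 1 + TensorProduct.mapL 1 (dGammaTensor A n) :
      (H ⊗[ℂ] TensorPow H n) →L[ℂ] (H ⊗[ℂ] TensorPow H n))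

theorem dGammaTensor_cons (A : H →L[ℂ] H) (n : ℕ) (f : H) (x : TensorPow H n) :
    dGammaTensor A (n + 1) (consTensor n f x) =
      consTensor n (A f) x + consTensor n f (dGammaTensor A n x) := rfl

theorem norm_dGammaTensor_le (A : H →L[ℂ] H) (n : ℕ) : ‖dGammaTensor A n‖ ≤ n * ‖A‖ := by
  induction n with
  | zero => exact (norm_zero).le.trans (by simp)
  | succ n ih =>
    have h1 : ‖TensorProduct.mapL A (1 : TensorPow H n →L[ℂ] TensorPow H n)‖ ≤ ‖A‖ :=
      (TensorProduct.norm_mapL_le _ _).trans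
        (mul_le_of_le_one_right (norm_nonneg _) ContinuousLinearMap.norm_id_le)
    have h2 : ‖TensorProduct.mapL (1 : H →L[ℂ] H) (dGammaTensor A n)‖ ≤ n * ‖A‖ :=
      (TensorProduct.norm_mapL_le _ _).trans
        ((mul_le_of_le_one_left (norm_nonneg _) ContinuousLinearMap.norm_id_le).trans ih)
    refine (norm_add_le (TensorProduct.mapL A (1 : TensorPow H n →L[ℂ] TensorPow H n))
      (TensorProduct.mapL (1 : H →L[ℂ] H) (dGammaTensor A n))).trans ?_
    push_cast
    linarith

theorem dGammaTensor_elemTensor (A : H →L[ℂ] H) {n : ℕ} (f : Fin n → H) :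
    dGammaTensor A n (elemTensor n f) =
      ∑ j, elemTensor n (Function.update f j (A (f j))) := by
  induction n with
  | zero => exact (Finset.sum_empty).symm
  | succ n ih =>
    rw [elemTensor, dGammaTensor_cons, ih, map_sum, Fin.sum_univ_succ]
    congr 1
    refine Finset.sum_congr rfl fun j _ => ?_
    rw [elemTensor, Fin.tail_update_succ]
    rfl

theorem dGammaTensor_wedge (A : H →L[ℂ] H) {n : ℕ} (f : Fin n → H) :
    (dGammaTensor A n).completion (wedge n f) =
      ∑ j, wedge n (Function.update f j (A (f j))) := by
  simp only [wedge, map_smul, map_sum, ContinuousLinearMap.completion_apply_coe,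
    dGammaTensor_elemTensor]
  rw [← Finset.smul_sum, Finset.sum_comm]
  congr 1
  refine Finset.sum_congr rfl fun σ _ => ?_
  rw [← Finset.smul_sum]
  congr 1
  have : ((∑ j, elemTensor n (Function.update (f ∘ σ) j (A ((f ∘ σ) j))) : TensorPow H n) :
      Completion (TensorPow H n)) = ∑ j, (elemTensor n (Function.update (f ∘ σ) j
        (A ((f ∘ σ) j))) : Completion (TensorPow H n)) :=
    map_sum (Completion.toComplL (𝕜 := ℂ) (E := TensorPow H n)) _ _
  rw [this]
  -- Changing slot `j` after permuting by `σ` is the same as changing slot `σ j` before; hence the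
  -- sum over slots commutes with antisymmetrization.
  refine Eq.trans ?_ (Equiv.sum_comp σ fun j => ((elemTensor n (Function.update f j (A (f j)) ∘ σ) :
    TensorPow H n) : Completion (TensorPow H n)))
  refine Finset.sum_congr rfl fun j _ => ?_
  congr 2
  funext i
  simp [Function.update_apply]

theorem dGammaTensor_mem (A : H →L[ℂ] H) {n : ℕ} {x : Completion (TensorPow H n)}
    (hx : x ∈ FockSector H n) : (dGammaTensor A n).completion x ∈ FockSector H n := by
  have hle : FockSector H n ≤ (FockSector H n).comap
      ((dGammaTensor A n).completion : _ →ₗ[ℂ] _) := by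
    refine Submodule.topologicalClosure_minimal _ ?_ ?_
    · rw [Submodule.span_le]
      rintro _ ⟨g, rfl⟩
      change (dGammaTensor A n).completion (wedge n g) ∈ FockSector H n
      rw [dGammaTensor_wedge]
      exact Submodule.sum_mem _ fun j _ => wedge_mem _ _
    · exact (Submodule.isClosed_topologicalClosure _).preimage
        (dGammaTensor A n).completion.continuous
  exact hle hx

/-- The second quantization of `A` on the antisymmetric `n`-particle space. -/
def dGammaSector (A : H →L[ℂ] H) (n : ℕ) : FockSector H n →L[ℂ] FockSector H n :=
  ((dGammaTensor A n).completion ∘L (FockSector H n).subtypeL).codRestrict (FockSector H n)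
    fun x => dGammaTensor_mem A x.2

/-- The second quantization of `A` on the `n`-particle subspace of Fock space, extended by zero. -/
def dGammaFock (A : H →L[ℂ] H) (n : ℕ) : Fock H →L[ℂ] Fock H :=
  lp.singleContinuousLinearMap ℂ (fun n : ℕ => FockSector H n) 2 n ∘L dGammaSector A n ∘L
    lp.evalCLM ℂ (fun n : ℕ => FockSector H n) 2 n

theorem dGammaFock_apply (A : H →L[ℂ] H) (n : ℕ) (ψ : Fock H) :
    dGammaFock A n ψ = lp.single 2 n (dGammaSector A n (ψ n)) := rfl

theorem dGammaFock_mem (A : H →L[ℂ] H) (n : ℕ) (ψ : Fock H) : dGammaFock A n ψ ∈ sector H n :=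
  single_mem_sector _ _

theorem norm_dGammaFock_apply_le (A : H →L[ℂ] H) (n : ℕ) (ψ : Fock H) :
    ‖dGammaFock A n ψ‖ ≤ n * ‖A‖ * ‖ψ‖ := by
  rw [dGammaFock_apply, lp.norm_single (by norm_num)]
  have h1 : ‖dGammaSector A n (ψ n)‖ ≤ n * ‖A‖ * ‖ψ n‖ :=
    norm_completion_apply_le _ (fun x => ((dGammaTensor A n).le_opNorm x).trans
      (mul_le_mul_of_nonneg_right (norm_dGammaTensor_le A n) (norm_nonneg _))) _
  exact h1.trans (mul_le_mul_of_nonneg_left (lp.norm_apply_le_norm (by norm_num) ψ n)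
    (by positivity))

theorem dGammaFock_fockWedge (A : H →L[ℂ] H) {n : ℕ} (g : Fin n → H) :
    dGammaFock A n (fockWedge n g) = ∑ j, fockWedge n (Function.update g j (A (g j))) := by
  rw [dGammaFock_apply, fockWedge, lp.single_apply_self]
  have : dGammaSector A n ⟨wedge n g, wedge_mem n g⟩ =
      ∑ j, ⟨wedge n (Function.update g j (A (g j))), wedge_mem _ _⟩ := by
    apply Subtype.ext
    rw [Submodule.coe_sum]
    exact dGammaTensor_wedge A g
  rw [this]
  exact map_sum (lp.singleContinuousLinearMap ℂ (fun n : ℕ => FockSector H n) 2 n) _ _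

/-- This is the relation `[dΓ(A), c*(f)] = c*(A f)`. Together with `sector_succ_le` it determines
`dΓ(A)` by induction on the particle number. -/
theorem dGammaFock_create (A : H →L[ℂ] H) (f : H) {n : ℕ} {ψ : Fock H} (hψ : ψ ∈ sector H n) :
    dGammaFock A (n + 1) (create f ψ) = create (A f) ψ + create f (dGammaFock A n ψ) := by
  refine eqOn_sector (S := dGammaFock A (n + 1) ∘L create f)
    (T := create (A f) + create f ∘L dGammaFock A n) (fun g => ?_) hψ
  change dGammaFock A (n + 1) (create f (fockWedge n g)) =
    create (A f) (fockWedge n g) + create f (dGammaFock A n (fockWedge n g))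
  rw [create_fockWedge, dGammaFock_fockWedge, dGammaFock_fockWedge, Fin.sum_univ_succ, map_sum,
    create_fockWedge]
  congr 1
  · simp
  · refine Finset.sum_congr rfl fun j _ => ?_
    rw [create_fockWedge]
    simp [← Fin.cons_update]

theorem sector_succ_le (n : ℕ) : sector H (n + 1) ≤
    (Submodule.span ℂ {χ : Fock H | ∃ f, ∃ ψ ∈ sector H n, create f ψ = χ}).topologicalClosure := by
  rw [sector_eq_closure]
  refine Submodule.topologicalClosure_mono (Submodule.span_mono ?_)
  rintro _ ⟨g, rfl⟩
  refine ⟨g 0, fockWedge n (Fin.tail g), fockWedge_mem_sector _ _, ?_⟩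
  rw [create_fockWedge, Fin.cons_self_tail]

/-- Creation operators on a Hilbert space graded by particle number, with the canonical
anticommutation relations and the second quantizations of bounded one-particle operators. -/
structure FermionSystem (H : Type*) [NormedAddCommGroup H] [InnerProductSpace ℂ H]
    (F : Type*) [NormedAddCommGroup F] [InnerProductSpace ℂ F] [CompleteSpace F] where
  createLM : H →ₗ[ℂ] F →L[ℂ] F
  norm_createLM_le : ∀ f, ‖createLM f‖ ≤ ‖f‖
  createLM_mul_createLM : ∀ f g, createLM f * createLM g = -(createLM g * createLM f)
  anticommutation : ∀ f g, ContinuousLinearMap.adjoint (createLM f) * createLM g =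
    (inner ℂ f g : ℂ) • 1 - createLM g * ContinuousLinearMap.adjoint (createLM f)
  sec : ℕ → Submodule ℂ F
  inner_eq_zero : ∀ {m n x y}, m ≠ n → x ∈ sec m → y ∈ sec n → inner ℂ x y = 0
  createLM_mem : ∀ f {n x}, x ∈ sec n → createLM f x ∈ sec (n + 1)
  annihilate_mem : ∀ f {n x}, x ∈ sec (n + 1) → ContinuousLinearMap.adjoint (createLM f) x ∈ sec n
  annihilate_eq_zero : ∀ f {x}, x ∈ sec 0 → ContinuousLinearMap.adjoint (createLM f) x = 0
  sec_succ_le : ∀ n, sec (n + 1) ≤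
    (Submodule.span ℂ {y : F | ∃ f, ∃ x ∈ sec n, createLM f x = y}).topologicalClosure
  dGamma : (H →L[ℂ] H) → ℕ → F →L[ℂ] F
  dGamma_mem : ∀ A n x, dGamma A n x ∈ sec n
  norm_dGamma_apply_le : ∀ A n x, ‖dGamma A n x‖ ≤ n * ‖A‖ * ‖x‖
  dGamma_create : ∀ A f {n x}, x ∈ sec n →
    dGamma A (n + 1) (createLM f x) = createLM (A f) x + createLM f (dGamma A n x)

variable (H) in
/-- Fermion Fock space. -/
def fockSystem : FermionSystem H (Fock H) where
  createLM := createLM H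
  norm_createLM_le := norm_create_le
  createLM_mul_createLM := create_mul_create
  anticommutation := annihilate_mul_create
  sec := sector H
  inner_eq_zero := fun h hx hy => inner_eq_zero_of_mem_sector h hx hy
  createLM_mem := create_mem_sector
  annihilate_mem := annihilate_mem_sector
  annihilate_eq_zero := annihilate_eq_zero_of_mem_sector_zero
  sec_succ_le := sector_succ_le
  dGamma := dGammaFock
  dGamma_mem := dGammaFock_mem
  norm_dGamma_apply_le := norm_dGammaFock_apply_le
  dGamma_create := dGammaFock_create

end SecondQuantization

/-! ### Expansion of a trace class operator along a commuting family of projections. -/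

section TraceExpansion

variable {E : Type u} [NormedAddCommGroup E] [InnerProductSpace ℂ E] [CompleteSpace E]

/-- An operator dominated by another one factors through it by a contraction. -/
theorem exists_contraction_comp_eq (A B : E →L[ℂ] E) (h : ∀ x, ‖A x‖ ≤ ‖B x‖) :
    ∃ U : E →L[ℂ] E, (∀ x, ‖U x‖ ≤ ‖x‖) ∧ ∀ x, U (B x) = A x := by
  let K : Submodule ℂ E := (LinearMap.range (B : E →ₗ[ℂ] E)).topologicalClosure
  have hmem : ∀ x, B x ∈ K := fun x =>
    Submodule.le_topologicalClosure _ (LinearMap.mem_range_self (B : E →ₗ[ℂ] E) x)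
  let e : E →ₗ[ℂ] K := (B : E →ₗ[ℂ] E).codRestrict K hmem
  have : CompleteSpace K := (Submodule.isClosed_topologicalClosure _).completeSpace_coe
  have hd : DenseRange e := by
    rintro ⟨x, hx⟩
    rw [Metric.mem_closure_iff]
    intro ε hε
    obtain ⟨_, ⟨y, rfl⟩, hy⟩ := Metric.mem_closure_iff.1 (show x ∈ closure
      (LinearMap.range (B : E →ₗ[ℂ] E) : Set E) from hx) ε hε
    exact ⟨e y, ⟨y, rfl⟩, hy⟩
  have hn : ∀ x, ‖(A : E →ₗ[ℂ] E) x‖ ≤ 1 * ‖e x‖ := fun x => by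
    rw [one_mul]; exact h x
  -- The map `B x ↦ A x` is contractive on the range of `B`. It is extended to the closure by
  -- continuity, and below by zero to the orthogonal complement.
  let V : K →L[ℂ] E := (A : E →ₗ[ℂ] E).extendOfNorm e
  have hV : ∀ x, V (e x) = A x := LinearMap.extendOfNorm_eq hd ⟨1, hn⟩
  have hVn : ∀ x, ‖V x‖ ≤ ‖x‖ := fun x => by
    refine hd.induction_on (p := fun x => ‖V x‖ ≤ ‖x‖) x ?_ ?_
    · exact isClosed_le (by fun_prop) (by fun_prop)
    · intro y
      rw [hV]; simpa using hn y
  refine ⟨V ∘L K.orthogonalProjectionOnto, fun x => ?_, fun x => ?_⟩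
  · exact (hVn _).trans (K.norm_orthogonalProjectionOnto_apply_le x)
  · rw [ContinuousLinearMap.comp_apply, ← hV]
    congr 1
    exact Submodule.orthogonalProjectionOnto_mem_subspace_eq_self (K := K) (e x)

/-- Supplies the hypothesis of `exists_contraction_comp_eq` for the polar decomposition `T = U |T|`.
-/
theorem norm_abs_apply (T : E →L[ℂ] E) (x : E) : ‖CFC.abs T x‖ = ‖T x‖ := by
  have h1 : IsSelfAdjoint (CFC.abs T) := IsSelfAdjoint.of_nonneg (CFC.abs_nonneg T)
  have h2 : ContinuousLinearMap.adjoint (CFC.abs T) = CFC.abs T := h1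
  have h3 : inner ℂ (CFC.abs T x) (CFC.abs T x) = inner ℂ (T x) (T x) := by
    rw [← ContinuousLinearMap.adjoint_inner_right, h2, ← ContinuousLinearMap.adjoint_inner_right T]
    exact congrArg (fun A : E →L[ℂ] E => inner ℂ x (A x)) (CFC.abs_mul_abs T)
  have h4 := congrArg Complex.re h3
  have key : ∀ v : E, (inner ℂ v v).re = ‖v‖ ^ 2 := fun v => inner_self_eq_norm_sq (𝕜 := ℂ) v
  rw [key, key] at h4
  exact (sq_eq_sq₀ (norm_nonneg _) (norm_nonneg _)).1 h4

theorem sqrtAbs_mul_self (T : E →L[ℂ] E) : sqrtAbs T * sqrtAbs T = CFC.abs T :=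
  CFC.sqrt_mul_sqrt_self _ (CFC.abs_nonneg T)

theorem adjoint_sqrtAbs (T : E →L[ℂ] E) :
    ContinuousLinearMap.adjoint (sqrtAbs T) = sqrtAbs T :=
  IsSelfAdjoint.of_nonneg (CFC.sqrt_nonneg _)

/-- Self-adjointness makes `P` commute with `T*` too, hence with `T* T` and with its continuous
functions. -/
theorem commute_sqrtAbs {P T : E →L[ℂ] E} (hP : IsSelfAdjoint P) (h : Commute P T) :
    Commute P (sqrtAbs T) := by
  have h2 : Commute P (star T) := by
    have := h.star_star
    rwa [hP.star_eq] at this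
  have h3 : Commute P (CFC.abs T) := by
    exact (Commute.cfcₙ_nnreal (h2.mul_right h).symm _).symm
  exact (Commute.cfcₙ_nnreal h3.symm _).symm

theorem inner_abs_self (T : E →L[ℂ] E) (x : E) :
    inner ℂ x (CFC.abs T x) = ((‖sqrtAbs T x‖ ^ 2 : ℝ) : ℂ) := by
  have h1 : CFC.abs T x = sqrtAbs T (sqrtAbs T x) :=
    congrArg (fun A : E →L[ℂ] E => A x) (sqrtAbs_mul_self T).symm
  rw [h1, ← ContinuousLinearMap.adjoint_inner_left, adjoint_sqrtAbs, Complex.ofReal_pow]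
  exact inner_self_eq_norm_sq_to_K (𝕜 := ℂ) _

/-- The criterion becomes the Hilbert–Schmidt property of `|T|^{1/2}`, which is easily moved between
bases and combined with the number moment. -/
theorem isTraceClass_iff (T : E →L[ℂ] E) :
    IsTraceClass T ↔ Summable fun i => ‖sqrtAbs T (onb E i)‖ ^ 2 := by
  rw [IsTraceClass]
  refine summable_congr fun i => ?_
  rw [inner_abs_self, Complex.norm_real, Real.norm_of_nonneg (by positivity)]

/-- Cauchy–Schwarz followed by Bessel, uniformly in the finite set. -/
theorem sum_norm_inner_mul_le {E : Type*} [NormedAddCommGroup E] [InnerProductSpace ℂ E]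
    {κ : Type*} {e : κ → E} (he : Orthonormal ℂ e) (u v : E) (s : Finset κ) :
    ∑ j ∈ s, ‖inner ℂ (e j) v‖ * ‖inner ℂ u (e j)‖ ≤ ‖v‖ * ‖u‖ := by
  refine (Real.sum_mul_le_sqrt_mul_sqrt _ _ _).trans ?_
  gcongr
  · exact Real.sqrt_le_iff.2 ⟨norm_nonneg _, he.sum_inner_products_le v⟩
  · simp_rw [norm_inner_symm u]
    exact Real.sqrt_le_iff.2 ⟨norm_nonneg _, he.sum_inner_products_le u⟩

/-- The trace of an absolutely convergent series of rank one operators. -/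
theorem hasSum_inner_trace {κ : Type*} (x y : κ → E) (T : E →L[ℂ] E)
    (hxy : Summable fun a => ‖x a‖ * ‖y a‖)
    (hT : ∀ v, HasSum (fun a => (inner ℂ (y a) v : ℂ) • x a) (T v)) (X : E →L[ℂ] E) :
    HasSum (fun a => inner ℂ (y a) (X (x a))) (trace (T * X)) := by
  -- Summing `G` over `j` gives `⟨y a, X (x a)⟩` by Parseval; summing over `a` gives the diagonal
  -- element of `T * X` at `j`. Absolute summability allows the exchange.
  let G : κ → onbIndex E → ℂ := fun a j =>
    inner ℂ (onb E j) (x a) * inner ℂ (ContinuousLinearMap.adjoint X (y a)) (onb E j)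
  have hsum : ∀ a (s : Finset (onbIndex E)), ∑ j ∈ s, ‖G a j‖ ≤ ‖X‖ * (‖x a‖ * ‖y a‖) := by
    intro a s
    simp only [G, norm_mul]
    refine (sum_norm_inner_mul_le (onb E).orthonormal _ _ s).trans ?_
    have h1 : ‖ContinuousLinearMap.adjoint X (y a)‖ ≤ ‖X‖ * ‖y a‖ := by
      refine (ContinuousLinearMap.le_opNorm _ _).trans_eq ?_
      rw [LinearIsometryEquiv.norm_map]
    calc _ ≤ ‖x a‖ * (‖X‖ * ‖y a‖) := by gcongr
      _ = _ := by ring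
  have hG1 : ∀ a, Summable fun j => ‖G a j‖ := fun a =>
    summable_of_sum_le (fun _ => norm_nonneg _) (hsum a)
  have hG : Summable (Function.uncurry G) := by
    refine Summable.of_norm ((summable_prod_of_nonneg fun _ => norm_nonneg _).2 ⟨hG1, ?_⟩)
    exact Summable.of_nonneg_of_le (fun a => tsum_nonneg fun _ => norm_nonneg _)
      (fun a => (hG1 a).tsum_le_of_sum_le (hsum a)) (hxy.mul_left ‖X‖)
  have h1 : ∀ a, ∑' j, G a j = inner ℂ (y a) (X (x a)) := by
    intro a
    rw [← ContinuousLinearMap.adjoint_inner_left, ← (onb E).tsum_inner_mul_inner]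
    exact tsum_congr fun j => mul_comm _ _
  have h2 : ∀ j, ∑' a, G a j = inner ℂ (onb E j) ((T * X) (onb E j)) := by
    intro j
    have := ((hT (X (onb E j))).mapL (innerSL ℂ (onb E j))).tsum_eq
    refine Eq.trans (tsum_congr fun a => ?_) this
    simp only [G]
    rw [ContinuousLinearMap.adjoint_inner_left]
    simp [mul_comm]
  have h3 : trace (T * X) = ∑' a, inner ℂ (y a) (X (x a)) := by
    rw [trace]
    simp_rw [← h1, ← h2]
    exact hG.tsum_comm
  rw [h3]
  refine (Summable.of_norm (Summable.of_nonneg_of_le (fun _ => norm_nonneg _) (fun a => ?_)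
    (hxy.mul_left ‖X‖))).hasSum
  refine (norm_inner_le_norm _ _).trans ?_
  calc _ ≤ ‖y a‖ * (‖X‖ * ‖x a‖) := by gcongr; exact X.le_opNorm _
    _ = _ := by ring

/-- A trace class operator that commutes with a resolution of the identity by projections `P n` is
a series of rank one operators within the ranges of the `P n`. -/
theorem exists_trace_expansion (P : ℕ → E →L[ℂ] E) (hPs : ∀ n, IsSelfAdjoint (P n))
    (hPi : ∀ n, P n * P n = P n) (hP : ∀ v, HasSum (fun n => P n v) v) (T : E →L[ℂ] E)
    (hc : ∀ n, Commute (P n) T)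
    (hT : Summable fun a : ℕ × onbIndex E =>
      ((a.1 : ℝ) + 1) ^ 2 * ‖P a.1 (sqrtAbs T (onb E a.2))‖ ^ 2) :
    ∃ x y : ℕ × onbIndex E → E, (∀ a, P a.1 (x a) = x a) ∧ (∀ a, P a.1 (y a) = y a) ∧
      (Summable fun a => ((a.1 : ℝ) + 1) ^ 2 * (‖x a‖ * ‖y a‖)) ∧
      ∀ X : E →L[ℂ] E, HasSum (fun a => inner ℂ (y a) (X (x a))) (trace (T * X)) := by
  obtain ⟨U, hU, hUT⟩ := exists_contraction_comp_eq T (CFC.abs T)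
    fun x => (norm_abs_apply T x).ge
  have hPapp : ∀ n v, P n (P n v) = P n v := fun n v =>
    congrArg (fun A : E →L[ℂ] E => A v) (hPi n)
  have hPn : ∀ n v, ‖P n v‖ ≤ ‖v‖ := by
    intro n v
    have h1 : ‖P n v‖ ^ 2 ≤ ‖v‖ * ‖P n v‖ := by
      have h2 : inner ℂ (P n v) (P n v) = inner ℂ v (P n v) := by
        conv_lhs => rw [← ContinuousLinearMap.adjoint_inner_right,
          show ContinuousLinearMap.adjoint (P n) = P n from hPs n, hPapp]
      have h3 := norm_inner_le_norm (𝕜 := ℂ) v (P n v)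
      rw [← h2, inner_self_eq_norm_sq_to_K] at h3
      simpa using h3
    by_contra hlt
    push Not at hlt
    nlinarith [norm_nonneg v]
  have hS : ∀ n v, P n (sqrtAbs T v) = sqrtAbs T (P n v) := fun n v =>
    congrArg (fun A : E →L[ℂ] E => A v) (commute_sqrtAbs (hPs n) (hc n))
  have hT' : ∀ n v, P n (T v) = T (P n v) := fun n v =>
    congrArg (fun A : E →L[ℂ] E => A v) (hc n)
  -- Factor `T = U |T|^{1/2} |T|^{1/2}`, insert the basis between the two square roots and cut with
  -- `P n`, which commutes with `T` and `|T|^{1/2}`. The contraction `U` need not respect the `P n`,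
  -- hence the outer projection in `x`.
  let y : ℕ × onbIndex E → E := fun a => P a.1 (sqrtAbs T (onb E a.2))
  let x : ℕ × onbIndex E → E := fun a => P a.1 (U (y a))
  have hxy : ∀ a, ‖x a‖ ≤ ‖y a‖ := fun a => (hPn _ _).trans (hU _)
  have hsum : Summable fun a : ℕ × onbIndex E => ((a.1 : ℝ) + 1) ^ 2 * (‖x a‖ * ‖y a‖) := by
    refine Summable.of_nonneg_of_le (fun a => by positivity) (fun a => ?_) hT
    rw [sq ‖_‖]
    gcongr
    exact hxy a
  have hsum' : Summable fun a => ‖x a‖ * ‖y a‖ := by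
    refine Summable.of_nonneg_of_le (fun a => by positivity) (fun a => ?_) hsum
    refine le_mul_of_one_le_left (by positivity) ?_
    have : (0 : ℝ) ≤ a.1 := by positivity
    nlinarith
  refine ⟨x, y, fun a => hPapp _ _, fun a => hPapp _ _, hsum, fun X =>
    hasSum_inner_trace x y T hsum' (fun v => ?_) X⟩
  have h1 : Summable fun a => (inner ℂ (y a) v : ℂ) • x a := by
    refine Summable.of_norm (Summable.of_nonneg_of_le (fun _ => norm_nonneg _) (fun a => ?_)
      (hsum'.mul_left ‖v‖))
    rw [norm_smul]
    calc _ ≤ (‖y a‖ * ‖v‖) * ‖x a‖ := by gcongr; exact norm_inner_le_norm _ _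
      _ = _ := by ring
  have h2 : ∀ n, HasSum (fun i => (inner ℂ (y (n, i)) v : ℂ) • x (n, i)) (P n (T v)) := by
    intro n
    have h3 := ((onb E).hasSum_repr (sqrtAbs T (P n v))).mapL (P n ∘L U ∘L P n ∘L sqrtAbs T)
    convert h3 using 1
    · funext i
      rw [map_smul, HilbertBasis.repr_apply_apply]
      congr 1
      rw [← ContinuousLinearMap.adjoint_inner_left, adjoint_sqrtAbs,
        ← ContinuousLinearMap.adjoint_inner_left,
        show ContinuousLinearMap.adjoint (P n) = P n from hPs n]
    · have h4 : sqrtAbs T (sqrtAbs T (P n v)) = CFC.abs T (P n v) :=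
        congrArg (fun A : E →L[ℂ] E => A (P n v)) (sqrtAbs_mul_self T)
      simp only [ContinuousLinearMap.comp_apply]
      rw [h4, ← h4, hS, hS, hPapp, h4, hUT, ← hT', hPapp]
  -- The fibre over `n` sums to `P n (T v)`, and these add up to `T v`.
  have h5 := h1.hasSum.prod_fiberwise h2
  exact (h5.unique (hP (T v))) ▸ h1.hasSum

end TraceExpansion

/-! ### The number-resolved series for the functional `X ↦ tr (ρ X)`. -/

section Expansion

variable {H : Type u} [NormedAddCommGroup H] [InnerProductSpace ℂ H]

theorem isSelfAdjoint_sectorProj (n : ℕ) : IsSelfAdjoint (sectorProj H n) := by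
  refine ContinuousLinearMap.isSelfAdjoint_iff_isSymmetric.2 fun x y => ?_
  change inner ℂ (sectorProj H n x) y = inner ℂ x (sectorProj H n y)
  rw [sectorProj_apply, sectorProj_apply, lp.inner_single_left, lp.inner_single_right]

theorem sectorProj_mul_self (n : ℕ) : sectorProj H n * sectorProj H n = sectorProj H n := by
  ext1 x
  exact mem_sector.1 (sectorProj_mem_sector n x)

theorem numberOp_apply (v : Fock H) (h : v ∈ (numberOp H).domain) (n : ℕ) :
    (numberOp H ⟨v, h⟩) n = (n : ℂ) • v n := rfl

theorem mem_domain_of_mem_sector {n : ℕ} {v : Fock H} (hv : v ∈ sector H n) :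
    v ∈ (numberOp H).domain := by
  change Memℓp (fun m : ℕ => (m : ℂ) • v m) 2
  have : (fun m : ℕ => (m : ℂ) • v m) = ((n : ℂ) • v : Fock H) := by
    funext m
    by_cases h : m = n
    · subst h; rfl
    · change (m : ℂ) • v m = (n : ℂ) • v m
      rw [apply_eq_zero_of_mem_sector h hv, smul_zero, smul_zero]
  rw [this]
  exact lp.memℓp _

/-- Vectors of a sector are eigenvectors of the number operator, and a commuting operator preserves
its eigenspaces. -/
theorem CommutesWithNumber.apply_mem_sector {ρ : Fock H →L[ℂ] Fock H} (h : CommutesWithNumber ρ)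
    {n : ℕ} {v : Fock H} (hv : v ∈ sector H n) : ρ v ∈ sector H n := by
  obtain ⟨h1, h2⟩ := h ⟨v, mem_domain_of_mem_sector hv⟩
  have h3 : numberOp H ⟨v, mem_domain_of_mem_sector hv⟩ = (n : ℂ) • v := by
    ext m : 2
    rw [numberOp_apply]
    change (m : ℂ) • v m = (n : ℂ) • v m
    by_cases h : m = n
    · rw [h]
    · rw [apply_eq_zero_of_mem_sector h hv, smul_zero, smul_zero]
  rw [h3, map_smul] at h2
  refine mem_sector_of_apply_eq_zero fun m hm => ?_
  have h4 : (m : ℂ) • (ρ v) m = (n : ℂ) • (ρ v) m := by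
    rw [← numberOp_apply _ h1, h2]; rfl
  rw [← sub_eq_zero, ← sub_smul, smul_eq_zero, sub_eq_zero] at h4
  exact h4.resolve_left (by exact_mod_cast hm)

theorem CommutesWithNumber.commute_sectorProj {ρ : Fock H →L[ℂ] Fock H}
    (h : CommutesWithNumber ρ) (n : ℕ) : Commute (sectorProj H n) ρ := by
  change sectorProj H n * ρ = ρ * sectorProj H n
  refine ext_sector fun m v hv => ?_
  change sectorProj H n (ρ v) = ρ (sectorProj H n v)
  by_cases hm : n = m
  · subst hm
    rw [mem_sector.1 hv, mem_sector.1 (h.apply_mem_sector hv)]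
  · rw [sectorProj_eq_zero_of_mem_sector hm hv, map_zero,
      sectorProj_eq_zero_of_mem_sector hm (h.apply_mem_sector hv)]

theorem norm_sectorProj_apply (n : ℕ) (v : Fock H) : ‖sectorProj H n v‖ = ‖v n‖ := by
  rw [sectorProj_apply, lp.norm_single (by norm_num)]

theorem summable_norm_sq_apply {κ : Type*} (v : κ → Fock H) (hv : Summable fun i => ‖v i‖ ^ 2) :
    Summable fun a : κ × ℕ => ‖(v a.1) a.2‖ ^ 2 := by
  refine (summable_prod_of_nonneg fun _ => sq_nonneg _).2
    ⟨fun i => (hasSum_norm_sq (v i)).summable, ?_⟩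
  exact hv.congr fun i => (hasSum_norm_sq (v i)).tsum_eq.symm

/-- Since `(n + 1)² ≤ 2 n² + 2`, the weighted sum is controlled by the second number moment and the
trace norm together. -/
theorem summable_number_moment {ρ : Fock H →L[ℂ] Fock H} (hρ : IsTraceClass ρ)
    (hN2 : FiniteNumberSq ρ) : Summable fun a : ℕ × onbIndex (Fock H) =>
      ((a.1 : ℝ) + 1) ^ 2 * ‖sectorProj H a.1 (sqrtAbs ρ (onb (Fock H) a.2))‖ ^ 2 := by
  obtain ⟨hd, hs⟩ := hN2
  rw [isTraceClass_iff] at hρ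
  have key : Summable fun a : onbIndex (Fock H) × ℕ =>
      2 * ‖(a.2 : ℂ) • (sqrtAbs ρ (onb (Fock H) a.1)) a.2‖ ^ 2 +
        2 * ‖(sqrtAbs ρ (onb (Fock H) a.1)) a.2‖ ^ 2 := by
    refine Summable.add (Summable.mul_left _ ?_) (Summable.mul_left _ ?_)
    · refine (summable_norm_sq_apply (fun i => numberOp H ⟨_, hd i⟩) hs).congr fun a => ?_
      rw [numberOp_apply]
    · exact summable_norm_sq_apply (fun i => sqrtAbs ρ (onb (Fock H) i)) hρ
  have key' := (Equiv.prodComm ℕ (onbIndex (Fock H))).summable_iff.2 key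
  refine Summable.of_nonneg_of_le (fun a => by positivity) (fun a => ?_) key'
  rw [norm_sectorProj_apply]
  simp only [Function.comp_apply, Equiv.prodComm_apply, Prod.fst_swap, Prod.snd_swap, norm_smul,
    Complex.norm_natCast, mul_pow]
  have aux : ∀ n t : ℝ, (n + 1) ^ 2 * t ^ 2 ≤ 2 * (n ^ 2 * t ^ 2) + 2 * t ^ 2 := fun n t => by
    nlinarith [sq_nonneg ((n - 1) * t)]
  exact aux _ _

/-- A series representation of a linear functional on operators in which each term is a matrix
element within an `n`-particle space. -/
structure NumberExpansion {H : Type*} [NormedAddCommGroup H] [InnerProductSpace ℂ H]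
    {F : Type u} [NormedAddCommGroup F] [InnerProductSpace ℂ F] [CompleteSpace F]
    (Φ : FermionSystem H F) (ω : (F →L[ℂ] F) → ℂ) where
  idx : Type u
  num : idx → ℕ
  x : idx → F
  y : idx → F
  x_mem : ∀ a, x a ∈ Φ.sec (num a)
  y_mem : ∀ a, y a ∈ Φ.sec (num a)
  summable : Summable fun a => ((num a : ℝ) + 1) ^ 2 * (‖x a‖ * ‖y a‖)
  hasSum : ∀ X : F →L[ℂ] F, HasSum (fun a => inner ℂ (y a) (X (x a))) (ω X)

/-- The second clause writes the mean particle number through the same series, so that it can later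
be identified with `tau 1`. -/
theorem exists_numberExpansion {ρ : Fock H →L[ℂ] Fock H} (hρ : IsTraceClass ρ)
    (hN2 : FiniteNumberSq ρ) (hcomm : CommutesWithNumber ρ) :
    ∃ e : NumberExpansion (fockSystem H) (fun X => trace (ρ * X)),
      numberExpectation ρ = ∑' a, (e.num a : ℂ) * inner ℂ (e.y a) (e.x a) := by
  obtain ⟨x, y, hx, hy, hs, hsum⟩ := exists_trace_expansion (sectorProj H)
    isSelfAdjoint_sectorProj sectorProj_mul_self hasSum_sectorProj ρ hcomm.commute_sectorProj
    (summable_number_moment hρ hN2)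
  refine ⟨⟨_, Prod.fst, x, y, hx, hy, hs, hsum⟩, ?_⟩
  have h1 : ∀ n, trace (sectorProj H n * ρ) = ∑' i, inner ℂ (y (n, i)) (x (n, i)) := by
    intro n
    have h2 : sectorProj H n * ρ = ρ * sectorProj H n := hcomm.commute_sectorProj n
    have h3 := hsum (sectorProj H n)
    -- The projection onto `n` particles kills all terms of the series with another particle number.
    rw [h2, ← h3.tsum_eq, h3.summable.tsum_prod, tsum_eq_single n]
    · exact tsum_congr fun i => by rw [hx (n, i)]
    · intro m hm
      refine (tsum_congr fun i => ?_).trans tsum_zero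
      rw [sectorProj_eq_zero_of_mem_sector hm.symm (hx (m, i)), inner_zero_right]
  have h4 : Summable fun a : ℕ × onbIndex (Fock H) => (a.1 : ℂ) * inner ℂ (y a) (x a) := by
    refine Summable.of_norm (Summable.of_nonneg_of_le (fun _ => norm_nonneg _) (fun a => ?_) hs)
    rw [norm_mul, Complex.norm_natCast]
    have h5 := norm_inner_le_norm (𝕜 := ℂ) (y a) (x a)
    have h6 : (a.1 : ℝ) ≤ ((a.1 : ℝ) + 1) ^ 2 := by
      have : (0 : ℝ) ≤ a.1 := by positivity
      nlinarith
    rw [mul_comm] at h5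
    gcongr
  rw [numberExpectation, h4.tsum_prod]
  exact tsum_congr fun n => by rw [h1, ← tsum_mul_left]

theorem HasParticleNumber.numberExpectation_eq {ρ : Fock H →L[ℂ] Fock H} {N : ℕ}
    (h : HasParticleNumber ρ N) (htr : trace ρ = 1) : numberExpectation ρ = N := by
  have h1 : ∀ v, ρ v ∈ sector H N := by
    intro v
    obtain ⟨h1, h2⟩ := h v
    refine mem_sector_of_apply_eq_zero fun m hm => ?_
    have h4 : (m : ℂ) • (ρ v) m = (N : ℂ) • (ρ v) m := by
      rw [← numberOp_apply _ h1, h2]; rfl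
    rw [← sub_eq_zero, ← sub_smul, smul_eq_zero, sub_eq_zero] at h4
    exact h4.resolve_left (by exact_mod_cast hm)
  have h2 : sectorProj H N * ρ = ρ := by
    ext1 v; exact mem_sector.1 (h1 v)
  rw [numberExpectation, tsum_eq_single N, h2, htr, mul_one]
  intro n hn
  have h3 : sectorProj H n * ρ = 0 := by
    ext1 v; exact sectorProj_eq_zero_of_mem_sector hn (h1 v)
  rw [h3, trace]
  have h4 : ∀ i, inner ℂ (onb (Fock H) i) ((0 : Fock H →L[ℂ] Fock H) (onb (Fock H) i)) = 0 :=
    fun i => inner_zero_right _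
  rw [tsum_congr h4, tsum_zero, mul_zero]

end Expansion

/-! ### Strong convergence and finite rank projections. -/

/-- For a uniformly bounded family, convergence at nearby vectors suffices. This carries limits from
created vectors to the closure of their span. -/
theorem isClosed_setOf_tendsto_apply {σ E G : Type*} [NormedAddCommGroup E] [NormedSpace ℂ E]
    [NormedAddCommGroup G] [NormedSpace ℂ G] {l : Filter σ} {T : σ → E →L[ℂ] G} {S : E →L[ℂ] G}
    {M : ℝ} (hM : ∀ s x, ‖T s x‖ ≤ M * ‖x‖) :
    IsClosed {x | Tendsto (fun s => T s x) l (𝓝 (S x))} := by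
  refine isClosed_of_closure_subset fun x hx => ?_
  refine Metric.tendsto_nhds.2 fun ε hε => ?_
  -- Chosen so that both errors of replacing `x` by `y` together cost at most `ε / 2`; the `+ 1`
  -- avoids a zero denominator.
  set δ := ε / (2 * (|M| + ‖S‖ + 1)) with hδ
  have hpos : 0 < |M| + ‖S‖ + 1 := by positivity
  have hδ0 : 0 < δ := by positivity
  obtain ⟨y, hy, hxy⟩ := Metric.mem_closure_iff.1 hx δ hδ0
  have hy' : Tendsto (fun s => T s y) l (𝓝 (S y)) := hy
  filter_upwards [Metric.tendsto_nhds.1 hy' (ε / 2) (by positivity)] with s hs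
  rw [dist_eq_norm] at hs hxy ⊢
  have h1 : T s x - S x = T s (x - y) + (T s y - S y) - S (x - y) := by
    simp only [map_sub]; abel
  have h2 : ‖T s (x - y)‖ ≤ |M| * ‖x - y‖ :=
    (hM s _).trans (mul_le_mul_of_nonneg_right (le_abs_self M) (norm_nonneg _))
  have h3 := S.le_opNorm (x - y)
  have h4 : (|M| + ‖S‖ + 1) * δ = ε / 2 := by rw [hδ]; field_simp
  have h5 : (|M| + ‖S‖) * ‖x - y‖ ≤ (|M| + ‖S‖ + 1) * δ := by
    exact mul_le_mul (by linarith) hxy.le (norm_nonneg _) hpos.le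
  rw [h1]
  refine (norm_sub_le _ _).trans_lt ?_
  have h6 := norm_add_le (T s (x - y)) (T s y - S y)
  linarith

section FiniteProjection

variable {H : Type*} [NormedAddCommGroup H] [InnerProductSpace ℂ H] {κ : Type*}

/-- The sum of the rank one operators `⟨eₖ, ·⟩ eₖ` over a finite set of indices. -/
def finiteProj (e : κ → H) (s : Finset κ) : H →L[ℂ] H :=
  ∑ k ∈ s, InnerProductSpace.rankOne ℂ (e k) (e k)

theorem finiteProj_apply (e : κ → H) (s : Finset κ) (f : H) :
    finiteProj e s f = ∑ k ∈ s, (inner ℂ (e k) f : ℂ) • e k := by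
  simp [finiteProj]

theorem norm_sq_sum_smul {e : κ → H} (he : Orthonormal ℂ e) (a : κ → ℂ) (s : Finset κ) :
    ‖∑ k ∈ s, a k • e k‖ ^ 2 = ∑ k ∈ s, ‖a k‖ ^ 2 := by
  have h := he.inner_sum a a s
  have h2 : ∀ z : ℂ, (starRingEnd ℂ z) * z = ((‖z‖ ^ 2 : ℝ) : ℂ) := fun z => by
    rw [mul_comm, Complex.mul_conj, Complex.normSq_eq_norm_sq]
  simp_rw [h2, ← Complex.ofReal_sum] at h
  have h3 := congrArg Complex.re h
  rw [Complex.ofReal_re] at h3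
  exact (inner_self_eq_norm_sq (𝕜 := ℂ) _).symm.trans h3

theorem norm_finiteProj_apply_le {e : κ → H} (he : Orthonormal ℂ e) (s : Finset κ) (f : H) :
    ‖finiteProj e s f‖ ≤ ‖f‖ := by
  rw [finiteProj_apply]
  refine le_of_sq_le_sq ?_ (norm_nonneg _)
  rw [norm_sq_sum_smul he]
  exact he.sum_inner_products_le f

theorem norm_finiteProj_le {e : κ → H} (he : Orthonormal ℂ e) (s : Finset κ) :
    ‖finiteProj e s‖ ≤ 1 :=
  ContinuousLinearMap.opNorm_le_bound _ zero_le_one fun f => by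
    rw [one_mul]; exact norm_finiteProj_apply_le he s f

theorem tendsto_finiteProj (e : HilbertBasis κ ℂ H) (f : H) :
    Tendsto (fun s => finiteProj e s f) atTop (𝓝 f) := by
  have h := e.hasSum_repr f
  simp_rw [HilbertBasis.repr_apply_apply] at h
  simp_rw [finiteProj_apply]
  exact h

end FiniteProjection

/-! ### Bounds and strong continuity on the sectors of a fermion system. -/

namespace FermionSystem

variable {H : Type*} [NormedAddCommGroup H] [InnerProductSpace ℂ H]
  {F : Type*} [NormedAddCommGroup F] [InnerProductSpace ℂ F] [CompleteSpace F]
  (Φ : FermionSystem H F)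

/-- The annihilation operators. -/
def ann (f : H) : F →L[ℂ] F := ContinuousLinearMap.adjoint (Φ.createLM f)

theorem adjoint_ann (f : H) : ContinuousLinearMap.adjoint (Φ.ann f) = Φ.createLM f := by
  rw [ann, ContinuousLinearMap.adjoint_adjoint]

theorem star_ann (f : H) : star (Φ.ann f) = Φ.createLM f := Φ.adjoint_ann f

theorem star_createLM (f : H) : star (Φ.createLM f) = Φ.ann f := rfl

theorem ann_add (f g : H) : Φ.ann (f + g) = Φ.ann f + Φ.ann g := by
  simp only [ann, map_add]

theorem ann_smul (a : ℂ) (f : H) : Φ.ann (a • f) = starRingEnd ℂ a • Φ.ann f := by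
  simp only [ann, map_smulₛₗ]; simp

theorem ann_mul_createLM (f g : H) :
    Φ.ann f * Φ.createLM g = (inner ℂ f g : ℂ) • 1 - Φ.createLM g * Φ.ann f :=
  Φ.anticommutation f g

theorem ann_mul_ann (f g : H) : Φ.ann f * Φ.ann g = -(Φ.ann g * Φ.ann f) := by
  rw [← star_createLM, ← star_createLM, ← star_mul, ← star_mul, ← star_neg,
    createLM_mul_createLM]

theorem ann_createLM_apply (f g : H) (x : F) :
    Φ.ann f (Φ.createLM g x) = (inner ℂ f g : ℂ) • x - Φ.createLM g (Φ.ann f x) :=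
  congrArg (fun T : F →L[ℂ] F => T x) (Φ.ann_mul_createLM f g)

theorem continuous_createLM : Continuous Φ.createLM :=
  (Φ.createLM.mkContinuous 1 fun f => by simpa using Φ.norm_createLM_le f).continuous

/-- The induction step in the particle number: identities and limits for `dGamma` need to be checked
only on vectors `c*(f) x`. -/
theorem sec_succ_le_of_isClosed {n : ℕ} {K : Submodule ℂ F} (hK : IsClosed (K : Set F))
    (h : ∀ f, ∀ x ∈ Φ.sec n, Φ.createLM f x ∈ K) : Φ.sec (n + 1) ≤ K := by
  refine (Φ.sec_succ_le n).trans (Submodule.topologicalClosure_minimal _ ?_ hK)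
  rw [Submodule.span_le]
  rintro _ ⟨f, x, hx, rfl⟩
  exact h f x hx

theorem dGamma_zero_apply (A : H →L[ℂ] H) (x : F) : Φ.dGamma A 0 x = 0 := by
  simpa using Φ.norm_dGamma_apply_le A 0 x

/-- The second quantization of a finite rank operator. -/
theorem sum_createLM_ann_apply {κ : Type*} (s : Finset κ) (u v : κ → H) {A : H →L[ℂ] H}
    (hA : ∀ f, A f = ∑ k ∈ s, (inner ℂ (v k) f : ℂ) • u k) {n : ℕ} {x : F} (hx : x ∈ Φ.sec n) :
    (∑ k ∈ s, Φ.createLM (u k) * Φ.ann (v k)) x = Φ.dGamma A n x := by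
  induction n generalizing x with
  | zero =>
    rw [dGamma_zero_apply, _root_.sum_apply]
    refine Finset.sum_eq_zero fun k _ => ?_
    have : Φ.ann (v k) x = 0 := Φ.annihilate_eq_zero _ hx
    simp [this]
  | succ n ih =>
    have : Φ.sec (n + 1) ≤ LinearMap.eqLocus
        ((∑ k ∈ s, Φ.createLM (u k) * Φ.ann (v k) : F →L[ℂ] F) : F →ₗ[ℂ] F)
        (Φ.dGamma A (n + 1) : F →ₗ[ℂ] F) := by
      refine Φ.sec_succ_le_of_isClosed (isClosed_eq (ContinuousLinearMap.continuous _)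
        (ContinuousLinearMap.continuous _)) fun f x hx => ?_
      change (∑ k ∈ s, Φ.createLM (u k) * Φ.ann (v k)) (Φ.createLM f x) =
        Φ.dGamma A (n + 1) (Φ.createLM f x)
      rw [Φ.dGamma_create A f hx, ← ih hx, hA]
      simp only [_root_.sum_apply, map_sum, ← Finset.sum_add_distrib,
        mul_apply_eq_comp]
      refine Finset.sum_congr rfl fun k _ => ?_
      -- Moving `c(v k)` past `c*(f)` yields a scalar, whose sum over `k` is `c*(A f)`; the sign
      -- from this exchange is cancelled when `c*(u k)` passes `c*(f)`.
      rw [ann_createLM_apply, map_sub, map_smul, map_smul, sub_eq_add_neg]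
      congr 1
      exact (congrArg (fun T : F →L[ℂ] F => -(T (Φ.ann (v k) x)))
        (Φ.createLM_mul_createLM (u k) f)).trans (neg_neg _)
    exact this hx

theorem dGamma_one_apply {n : ℕ} {x : F} (hx : x ∈ Φ.sec n) : Φ.dGamma 1 n x = (n : ℂ) • x := by
  induction n generalizing x with
  | zero => rw [dGamma_zero_apply]; simp
  | succ n ih =>
    have : Φ.sec (n + 1) ≤ LinearMap.eqLocus (Φ.dGamma 1 (n + 1) : F →ₗ[ℂ] F)
        ((((n + 1 : ℕ) : ℂ) • (1 : F →L[ℂ] F) : F →L[ℂ] F) : F →ₗ[ℂ] F) := by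
      refine Φ.sec_succ_le_of_isClosed (isClosed_eq (ContinuousLinearMap.continuous _)
        (ContinuousLinearMap.continuous _)) fun f x hx => ?_
      change Φ.dGamma 1 (n + 1) (Φ.createLM f x) = ((n + 1 : ℕ) : ℂ) • (Φ.createLM f x)
      rw [Φ.dGamma_create _ f hx, ih hx, map_smul]
      push_cast
      rw [add_smul, one_smul, add_comm]
      rfl
    exact this hx

/-- On a created vector the derivation rule leaves `c*(B s f) x`, which converges in norm, and a
term with one particle fewer. The uniform bound `(n + 1) C` on the sector passes to limits. -/
theorem tendsto_dGamma {σ : Type*} {l : Filter σ} {B : σ → H →L[ℂ] H} {A : H →L[ℂ] H} {C : ℝ}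
    (hC : ∀ s, ‖B s‖ ≤ C) (hB : ∀ f, Tendsto (fun s => B s f) l (𝓝 (A f))) {n : ℕ} {x : F}
    (hx : x ∈ Φ.sec n) : Tendsto (fun s => Φ.dGamma (B s) n x) l (𝓝 (Φ.dGamma A n x)) := by
  induction n generalizing x with
  | zero => simp only [dGamma_zero_apply]; exact tendsto_const_nhds
  | succ n ih =>
    let K : Submodule ℂ F :=
      { carrier := {x | Tendsto (fun s => Φ.dGamma (B s) (n + 1) x) l
          (𝓝 (Φ.dGamma A (n + 1) x))}
        zero_mem' := by
          change Tendsto _ _ _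
          simp only [map_zero]; exact tendsto_const_nhds
        add_mem' := fun {x y} hx hy => by
          change Tendsto _ _ _
          simp only [map_add]
          exact Tendsto.add hx hy
        smul_mem' := fun c x hx => by
          change Tendsto _ _ _
          simp only [map_smul]
          exact Tendsto.const_smul hx c }
    have hK : IsClosed (K : Set F) :=
      isClosed_setOf_tendsto_apply (M := (n + 1 : ℕ) * C) fun s x =>
        (Φ.norm_dGamma_apply_le _ _ x).trans (by gcongr; exact hC s)
    refine Φ.sec_succ_le_of_isClosed hK (fun f x hx => ?_) hx
    change Tendsto _ _ _
    simp only [Φ.dGamma_create _ f hx]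
    refine Tendsto.add ?_ (((Φ.createLM f).continuous.tendsto _).comp (ih hx))
    have h1 := ((Φ.continuous_createLM.tendsto _).comp (hB f))
    exact ((ContinuousLinearMap.apply ℂ F x).continuous.tendsto _).comp h1

theorem tendsto_dGamma_dGamma {σ : Type*} {l : Filter σ} {B B' : σ → H →L[ℂ] H}
    {A A' : H →L[ℂ] H} {C C' : ℝ} (hC : ∀ s, ‖B s‖ ≤ C) (hC' : ∀ s, ‖B' s‖ ≤ C')
    (hB : ∀ f, Tendsto (fun s => B s f) l (𝓝 (A f)))
    (hB' : ∀ f, Tendsto (fun s => B' s f) l (𝓝 (A' f))) {n : ℕ} {x : F} (hx : x ∈ Φ.sec n) :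
    Tendsto (fun s => Φ.dGamma (B' s) n (Φ.dGamma (B s) n x)) l
      (𝓝 (Φ.dGamma A' n (Φ.dGamma A n x))) := by
  have h1 := Φ.tendsto_dGamma hC hB hx
  have h2 := Φ.tendsto_dGamma hC' hB' (Φ.dGamma_mem A n x)
  -- The outer factor moves as well, so its uniform bound on the sector is applied to the error of
  -- the inner one.
  have h3 : Tendsto (fun s => Φ.dGamma (B' s) n (Φ.dGamma (B s) n x - Φ.dGamma A n x)) l
      (𝓝 0) := by
    have h4 : Tendsto (fun s => (n * C') * ‖Φ.dGamma (B s) n x - Φ.dGamma A n x‖) l (𝓝 0) := by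
      have := (tendsto_iff_norm_sub_tendsto_zero.1 h1).const_mul (n * C')
      simpa using this
    refine squeeze_zero_norm (fun s => ?_) h4
    exact (Φ.norm_dGamma_apply_le _ _ _).trans (by gcongr; exact hC' s)
  have := h3.add h2
  simpa using this

/-- The sum is `⟨x, dΓ(P_s) x⟩` with `P_s` a projection, and `‖dΓ(P_s)‖ ≤ n` on the sector. -/
theorem sum_norm_ann_sq_le {κ : Type*} {e : κ → H} (he : Orthonormal ℂ e) (s : Finset κ) {n : ℕ}
    {x : F} (hx : x ∈ Φ.sec n) : ∑ k ∈ s, ‖Φ.ann (e k) x‖ ^ 2 ≤ n * ‖x‖ ^ 2 := by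
  have h1 := Φ.sum_createLM_ann_apply s e e (finiteProj_apply e s) hx
  have h2 : inner ℂ x (Φ.dGamma (finiteProj e s) n x) =
      ((∑ k ∈ s, ‖Φ.ann (e k) x‖ ^ 2 : ℝ) : ℂ) := by
    rw [← h1, _root_.sum_apply, inner_sum, Complex.ofReal_sum]
    refine Finset.sum_congr rfl fun k _ => ?_
    rw [mul_apply_eq_comp, ← adjoint_ann, ContinuousLinearMap.adjoint_inner_right]
    exact (inner_self_eq_norm_sq_to_K (𝕜 := ℂ) _).trans (by simp)
  have h3 : ‖inner ℂ x (Φ.dGamma (finiteProj e s) n x)‖ ≤ ‖x‖ * (n * 1 * ‖x‖) :=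
    (norm_inner_le_norm _ _).trans (by
      gcongr
      exact (Φ.norm_dGamma_apply_le _ _ _).trans (by gcongr; exact norm_finiteProj_le he s))
  rw [h2, Complex.norm_real, Real.norm_of_nonneg (by positivity)] at h3
  linarith [h3]

/-- The linear map `f ⊗ g ↦ c*(g) c*(f)`. -/
def pairCreate : H ⊗[ℂ] H →ₗ[ℂ] F →L[ℂ] F :=
  TensorProduct.lift (LinearMap.mk₂ ℂ (fun f g => Φ.createLM g * Φ.createLM f)
    (fun f f' g => by rw [map_add, mul_add]) (fun c f g => by rw [map_smul, mul_smul_comm])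
    (fun f g g' => by rw [map_add, add_mul]) (fun c f g => by rw [map_smul, smul_mul_assoc]))

theorem pairCreate_tmul (f g : H) :
    Φ.pairCreate (f ⊗ₜ g) = Φ.createLM g * Φ.createLM f := rfl

theorem star_pairCreate_tmul (f g : H) :
    star (Φ.pairCreate (f ⊗ₜ g)) = Φ.ann f * Φ.ann g := by
  rw [pairCreate_tmul, star_mul, star_createLM, star_createLM]

/-- An algebraic tensor involves finitely many vectors; an orthonormal basis of their span makes its
norm the `ℓ²` norm of the coefficients. -/
theorem exists_orthonormal_expansion (ξ : H ⊗[ℂ] H) :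
    ∃ (m : ℕ) (e : Fin m → H) (a : Fin m × Fin m → ℂ), Orthonormal ℂ e ∧
      ξ = ∑ p, a p • (e p.1 ⊗ₜ[ℂ] e p.2) := by
  obtain ⟨S, hS⟩ := TensorProduct.exists_finset ξ
  classical
  let W : Submodule ℂ H := Submodule.span ℂ ((S.image Prod.fst ∪ S.image Prod.snd : Finset H) :
    Set H)
  have : FiniteDimensional ℂ W := FiniteDimensional.span_finset ℂ _
  let b := stdOrthonormalBasis ℂ W
  have hb : ∀ w ∈ W, w = ∑ k, (inner ℂ (b k : H) w : ℂ) • (b k : H) := by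
    intro w hw
    have h := congrArg (W.subtype) (b.sum_repr' ⟨w, hw⟩)
    rw [map_sum] at h
    exact h.symm
  refine ⟨_, fun k => (b k : H), fun p => ∑ i ∈ S, (inner ℂ (b p.1 : H) i.1 : ℂ) *
    inner ℂ (b p.2 : H) i.2, b.orthonormal.comp_linearIsometry W.subtypeₗᵢ, ?_⟩
  simp_rw [Finset.sum_smul]
  rw [Finset.sum_comm, hS]
  refine Finset.sum_congr rfl fun i hi => ?_
  have h1 := hb i.1 (Submodule.subset_span (by
    simp only [Finset.coe_union, Finset.coe_image]; exact Or.inl ⟨i, hi, rfl⟩))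
  have h2 := hb i.2 (Submodule.subset_span (by
    simp only [Finset.coe_union, Finset.coe_image]; exact Or.inr ⟨i, hi, rfl⟩))
  conv_lhs => rw [h1, h2]
  rw [TensorProduct.sum_tmul, Fintype.sum_prod_type]
  refine Finset.sum_congr rfl fun k _ => ?_
  rw [TensorProduct.tmul_sum]
  refine Finset.sum_congr rfl fun l _ => ?_
  rw [TensorProduct.smul_tmul_smul]

theorem orthonormal_tmul {κ : Type*} {e : κ → H} (he : Orthonormal ℂ e) :
    Orthonormal ℂ fun p : κ × κ => e p.1 ⊗ₜ[ℂ] e p.2 := by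
  classical
  rw [orthonormal_iff_ite] at he ⊢
  intro p q
  rw [TensorProduct.inner_tmul, he, he]
  simp only [Prod.ext_iff, ite_and, mul_ite, mul_one, mul_zero]
  split_ifs <;> rfl

/-- The one-body bound is used twice, the second time with one particle fewer, giving `n (n - 1) ≤
n²`. -/
theorem sum_norm_ann_ann_sq_le {m : ℕ} {e : Fin m → H} (he : Orthonormal ℂ e) {n : ℕ} {x : F}
    (hx : x ∈ Φ.sec n) :
    ∑ p : Fin m × Fin m, ‖Φ.ann (e p.1) (Φ.ann (e p.2) x)‖ ^ 2 ≤ (n * ‖x‖) ^ 2 := by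
  rw [Fintype.sum_prod_type, Finset.sum_comm]
  cases n with
  | zero =>
    have : ∀ f, Φ.ann f x = 0 := fun f => Φ.annihilate_eq_zero f hx
    simp [this]
  | succ n =>
    calc _ ≤ ∑ l, n * ‖Φ.ann (e l) x‖ ^ 2 := Finset.sum_le_sum fun l _ =>
          Φ.sum_norm_ann_sq_le he Finset.univ (Φ.annihilate_mem (e l) hx)
      _ = n * ∑ l, ‖Φ.ann (e l) x‖ ^ 2 := by rw [Finset.mul_sum]
      _ ≤ n * ((n + 1 : ℕ) * ‖x‖ ^ 2) := by
          gcongr; exact Φ.sum_norm_ann_sq_le he Finset.univ hx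
      _ ≤ _ := by
          push_cast
          nlinarith [sq_nonneg ‖x‖, mul_nonneg (Nat.cast_nonneg (α := ℝ) n) (sq_nonneg ‖x‖)]

theorem star_pairCreate_sum_apply {κ : Type*} (s : Finset κ) (a : κ → ℂ) (f g : κ → H) (x : F) :
    (star (Φ.pairCreate (∑ p ∈ s, a p • (f p ⊗ₜ[ℂ] g p)))) x =
      ∑ p ∈ s, (starRingEnd ℂ (a p)) • Φ.ann (f p) (Φ.ann (g p) x) := by
  rw [map_sum, star_sum, _root_.sum_apply]
  refine Finset.sum_congr rfl fun p _ => ?_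
  rw [map_smul, star_smul, star_pairCreate_tmul]
  rfl

/-- Cauchy–Schwarz in an orthonormal expansion gives a bound by the Hilbert norm of `ξ` that grows
linearly in `n`. Two such factors give the `n²` that the second moment absorbs. -/
theorem norm_star_pairCreate_apply_le (ξ : H ⊗[ℂ] H) {n : ℕ} {x : F} (hx : x ∈ Φ.sec n) :
    ‖(star (Φ.pairCreate ξ)) x‖ ≤ n * ‖ξ‖ * ‖x‖ := by
  obtain ⟨m, e, a, he, hξ⟩ := exists_orthonormal_expansion ξ
  have hnorm : √(∑ p, ‖a p‖ ^ 2) = ‖ξ‖ := by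
    rw [← norm_sq_sum_smul (orthonormal_tmul he), ← hξ, Real.sqrt_sq (norm_nonneg _)]
  have hsum : √(∑ p : Fin m × Fin m, ‖Φ.ann (e p.1) (Φ.ann (e p.2) x)‖ ^ 2) ≤ n * ‖x‖ :=
    Real.sqrt_le_iff.2 ⟨by positivity, Φ.sum_norm_ann_ann_sq_le he hx⟩
  have h1 := Φ.star_pairCreate_sum_apply Finset.univ a (fun p => e p.1) (fun p => e p.2) x
  rw [← hξ] at h1
  rw [h1]
  calc _ ≤ ∑ p, ‖a p‖ * ‖Φ.ann (e p.1) (Φ.ann (e p.2) x)‖ := by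
        refine (norm_sum_le _ _).trans_eq (Finset.sum_congr rfl fun p _ => ?_)
        rw [norm_smul, RCLike.norm_conj]
    _ ≤ _ := Real.sum_mul_le_sqrt_mul_sqrt _ _ _
    _ ≤ ‖ξ‖ * (n * ‖x‖) := by rw [hnorm]; gcongr
    _ = _ := by ring

end FermionSystem

/-! ### Expectations of second quantizations and existence of the density matrices. -/

/-- A bounded sesquilinear form on a space with dense image in a Hilbert space is given by a
bounded operator. -/
theorem exists_operator_of_form {D E : Type*} [AddCommGroup D] [Module ℂ D]
    [NormedAddCommGroup E] [InnerProductSpace ℂ E] [CompleteSpace E] (j : D →ₗ[ℂ] E)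
    (hj : DenseRange j) (B : D →ₗ⋆[ℂ] D →ₗ[ℂ] ℂ) {C : ℝ}
    (hB : ∀ ξ η, ‖B ξ η‖ ≤ C * ‖j ξ‖ * ‖j η‖) :
    ∃ T : E →L[ℂ] E, ∀ ξ η, inner ℂ (j ξ) (T (j η)) = B ξ η := by
  have hb : ∀ ξ, (∀ η, ‖B ξ η‖ ≤ (C * ‖j ξ‖) * ‖j η‖) := fun ξ η => hB ξ η
  let L : D → E →L[ℂ] ℂ := fun ξ => (B ξ).extendOfNorm j
  have hL : ∀ ξ η, L ξ (j η) = B ξ η := fun ξ η =>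
    LinearMap.extendOfNorm_eq hj ⟨_, hb ξ⟩ η
  let v : D → E := fun ξ => (InnerProductSpace.toDual ℂ E).symm (L ξ)
  have hv : ∀ ξ η, inner ℂ (v ξ) (j η) = B ξ η := fun ξ η => by
    rw [InnerProductSpace.toDual_symm_apply, hL]
  have hext : ∀ x y : E, (∀ η, inner ℂ x (j η) = inner ℂ y (j η)) → x = y := by
    intro x y h
    refine ext_inner_right ℂ fun w => ?_
    refine hj.induction_on (p := fun w => inner ℂ x w = inner ℂ y w) w ?_ h
    exact isClosed_eq (by fun_prop) (by fun_prop)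
  have hvn : ∀ ξ, ‖v ξ‖ ≤ |C| * ‖j ξ‖ := by
    intro ξ
    rw [LinearIsometryEquiv.norm_map]
    refine ContinuousLinearMap.opNorm_le_bound _ (by positivity) fun w => ?_
    refine LinearMap.norm_extendOfNorm_apply_le hj (|C| * ‖j ξ‖) (fun η => (hB ξ η).trans ?_) w
    gcongr
    exact le_abs_self C
  let V : D →ₗ[ℂ] E :=
    { toFun := v
      map_add' := fun a b => hext _ _ fun η => by
        rw [hv, inner_add_left, hv, hv, map_add, LinearMap.add_apply]
      map_smul' := fun c a => hext _ _ fun η => by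
        rw [hv, RingHom.id_apply, inner_smul_left, hv, map_smulₛₗ, LinearMap.smul_apply,
          smul_eq_mul] }
  -- `V` assigns to `ξ` the Riesz vector of `B ξ`, so it acts on the first slot; the adjoint moves
  -- it to the second.
  refine ⟨ContinuousLinearMap.adjoint (V.extendOfNorm j), fun ξ η => ?_⟩
  rw [ContinuousLinearMap.adjoint_inner_right, LinearMap.extendOfNorm_eq hj ⟨_, hvn⟩]
  exact hv ξ η

namespace NumberExpansion

variable {H : Type*} [NormedAddCommGroup H] [InnerProductSpace ℂ H]
  {F : Type u} [NormedAddCommGroup F] [InnerProductSpace ℂ F] [CompleteSpace F]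
  {Φ : FermionSystem H F} {ω : (F →L[ℂ] F) → ℂ} (e : NumberExpansion Φ ω)


/-- A functional with a number expansion is linear. -/
def linearMap (e : NumberExpansion Φ ω) : (F →L[ℂ] F) →ₗ[ℂ] ℂ where
  toFun := ω
  map_add' X Y := by
    refine (e.hasSum (X + Y)).unique ?_
    convert (e.hasSum X).add (e.hasSum Y) using 2
    rw [_root_.add_apply, inner_add_right]
  map_smul' c X := by
    have h : (fun a => (inner ℂ (e.y a) ((c • X) (e.x a)) : ℂ)) =
      fun a => c * inner ℂ (e.y a) (X (e.x a)) := funext fun a => inner_smul_right _ _ _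
    refine (e.hasSum (c • X)).unique ?_
    rw [h]
    exact (e.hasSum X).mul_left c

theorem norm_mul_norm_le (a : e.idx) :
    ‖e.x a‖ * ‖e.y a‖ ≤ ((e.num a : ℝ) + 1) ^ 2 * (‖e.x a‖ * ‖e.y a‖) := by
  refine le_mul_of_one_le_left (by positivity) ?_
  have : (0 : ℝ) ≤ e.num a := by positivity
  nlinarith

theorem tsum_norm_le {b : e.idx → ℂ} {C : ℝ}
    (hb : ∀ a, ‖b a‖ ≤ C * (((e.num a : ℝ) + 1) ^ 2 * (‖e.x a‖ * ‖e.y a‖))) :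
    ‖∑' a, b a‖ ≤ C * ∑' a, ((e.num a : ℝ) + 1) ^ 2 * (‖e.x a‖ * ‖e.y a‖) :=
  tsum_of_norm_bounded (e.summable.hasSum.mul_left C) hb

theorem norm_le (X : F →L[ℂ] F) :
    ‖ω X‖ ≤ ‖X‖ * ∑' a, ((e.num a : ℝ) + 1) ^ 2 * (‖e.x a‖ * ‖e.y a‖) := by
  rw [← (e.hasSum X).tsum_eq]
  refine e.tsum_norm_le fun a => (norm_inner_le_norm _ _).trans ?_
  calc _ ≤ ‖e.y a‖ * (‖X‖ * ‖e.x a‖) := by gcongr; exact X.le_opNorm _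
    _ = ‖X‖ * (‖e.x a‖ * ‖e.y a‖) := by ring
    _ ≤ _ := mul_le_mul_of_nonneg_left (e.norm_mul_norm_le a) (norm_nonneg _)

/-- Only matrix elements within one sector enter the series. This removes all cross terms between
different changes of particle number. -/
theorem apply_eq_zero (e : NumberExpansion Φ ω) {X : F →L[ℂ] F}
    (hX : ∀ n, ∀ x ∈ Φ.sec n, ∀ y ∈ Φ.sec n, inner ℂ y (X x) = 0) : ω X = 0 := by
  rw [← (e.hasSum X).tsum_eq]
  exact (tsum_congr fun a => hX _ _ (e.x_mem a) _ (e.y_mem a)).trans tsum_zero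

/-- The expectation of the second quantization of `A`. -/
def tau (A : H →L[ℂ] H) : ℂ := ∑' a, inner ℂ (e.y a) (Φ.dGamma A (e.num a) (e.x a))

/-- The expectation of the product of the second quantizations of `A` and `B`. -/
def kappa (A B : H →L[ℂ] H) : ℂ :=
  ∑' a, inner ℂ (e.y a) (Φ.dGamma A (e.num a) (Φ.dGamma B (e.num a) (e.x a)))

theorem tau_one : e.tau 1 = ∑' a, (e.num a : ℂ) * inner ℂ (e.y a) (e.x a) :=
  tsum_congr fun a => by rw [Φ.dGamma_one_apply (e.x_mem a), inner_smul_right]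

/-- For `A` of finite rank, the second quantization is given by one bounded operator on the whole
space, so `tau A` is a value of `ω`; for general `A` it is only a sum over sectors. -/
theorem apply_sum_createLM_ann {κ : Type*} (s : Finset κ) (u v : κ → H) {A : H →L[ℂ] H}
    (hA : ∀ f, A f = ∑ k ∈ s, (inner ℂ (v k) f : ℂ) • u k) :
    ω (∑ k ∈ s, Φ.createLM (u k) * Φ.ann (v k)) = e.tau A := by
  rw [← (e.hasSum _).tsum_eq]
  exact tsum_congr fun a => by rw [Φ.sum_createLM_ann_apply s u v hA (e.x_mem a)]

theorem apply_sum_mul_sum {κ κ' : Type*} (s : Finset κ) (u v : κ → H) {A : H →L[ℂ] H}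
    (hA : ∀ f, A f = ∑ k ∈ s, (inner ℂ (v k) f : ℂ) • u k) (s' : Finset κ') (u' v' : κ' → H)
    {A' : H →L[ℂ] H} (hA' : ∀ f, A' f = ∑ k ∈ s', (inner ℂ (v' k) f : ℂ) • u' k) :
    ω ((∑ k ∈ s', Φ.createLM (u' k) * Φ.ann (v' k)) * ∑ k ∈ s, Φ.createLM (u k) * Φ.ann (v k)) =
      e.kappa A' A := by
  rw [← (e.hasSum _).tsum_eq]
  exact tsum_congr fun a => by
    rw [mul_apply_eq_comp, Φ.sum_createLM_ann_apply s u v hA (e.x_mem a),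
      Φ.sum_createLM_ann_apply s' u' v' hA' (Φ.dGamma_mem _ _ _)]

/-- Dominated convergence: each term converges on its own sector, and a factor `n` is within the
weight `(n + 1)²`. -/
theorem tendsto_tau {σ : Type*} {l : Filter σ} {B : σ → H →L[ℂ] H}
    {A : H →L[ℂ] H} {C : ℝ} (hC : ∀ s, ‖B s‖ ≤ C)
    (hB : ∀ f, Tendsto (fun s => B s f) l (𝓝 (A f))) :
    Tendsto (fun s => e.tau (B s)) l (𝓝 (e.tau A)) := by
  refine tendsto_tsum_of_dominated_convergence (e.summable.mul_left |C|)
    (fun a => ((innerSL ℂ (e.y a)).continuous.tendsto _).comp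
      (Φ.tendsto_dGamma hC hB (e.x_mem a))) (Eventually.of_forall fun s a => ?_)
  have h1 : (e.num a : ℝ) ≤ ((e.num a : ℝ) + 1) ^ 2 := by
    have : (0 : ℝ) ≤ e.num a := by positivity
    nlinarith
  calc _ ≤ ‖e.y a‖ * (e.num a * ‖B s‖ * ‖e.x a‖) :=
        (norm_inner_le_norm _ _).trans (by gcongr; exact Φ.norm_dGamma_apply_le _ _ _)
    _ ≤ ‖e.y a‖ * (((e.num a : ℝ) + 1) ^ 2 * |C| * ‖e.x a‖) := by
        gcongr; exact (hC s).trans (le_abs_self C)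
    _ = _ := by ring

/-- Two second quantizations cost `n²`, which uses the full weight `(n + 1)²`, that is, the second
number moment. -/
theorem tendsto_kappa {σ : Type*} {l : Filter σ} {B B' : σ → H →L[ℂ] H}
    {A A' : H →L[ℂ] H} {C C' : ℝ} (hC : ∀ s, ‖B s‖ ≤ C) (hC' : ∀ s, ‖B' s‖ ≤ C')
    (hB : ∀ f, Tendsto (fun s => B s f) l (𝓝 (A f)))
    (hB' : ∀ f, Tendsto (fun s => B' s f) l (𝓝 (A' f))) :
    Tendsto (fun s => e.kappa (B' s) (B s)) l (𝓝 (e.kappa A' A)) := by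
  refine tendsto_tsum_of_dominated_convergence (e.summable.mul_left (|C'| * |C|))
    (fun a => ((innerSL ℂ (e.y a)).continuous.tendsto _).comp
      (Φ.tendsto_dGamma_dGamma hC hC' hB hB' (e.x_mem a))) (Eventually.of_forall fun s a => ?_)
  have h1 : (e.num a : ℝ) * e.num a ≤ ((e.num a : ℝ) + 1) ^ 2 := by
    have : (0 : ℝ) ≤ e.num a := by positivity
    nlinarith
  have h2 : ‖Φ.dGamma (B' s) (e.num a) (Φ.dGamma (B s) (e.num a) (e.x a))‖ ≤
      e.num a * ‖B' s‖ * (e.num a * ‖B s‖ * ‖e.x a‖) :=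
    (Φ.norm_dGamma_apply_le _ _ _).trans (by gcongr; exact Φ.norm_dGamma_apply_le _ _ _)
  calc _ ≤ ‖e.y a‖ * (e.num a * ‖B' s‖ * (e.num a * ‖B s‖ * ‖e.x a‖)) :=
        (norm_inner_le_norm _ _).trans (by gcongr)
    _ = (e.num a * e.num a) * (‖B' s‖ * ‖B s‖) * (‖e.x a‖ * ‖e.y a‖) := by ring
    _ ≤ ((e.num a : ℝ) + 1) ^ 2 * (|C'| * |C|) * (‖e.x a‖ * ‖e.y a‖) := by
        gcongr
        · exact (hC' s).trans (le_abs_self C')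
        · exact (hC s).trans (le_abs_self C)
    _ = _ := by ring

/-- The sesquilinear form of the one-particle density matrix. -/
def oneForm (e : NumberExpansion Φ ω) : H →ₗ⋆[ℂ] H →ₗ[ℂ] ℂ :=
  LinearMap.mk₂'ₛₗ (starRingEnd ℂ) (RingHom.id ℂ) (fun f g => ω (Φ.createLM g * Φ.ann f))
    (fun f f' g => by
      rw [Φ.ann_add, mul_add]; exact e.linearMap.map_add _ _)
    (fun c f g => by
      rw [Φ.ann_smul, mul_smul_comm]; exact e.linearMap.map_smul _ _)
    (fun f g g' => by
      rw [map_add, add_mul]; exact e.linearMap.map_add _ _)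
    (fun c f g => by
      rw [map_smul, smul_mul_assoc]; exact e.linearMap.map_smul _ _)

/-- The sesquilinear form of the two-particle density matrix. -/
def twoForm (e : NumberExpansion Φ ω) : H ⊗[ℂ] H →ₗ⋆[ℂ] H ⊗[ℂ] H →ₗ[ℂ] ℂ :=
  LinearMap.mk₂'ₛₗ (starRingEnd ℂ) (RingHom.id ℂ)
    (fun ξ η => ω (Φ.pairCreate η * star (Φ.pairCreate ξ)))
    (fun f f' g => by
      rw [map_add, star_add, mul_add]; exact e.linearMap.map_add _ _)
    (fun c f g => by
      rw [map_smul, star_smul, mul_smul_comm]; exact e.linearMap.map_smul _ _)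
    (fun f g g' => by
      rw [map_add, add_mul]; exact e.linearMap.map_add _ _)
    (fun c f g => by
      rw [map_smul, smul_mul_assoc]; exact e.linearMap.map_smul _ _)

/-- The sesquilinear form of the two-hole density matrix. -/
def twoHoleForm (e : NumberExpansion Φ ω) : H ⊗[ℂ] H →ₗ⋆[ℂ] H ⊗[ℂ] H →ₗ[ℂ] ℂ :=
  LinearMap.mk₂'ₛₗ (starRingEnd ℂ) (RingHom.id ℂ)
    (fun ξ η => ω (star (Φ.pairCreate ξ) * Φ.pairCreate η))
    (fun f f' g => by
      rw [map_add, star_add, add_mul]; exact e.linearMap.map_add _ _)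
    (fun c f g => by
      rw [map_smul, star_smul, smul_mul_assoc]; exact e.linearMap.map_smul _ _)
    (fun f g g' => by
      rw [map_add, mul_add]; exact e.linearMap.map_add _ _)
    (fun c f g => by
      rw [map_smul, mul_smul_comm]; exact e.linearMap.map_smul _ _)

theorem norm_oneForm_le (f g : H) : ‖e.oneForm f g‖ ≤
    (∑' a, ((e.num a : ℝ) + 1) ^ 2 * (‖e.x a‖ * ‖e.y a‖)) * ‖f‖ * ‖g‖ := by
  have h1 : ‖Φ.createLM g * Φ.ann f‖ ≤ ‖f‖ * ‖g‖ := by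
    refine (norm_mul_le _ _).trans ?_
    rw [mul_comm]
    gcongr
    · rw [FermionSystem.ann, LinearIsometryEquiv.norm_map]
      exact Φ.norm_createLM_le f
    · exact Φ.norm_createLM_le g
  refine (e.norm_le _).trans ?_
  rw [mul_assoc, mul_comm]
  gcongr

theorem norm_twoForm_le (ξ η : H ⊗[ℂ] H) : ‖e.twoForm ξ η‖ ≤
    (∑' a, ((e.num a : ℝ) + 1) ^ 2 * (‖e.x a‖ * ‖e.y a‖)) * ‖ξ‖ * ‖η‖ := by
  change ‖ω (Φ.pairCreate η * star (Φ.pairCreate ξ))‖ ≤ _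
  rw [← (e.hasSum _).tsum_eq]
  refine (e.tsum_norm_le (C := ‖ξ‖ * ‖η‖) fun a => ?_).trans_eq (by ring)
  -- Placing one pair annihilator on each side earns a factor `n` from each, without bounding the
  -- pair creator on its own.
  have h1 : inner ℂ (e.y a) ((Φ.pairCreate η * star (Φ.pairCreate ξ)) (e.x a)) =
      inner ℂ (star (Φ.pairCreate η) (e.y a)) (star (Φ.pairCreate ξ) (e.x a)) := by
    rw [mul_apply_eq_comp]
    exact (ContinuousLinearMap.adjoint_inner_left _ _ _).symm
  rw [h1]
  have h2 : (e.num a : ℝ) * e.num a ≤ ((e.num a : ℝ) + 1) ^ 2 := by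
    have : (0 : ℝ) ≤ e.num a := by positivity
    nlinarith
  calc _ ≤ (e.num a * ‖η‖ * ‖e.y a‖) * (e.num a * ‖ξ‖ * ‖e.x a‖) :=
        (norm_inner_le_norm _ _).trans (by
          gcongr
          · exact Φ.norm_star_pairCreate_apply_le η (e.y_mem a)
          · exact Φ.norm_star_pairCreate_apply_le ξ (e.x_mem a))
    _ = (‖ξ‖ * ‖η‖) * ((e.num a * e.num a) * (‖e.x a‖ * ‖e.y a‖)) := by ring
    _ ≤ _ := by gcongr

theorem exists_onePDM (e : NumberExpansion Φ ω) [CompleteSpace H] :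
    ∃ γ : H →L[ℂ] H, ∀ f g, inner ℂ f (γ g) = ω (Φ.createLM g * Φ.ann f) :=
  exists_operator_of_form LinearMap.id denseRange_id e.oneForm e.norm_oneForm_le

theorem exists_twoPDM (e : NumberExpansion Φ ω) : ∃ Γ : HTensor H →L[ℂ] HTensor H, ∀ ξ η : H ⊗[ℂ] H,
    inner ℂ (ξ : HTensor H) (Γ (η : HTensor H)) = ω (Φ.pairCreate η * star (Φ.pairCreate ξ)) :=
  exists_operator_of_form (Completion.toComplL (𝕜 := ℂ) (E := H ⊗[ℂ] H)).toLinearMap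
    Completion.denseRange_coe e.twoForm fun ξ η => by
      have := e.norm_twoForm_le ξ η
      rwa [← Completion.norm_coe ξ, ← Completion.norm_coe η] at this

end NumberExpansion

/-! ### The two-particle Hilbert space: density, exchange and product bases. -/

section PairSpace

variable {H : Type*} [NormedAddCommGroup H] [InnerProductSpace ℂ H]

theorem inner_pairTensor (f g f' g' : H) :
    inner ℂ (pairTensor f g) (pairTensor f' g') = inner ℂ f f' * (inner ℂ g g' : ℂ) := by
  rw [pairTensor, pairTensor, Completion.inner_coe, TensorProduct.inner_tmul]

theorem inner_apply_eq_of_tmul {T : HTensor H →L[ℂ] HTensor H}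
    {B : H ⊗[ℂ] H →ₗ⋆[ℂ] H ⊗[ℂ] H →ₗ[ℂ] ℂ}
    (h : ∀ f₁ f₂ g₁ g₂, inner ℂ (pairTensor f₁ f₂) (T (pairTensor g₁ g₂)) =
      B (f₁ ⊗ₜ f₂) (g₁ ⊗ₜ g₂)) (ξ η : H ⊗[ℂ] H) :
    inner ℂ (ξ : HTensor H) (T (η : HTensor H)) = B ξ η := by
  induction ξ using TensorProduct.induction_on with
  | zero => simp [Completion.coe_zero]
  | add ξ ξ' h1 h2 =>
    rw [Completion.coe_add, inner_add_left, h1, h2, map_add, LinearMap.add_apply]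
  | tmul f₁ f₂ =>
    induction η using TensorProduct.induction_on with
    | zero => simp [Completion.coe_zero]
    | add η η' h1 h2 => rw [Completion.coe_add, map_add, inner_add_right, h1, h2, map_add]
    | tmul g₁ g₂ => exact h f₁ f₂ g₁ g₂

theorem ext_inner_coe {x y : HTensor H}
    (h : ∀ f g : H, inner ℂ (pairTensor f g) x = inner ℂ (pairTensor f g) y) : x = y := by
  refine ext_inner_left ℂ fun w => ?_
  induction w using Completion.induction_on with
  | hp => exact isClosed_eq (by fun_prop) (by fun_prop)
  | ih ξ =>
    induction ξ using TensorProduct.induction_on with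
    | zero => simp [Completion.coe_zero]
    | add ξ ξ' h1 h2 => rw [Completion.coe_add, inner_add_left, inner_add_left, h1, h2]
    | tmul f g => exact h f g

theorem ext_pairTensor {T T' : HTensor H →L[ℂ] HTensor H}
    (h : ∀ f g : H, T (pairTensor f g) = T' (pairTensor f g)) : T = T' := by
  ext w
  induction w using Completion.induction_on with
  | hp => exact isClosed_eq (by fun_prop) (by fun_prop)
  | ih ξ =>
    induction ξ using TensorProduct.induction_on with
    | zero => simp [Completion.coe_zero]
    | add ξ ξ' h1 h2 => rw [Completion.coe_add, map_add, map_add, h1, h2]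
    | tmul f g => exact h f g

theorem inner_pairTensor_exchange (f g : H) (w : HTensor H) :
    inner ℂ (pairTensor f g) (exchange H w) = inner ℂ (pairTensor g f) w := by
  induction w using Completion.induction_on with
  | hp => exact isClosed_eq (by fun_prop) (by fun_prop)
  | ih ξ =>
    induction ξ using TensorProduct.induction_on with
    | zero => simp [Completion.coe_zero]
    | add ξ ξ' h1 h2 => rw [Completion.coe_add, map_add, inner_add_right, inner_add_right, h1, h2]
    | tmul f' g' =>
      change inner ℂ (pairTensor f g) (exchange H (pairTensor f' g')) =
        inner ℂ (pairTensor g f) (pairTensor f' g')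
      rw [exchange_pairTensor, inner_pairTensor, inner_pairTensor, mul_comm]

theorem inner_pairTensor_opTensor [CompleteSpace H] (A B : H →L[ℂ] H) (f g : H) (w : HTensor H) :
    inner ℂ (pairTensor f g) (opTensor A B w) =
      inner ℂ (pairTensor (ContinuousLinearMap.adjoint A f) (ContinuousLinearMap.adjoint B g))
        w := by
  induction w using Completion.induction_on with
  | hp => exact isClosed_eq (by fun_prop) (by fun_prop)
  | ih ξ =>
    induction ξ using TensorProduct.induction_on with
    | zero => simp [Completion.coe_zero]
    | add ξ ξ' h1 h2 => rw [Completion.coe_add, map_add, inner_add_right, inner_add_right, h1, h2]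
    | tmul f' g' =>
      change inner ℂ (pairTensor f g) (opTensor A B (pairTensor f' g')) =
        inner ℂ (pairTensor _ _) (pairTensor f' g')
      rw [opTensor_pairTensor, inner_pairTensor, inner_pairTensor,
        ContinuousLinearMap.adjoint_inner_left, ContinuousLinearMap.adjoint_inner_left]

theorem continuous_pairTensor_left (g : H) : Continuous fun f : H => pairTensor f g :=
  (Completion.continuous_coe _).comp ((TensorProduct.continuous_tmul (𝕜 := ℂ) (E := H)
    (F := H)).comp (continuous_id.prodMk continuous_const))

theorem continuous_pairTensor_right (f : H) : Continuous fun g : H => pairTensor f g :=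
  (Completion.continuous_coe _).comp (TensorProduct.mkL ℂ H H f).continuous

/-- A closed condition that is linear holds everywhere if it holds on an orthonormal basis. -/
theorem forall_of_hilbertBasis {κ : Type*} (b : HilbertBasis κ ℂ H) {K : Submodule ℂ H}
    (hK : IsClosed (K : Set H)) (h : ∀ k, b k ∈ K) (f : H) : f ∈ K := by
  have h1 : (Submodule.span ℂ (Set.range b)).topologicalClosure ≤ K := by
    refine Submodule.topologicalClosure_minimal _ ?_ hK
    rw [Submodule.span_le]
    rintro _ ⟨k, rfl⟩
    exact h k
  rw [b.dense_span] at h1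
  exact h1 trivial

theorem orthonormal_pairTensor {κ : Type*} (b : HilbertBasis κ ℂ H) :
    Orthonormal ℂ fun p : κ × κ => pairTensor (b p.1) (b p.2) := by
  have h := FermionSystem.orthonormal_tmul b.orthonormal
  classical
  rw [orthonormal_iff_ite] at h ⊢
  intro p q
  rw [pairTensor, pairTensor, Completion.inner_coe, h]

/-- Totality is obtained one slot at a time, from linearity and continuity of `pairTensor` in each
slot separately. -/
theorem eq_zero_of_inner_pairTensor {κ : Type*} (b : HilbertBasis κ ℂ H) {v : HTensor H}
    (h : ∀ k l, inner ℂ (pairTensor (b k) (b l)) v = 0) : v = 0 := by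
  refine ext_inner_coe fun f g => ?_
  rw [inner_zero_right]
  have h1 : ∀ k g, inner ℂ (pairTensor (b k) g) v = 0 := by
    intro k g
    let K : Submodule ℂ H :=
      { carrier := {g | inner ℂ (pairTensor (b k) g) v = 0}
        zero_mem' := by simp [pairTensor, Completion.coe_zero]
        add_mem' := fun {x y} hx hy => by
          simp only [Set.mem_ofPred_eq, pairTensor] at hx hy ⊢
          rw [TensorProduct.tmul_add, Completion.coe_add, inner_add_left, hx, hy, add_zero]
        smul_mem' := fun c x hx => by
          simp only [Set.mem_ofPred_eq, pairTensor] at hx ⊢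
          rw [TensorProduct.tmul_smul, Completion.coe_smul, inner_smul_left, hx, mul_zero] }
    have hK : IsClosed (K : Set H) := isClosed_eq
      ((continuous_pairTensor_right (b k)).inner continuous_const) continuous_const
    exact forall_of_hilbertBasis b hK (h k) g
  let K : Submodule ℂ H :=
    { carrier := {f | inner ℂ (pairTensor f g) v = 0}
      zero_mem' := by simp [pairTensor, Completion.coe_zero]
      add_mem' := fun {x y} hx hy => by
        simp only [Set.mem_ofPred_eq, pairTensor] at hx hy ⊢
        rw [TensorProduct.add_tmul, Completion.coe_add, inner_add_left, hx, hy, add_zero]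
      smul_mem' := fun c x hx => by
        simp only [Set.mem_ofPred_eq, pairTensor] at hx ⊢
        rw [← TensorProduct.smul_tmul', Completion.coe_smul, inner_smul_left, hx, mul_zero] }
  have hK : IsClosed (K : Set H) := isClosed_eq
    ((continuous_pairTensor_left g).inner continuous_const) continuous_const
  exact forall_of_hilbertBasis b hK (fun k => h1 k g) f

/-- The orthonormal basis of the tensor product given by an orthonormal basis. -/
def pairBasis {κ : Type*} (b : HilbertBasis κ ℂ H) : HilbertBasis (κ × κ) ℂ (HTensor H) :=
  HilbertBasis.mkOfOrthogonalEqBot (orthonormal_pairTensor b) (by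
    rw [Submodule.eq_bot_iff]
    intro v hv
    refine eq_zero_of_inner_pairTensor b fun k l => ?_
    exact (Submodule.mem_orthogonal _ _).1 hv _ (Submodule.subset_span ⟨(k, l), rfl⟩))

theorem pairBasis_apply {κ : Type*} (b : HilbertBasis κ ℂ H) (p : κ × κ) :
    pairBasis b p = pairTensor (b p.1) (b p.2) := by
  rw [pairBasis, HilbertBasis.coe_mkOfOrthogonalEqBot]

/-- Brings test vectors back to algebraic tensors of basis vectors, for which `pairCreate` is a
polynomial in the ladder operators. -/
theorem exists_coe_eq_of_mem_span {κ : Type*} (b : HilbertBasis κ ℂ H) {w : HTensor H}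
    (hw : w ∈ Submodule.span ℂ (Set.range (pairBasis b))) :
    ∃ ξ ∈ Submodule.span ℂ (Set.range fun p : κ × κ => b p.1 ⊗ₜ[ℂ] b p.2), (ξ : HTensor H) = w := by
  have h1 : Set.range (pairBasis b) = (Completion.toComplL (𝕜 := ℂ) (E := H ⊗[ℂ] H)).toLinearMap ''
      (Set.range fun p : κ × κ => b p.1 ⊗ₜ[ℂ] b p.2) := by
    rw [← Set.range_comp]
    congr 1
    funext p
    exact pairBasis_apply b p
  rw [h1, ← Submodule.map_span] at hw
  exact hw

end PairSpace

/-! ### Positivity on dense subspaces and trace class criteria. -/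

section Positivity

variable {E : Type*} [NormedAddCommGroup E] [InnerProductSpace ℂ E]

theorem nonneg_iff_inner {T : E →L[ℂ] E} : 0 ≤ T ↔ ∀ x, 0 ≤ (inner ℂ x (T x) : ℂ) := by
  rw [ContinuousLinearMap.nonneg_iff_isPositive, ContinuousLinearMap.isPositive_iff_complex]
  refine forall_congr' fun x => ?_
  have hc : (inner ℂ (T x) x : ℂ) = starRingEnd ℂ (inner ℂ x (T x)) := (inner_conj_symm _ _).symm
  rw [hc, Complex.le_def]
  generalize (inner ℂ x (T x) : ℂ) = z
  constructor
  · rintro ⟨h1, h2⟩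
    have h3 := congrArg Complex.im h1
    exact ⟨by simpa using h2, Eq.symm (by simpa using h3)⟩
  · rintro ⟨h1, h2⟩
    refine ⟨Complex.ext ?_ ?_, by simpa using h1⟩
    · simp
    · simpa using h2.symm

/-- The order on `ℂ` includes reality of the quadratic form, and both this and nonnegativity of the
real part are closed conditions. -/
theorem nonneg_of_dense {T : E →L[ℂ] E} {κ : Type*} (b : HilbertBasis κ ℂ E)
    (h : ∀ x ∈ Submodule.span ℂ (Set.range b), 0 ≤ (inner ℂ x (T x) : ℂ)) : 0 ≤ T := by
  refine nonneg_iff_inner.2 fun x => ?_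
  have hx : x ∈ (Submodule.span ℂ (Set.range b)).topologicalClosure := by
    rw [b.dense_span]; trivial
  have hc : IsClosed {x : E | 0 ≤ (inner ℂ x (T x) : ℂ)} := by
    have : {x : E | 0 ≤ (inner ℂ x (T x) : ℂ)} =
        {x : E | 0 ≤ (inner ℂ x (T x) : ℂ).re} ∩ {x : E | 0 = (inner ℂ x (T x) : ℂ).im} := by
      ext x
      exact Complex.le_def
    rw [this]
    exact (isClosed_le continuous_const (by fun_prop)).inter
      (isClosed_eq continuous_const (by fun_prop))
  exact closure_minimal h hc hx

theorem hasSum_norm_inner_sq {κ : Type*} (b : HilbertBasis κ ℂ E) (x : E) :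
    HasSum (fun k => ‖(inner ℂ (b k) x : ℂ)‖ ^ 2) (‖x‖ ^ 2) := by
  have h := b.hasSum_inner_mul_inner x x
  have h1 := Complex.hasSum_re h
  have h2 : (inner ℂ x x : ℂ).re = ‖x‖ ^ 2 := inner_self_eq_norm_sq (𝕜 := ℂ) x
  rw [h2] at h1
  convert h1 using 2 with k
  rw [← inner_conj_symm x (b k), mul_comm, Complex.mul_conj, Complex.normSq_eq_norm_sq,
    Complex.ofReal_re]

/-- Both sums equal the double sum of `|⟨b' l, S (b k)⟩|²`, by Parseval in either index and
self-adjointness of `S`. -/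
theorem summable_norm_sq_of_hilbertBasis [CompleteSpace E] {κ κ' : Type*} (b : HilbertBasis κ ℂ E)
    (b' : HilbertBasis κ' ℂ E) {S : E →L[ℂ] E} (hS : ContinuousLinearMap.adjoint S = S)
    (h : Summable fun k => ‖S (b k)‖ ^ 2) : Summable fun k => ‖S (b' k)‖ ^ 2 := by
  have h1 : Summable fun p : κ × κ' => ‖(inner ℂ (b' p.2) (S (b p.1)) : ℂ)‖ ^ 2 := by
    refine (summable_prod_of_nonneg fun _ => sq_nonneg _).2
      ⟨fun k => (hasSum_norm_inner_sq b' (S (b k))).summable, ?_⟩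
    exact h.congr fun k => (hasSum_norm_inner_sq b' (S (b k))).tsum_eq.symm
  have h3 : Summable fun p : κ' × κ => ‖(inner ℂ (b' p.1) (S (b p.2)) : ℂ)‖ ^ 2 :=
    (Equiv.prodComm κ' κ).summable_iff.2 h1
  have h2 := ((summable_prod_of_nonneg fun _ => sq_nonneg _).1 h3).2
  refine h2.congr fun k => ?_
  rw [← (hasSum_norm_inner_sq b (S (b' k))).tsum_eq]
  refine tsum_congr fun l => ?_
  rw [norm_inner_symm, ← ContinuousLinearMap.adjoint_inner_right, hS]

/-- For `T ≥ 0` one has `|T| = T`, and a convergent diagonal sum in one basis of choice suffices; a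
product basis can then be used for `Γ`. -/
theorem isTraceClass_of_nonneg {E : Type u} [NormedAddCommGroup E] [InnerProductSpace ℂ E]
    [CompleteSpace E] {κ : Type*} (b : HilbertBasis κ ℂ E) {T : E →L[ℂ] E} (hT : 0 ≤ T)
    (h : Summable fun k => (inner ℂ (b k) (T (b k)) : ℂ).re) : IsTraceClass T := by
  rw [isTraceClass_iff]
  refine summable_norm_sq_of_hilbertBasis b (onb E) (adjoint_sqrtAbs T) (h.congr fun k => ?_)
  have h1 := inner_abs_self T (b k)
  rw [CFC.abs_of_nonneg T hT] at h1
  rw [h1, Complex.ofReal_re]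

end Positivity

/-! ### Normal ordering: traces of density matrices as expectations. -/

namespace NumberExpansion

variable {H : Type*} [NormedAddCommGroup H] [InnerProductSpace ℂ H]
  {F : Type u} [NormedAddCommGroup F] [InnerProductSpace ℂ F] [CompleteSpace F]
  {Φ : FermionSystem H F} {ω : (F →L[ℂ] F) → ℂ} (e : NumberExpansion Φ ω)

theorem map_add' (e : NumberExpansion Φ ω) (X Y : F →L[ℂ] F) : ω (X + Y) = ω X + ω Y :=
  e.linearMap.map_add X Y

theorem map_sub' (e : NumberExpansion Φ ω) (X Y : F →L[ℂ] F) : ω (X - Y) = ω X - ω Y :=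
  e.linearMap.map_sub X Y

theorem map_neg' (e : NumberExpansion Φ ω) (X : F →L[ℂ] F) : ω (-X) = -ω X :=
  e.linearMap.map_neg X

theorem map_smul' (e : NumberExpansion Φ ω) (c : ℂ) (X : F →L[ℂ] F) : ω (c • X) = c * ω X :=
  e.linearMap.map_smul c X

theorem map_sum' (e : NumberExpansion Φ ω) {κ : Type*} (s : Finset κ) (X : κ → F →L[ℂ] F) :
    ω (∑ k ∈ s, X k) = ∑ k ∈ s, ω (X k) :=
  map_sum e.linearMap X s

section OneBody

variable [CompleteSpace H] {γ : H →L[ℂ] H}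

/-- The partial sum over `s` is the expectation of the second quantization of `P_s A`, which tends
to `A` strongly and boundedly. The sum therefore does not depend on the basis. -/
theorem hasSum_inner_mul_onePDM
    (hγ : ∀ f g, inner ℂ f (γ g) = ω (Φ.createLM g * Φ.ann f)) {κ : Type*}
    (b : HilbertBasis κ ℂ H) (A : H →L[ℂ] H) :
    HasSum (fun k => inner ℂ (b k) ((A * γ) (b k))) (e.tau A) := by
  have h1 : Tendsto (fun s => e.tau (finiteProj b s ∘L A)) atTop (𝓝 (e.tau A)) := by
    refine e.tendsto_tau (C := ‖A‖) (fun s => ?_) fun f => tendsto_finiteProj b (A f)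
    refine (ContinuousLinearMap.opNorm_comp_le _ _).trans ?_
    exact mul_le_of_le_one_left (norm_nonneg _) (norm_finiteProj_le b.orthonormal s)
  refine Tendsto.congr (fun s => ?_) h1
  rw [← e.apply_sum_createLM_ann s b (fun k => ContinuousLinearMap.adjoint A (b k))
    (fun f => ?_), e.map_sum']
  · refine Finset.sum_congr rfl fun k _ => ?_
    rw [← hγ, ContinuousLinearMap.adjoint_inner_left]
    rfl
  · rw [ContinuousLinearMap.comp_apply, finiteProj_apply]
    simp_rw [ContinuousLinearMap.adjoint_inner_left]

theorem trace_mul_onePDM (hγ : ∀ f g, inner ℂ f (γ g) = ω (Φ.createLM g * Φ.ann f))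
    (A : H →L[ℂ] H) : trace (A * γ) = e.tau A :=
  (e.hasSum_inner_mul_onePDM hγ (onb H) A).tsum_eq

end OneBody

section TwoBody

variable {γ : H →L[ℂ] H} {Γ : HTensor H →L[ℂ] HTensor H}

theorem inner_twoPDM
    (hΓ : ∀ f₁ f₂ g₁ g₂, inner ℂ (pairTensor f₁ f₂) (Γ (pairTensor g₁ g₂)) =
      ω (Φ.createLM g₂ * Φ.createLM g₁ * Φ.ann f₁ * Φ.ann f₂))
    (e : NumberExpansion Φ ω) (ξ η : H ⊗[ℂ] H) :
    inner ℂ (ξ : HTensor H) (Γ (η : HTensor H)) =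
      ω (Φ.pairCreate η * star (Φ.pairCreate ξ)) := by
  refine inner_apply_eq_of_tmul (B := e.twoForm) (fun f₁ f₂ g₁ g₂ => ?_) ξ η
  change _ = ω (Φ.pairCreate (g₁ ⊗ₜ g₂) * star (Φ.pairCreate (f₁ ⊗ₜ f₂)))
  rw [hΓ, Φ.star_pairCreate_tmul, Φ.pairCreate_tmul]
  simp only [mul_assoc]

theorem exchange_mul_twoPDM
    (hΓ : ∀ f₁ f₂ g₁ g₂, inner ℂ (pairTensor f₁ f₂) (Γ (pairTensor g₁ g₂)) =
      ω (Φ.createLM g₂ * Φ.createLM g₁ * Φ.ann f₁ * Φ.ann f₂))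
    (e : NumberExpansion Φ ω) : exchange H * Γ = -Γ := by
  refine ext_pairTensor fun g₁ g₂ => ext_inner_coe fun f₁ f₂ => ?_
  rw [mul_apply_eq_comp, inner_pairTensor_exchange, _root_.neg_apply, inner_neg_right, hΓ, hΓ,
    ← e.map_neg']
  rw [mul_assoc, Φ.ann_mul_ann, mul_neg, mul_assoc _ (Φ.ann f₁)]

theorem twoPDM_mul_exchange
    (hΓ : ∀ f₁ f₂ g₁ g₂, inner ℂ (pairTensor f₁ f₂) (Γ (pairTensor g₁ g₂)) =
      ω (Φ.createLM g₂ * Φ.createLM g₁ * Φ.ann f₁ * Φ.ann f₂))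
    (e : NumberExpansion Φ ω) : Γ * exchange H = -Γ := by
  refine ext_pairTensor fun g₁ g₂ => ext_inner_coe fun f₁ f₂ => ?_
  rw [mul_apply_eq_comp, exchange_pairTensor, _root_.neg_apply, inner_neg_right, hΓ, hΓ,
    ← e.map_neg', Φ.createLM_mul_createLM g₁ g₂]
  simp only [neg_mul]

/-- In the product of `dΓ(P_s A*)` and `dΓ(P_s A)`, the normal ordered part produces `Γ` and the
single contraction produces `Ex (γ ⊗ 1)`. -/
theorem pair_sum_eq [CompleteSpace H] (e : NumberExpansion Φ ω)
    (hγ : ∀ f g, inner ℂ f (γ g) = ω (Φ.createLM g * Φ.ann f))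
    (hΓ : ∀ f₁ f₂ g₁ g₂, inner ℂ (pairTensor f₁ f₂) (Γ (pairTensor g₁ g₂)) =
      ω (Φ.createLM g₂ * Φ.createLM g₁ * Φ.ann f₁ * Φ.ann f₂))
    {κ : Type*} (b : κ → H) (A : H →L[ℂ] H) (s : Finset κ) :
    ∑ k ∈ s, ∑ l ∈ s, inner ℂ (pairTensor (b k) (b l))
      ((opTensor (star A) A * (Γ + exchange H * opTensor γ 1)) (pairTensor (b k) (b l))) =
      e.kappa (finiteProj b s ∘L star A) (finiteProj b s ∘L A) := by
  rw [← e.apply_sum_mul_sum s b (fun k => ContinuousLinearMap.adjoint A (b k)) (fun f => ?_)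
    s b (fun k => A (b k)) (fun f => ?_)]
  · rw [Finset.sum_mul_sum, e.map_sum']
    refine Finset.sum_congr rfl fun k _ => ?_
    rw [e.map_sum']
    refine Finset.sum_congr rfl fun l _ => ?_
    have h1 : Φ.createLM (b k) * Φ.ann (A (b k)) *
        (Φ.createLM (b l) * Φ.ann (ContinuousLinearMap.adjoint A (b l))) =
        Φ.createLM (b l) * Φ.createLM (b k) * Φ.ann (A (b k)) *
          Φ.ann (ContinuousLinearMap.adjoint A (b l)) +
        (inner ℂ (A (b k)) (b l) : ℂ) •
          (Φ.createLM (b k) * Φ.ann (ContinuousLinearMap.adjoint A (b l))) := by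
      rw [Φ.createLM_mul_createLM (b l), mul_assoc, ← mul_assoc (Φ.ann _), Φ.ann_mul_createLM,
        sub_mul, mul_sub, smul_mul_assoc, mul_smul_comm, one_mul]
      simp only [neg_mul, mul_assoc]
      abel
    have h2 : ContinuousLinearMap.adjoint (star A) = A := ContinuousLinearMap.adjoint_adjoint A
    rw [h1, e.map_add', e.map_smul', ← hΓ, ← hγ, mul_apply_eq_comp, inner_pairTensor_opTensor, h2,
      _root_.add_apply, inner_add_right, mul_apply_eq_comp, opTensor_pairTensor,
      exchange_pairTensor, inner_pairTensor]
    rfl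
  · rw [ContinuousLinearMap.comp_apply, finiteProj_apply]
    simp_rw [ContinuousLinearMap.adjoint_inner_left]
  · rw [ContinuousLinearMap.comp_apply, finiteProj_apply]
    refine Finset.sum_congr rfl fun k _ => ?_
    rw [← ContinuousLinearMap.adjoint_inner_right]
    rfl

/-- The limit makes no reference to `b`. This is what gives the trace in the G-Condition a meaning
in every basis. -/
theorem tendsto_pair_sum [CompleteSpace H] (e : NumberExpansion Φ ω)
    (hγ : ∀ f g, inner ℂ f (γ g) = ω (Φ.createLM g * Φ.ann f))
    (hΓ : ∀ f₁ f₂ g₁ g₂, inner ℂ (pairTensor f₁ f₂) (Γ (pairTensor g₁ g₂)) =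
      ω (Φ.createLM g₂ * Φ.createLM g₁ * Φ.ann f₁ * Φ.ann f₂))
    {κ : Type*} (b : HilbertBasis κ ℂ H) (A : H →L[ℂ] H) :
    Tendsto (fun s : Finset κ => ∑ k ∈ s, ∑ l ∈ s, inner ℂ (pairTensor (b k) (b l))
      ((opTensor (star A) A * (Γ + exchange H * opTensor γ 1)) (pairTensor (b k) (b l))))
      atTop (𝓝 (e.kappa (star A) A)) := by
  simp_rw [e.pair_sum_eq hγ hΓ]
  have h : ∀ B : H →L[ℂ] H, ∀ s, ‖finiteProj b s ∘L B‖ ≤ ‖B‖ := fun B s =>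
    (ContinuousLinearMap.opNorm_comp_le _ _).trans
      (mul_le_of_le_one_left (norm_nonneg _) (norm_finiteProj_le b.orthonormal s))
  exact e.tendsto_kappa (h A) (h (star A)) (fun f => tendsto_finiteProj b (A f))
    (fun f => tendsto_finiteProj b (star A f))

/-- Normal ordering of `c c c* c*`: full contractions give `1 - Ex`, single contractions give the
terms in `γ`, and the uncontracted term gives `Γ`. -/
theorem inner_twoHole (e : NumberExpansion Φ ω) (h1 : ω 1 = 1)
    (hγ : ∀ f g, inner ℂ f (γ g) = ω (Φ.createLM g * Φ.ann f))
    (hΓ : ∀ f₁ f₂ g₁ g₂, inner ℂ (pairTensor f₁ f₂) (Γ (pairTensor g₁ g₂)) =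
      ω (Φ.createLM g₂ * Φ.createLM g₁ * Φ.ann f₁ * Φ.ann f₂)) (ξ η : H ⊗[ℂ] H) :
    inner ℂ (ξ : HTensor H) ((Γ + (1 - exchange H) * (opTensor 1 1 - opTensor γ 1 - opTensor 1 γ) :
      HTensor H →L[ℂ] HTensor H) (η : HTensor H)) = ω (star (Φ.pairCreate ξ) * Φ.pairCreate η) := by
  refine inner_apply_eq_of_tmul (B := e.twoHoleForm) (fun f₁ f₂ g₁ g₂ => ?_) ξ η
  change _ = ω (star (Φ.pairCreate (f₁ ⊗ₜ f₂)) * Φ.pairCreate (g₁ ⊗ₜ g₂))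
  rw [Φ.star_pairCreate_tmul, Φ.pairCreate_tmul]
  have h2 : Φ.ann f₁ * Φ.ann f₂ * (Φ.createLM g₂ * Φ.createLM g₁) =
      (inner ℂ f₂ g₂ * inner ℂ f₁ g₁ - inner ℂ f₁ g₂ * inner ℂ f₂ g₁ : ℂ) • (1 : F →L[ℂ] F)
      - (inner ℂ f₂ g₂ : ℂ) • (Φ.createLM g₁ * Φ.ann f₁)
      - (inner ℂ f₁ g₁ : ℂ) • (Φ.createLM g₂ * Φ.ann f₂)
      + (inner ℂ f₁ g₂ : ℂ) • (Φ.createLM g₁ * Φ.ann f₂)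
      + (inner ℂ f₂ g₁ : ℂ) • (Φ.createLM g₂ * Φ.ann f₁)
      + Φ.createLM g₂ * Φ.createLM g₁ * Φ.ann f₁ * Φ.ann f₂ := by
    have c11 := Φ.ann_mul_createLM f₁ g₁
    have c12 := Φ.ann_mul_createLM f₁ g₂
    have c21 := Φ.ann_mul_createLM f₂ g₁
    have c22 := Φ.ann_mul_createLM f₂ g₂
    calc Φ.ann f₁ * Φ.ann f₂ * (Φ.createLM g₂ * Φ.createLM g₁)
        = Φ.ann f₁ * (Φ.ann f₂ * Φ.createLM g₂) * Φ.createLM g₁ := by simp only [mul_assoc]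
      _ = (inner ℂ f₂ g₂ : ℂ) • (Φ.ann f₁ * Φ.createLM g₁)
          - (Φ.ann f₁ * Φ.createLM g₂) * (Φ.ann f₂ * Φ.createLM g₁) := by
          rw [c22]
          simp only [mul_sub, sub_mul, mul_smul_comm, smul_mul_assoc, mul_one, mul_assoc]
      _ = (inner ℂ f₂ g₂ : ℂ) • (Φ.ann f₁ * Φ.createLM g₁)
          - ((inner ℂ f₁ g₂ : ℂ) • (Φ.ann f₂ * Φ.createLM g₁)
            - (inner ℂ f₂ g₁ : ℂ) • (Φ.createLM g₂ * Φ.ann f₁)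
            + Φ.createLM g₂ * (Φ.ann f₁ * Φ.createLM g₁) * Φ.ann f₂) := by
          congr 1
          rw [c12]
          conv_lhs => rw [sub_mul, smul_mul_assoc, one_mul]
          conv_lhs => enter [2]; rw [c21]
          simp only [mul_sub, mul_smul_comm, mul_one, mul_assoc]
          abel
      _ = _ := by
          rw [c11, c21]
          simp only [mul_sub, sub_mul, smul_sub, mul_smul_comm, smul_mul_assoc, mul_one,
            sub_smul, smul_smul, mul_assoc]
          abel
  rw [h2]
  simp only [e.map_add', e.map_sub', e.map_smul', ← hΓ, ← hγ, h1, mul_one]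
  rw [_root_.add_apply, inner_add_right, add_comm]
  congr 1
  simp only [mul_apply_eq_comp, _root_.sub_apply, opTensor_pairTensor, map_sub, inner_sub_right,
    one_apply_eq_self, exchange_pairTensor, inner_pairTensor]
  ring

end TwoBody

end NumberExpansion

/-! ### Compressions to finitely many basis vectors. -/

section FiniteProjection

variable {H : Type*} [NormedAddCommGroup H] [InnerProductSpace ℂ H] {κ : Type*}

theorem inner_finiteProj_left (b : κ → H) (s : Finset κ) (f g : H) :
    inner ℂ (finiteProj b s f) g = (inner ℂ f (finiteProj b s g) : ℂ) := by
  rw [finiteProj_apply, finiteProj_apply, sum_inner, inner_sum]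
  refine Finset.sum_congr rfl fun k _ => ?_
  rw [inner_smul_left, inner_smul_right, inner_conj_symm, mul_comm]

theorem finiteProj_mem_span (b : κ → H) (s : Finset κ) (f : H) :
    finiteProj b s f ∈ Submodule.span ℂ (Set.range b) := by
  rw [finiteProj_apply]
  exact Submodule.sum_mem _ fun k _ => Submodule.smul_mem _ _ (Submodule.subset_span ⟨k, rfl⟩)

/-- The compression of `A` to the span of finitely many vectors. -/
def compression (b : κ → H) (A : H →L[ℂ] H) (s : Finset κ) : H →L[ℂ] H :=
  finiteProj b s ∘L A ∘L finiteProj b s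

theorem norm_compression_le {b : κ → H} (hb : Orthonormal ℂ b) (A : H →L[ℂ] H) (s : Finset κ) :
    ‖compression b A s‖ ≤ ‖A‖ := by
  refine (ContinuousLinearMap.opNorm_comp_le _ _).trans ?_
  refine (mul_le_of_le_one_left (norm_nonneg _) (norm_finiteProj_le hb s)).trans ?_
  refine (ContinuousLinearMap.opNorm_comp_le _ _).trans ?_
  exact mul_le_of_le_one_right (norm_nonneg _) (norm_finiteProj_le hb s)

theorem tendsto_compression (b : HilbertBasis κ ℂ H) (A : H →L[ℂ] H) (f : H) :
    Tendsto (fun s => compression b A s f) atTop (𝓝 (A f)) := by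
  have h1 := tendsto_finiteProj b (A f)
  have h2 : Tendsto (fun s => finiteProj b s (A (finiteProj b s f - f))) atTop (𝓝 0) := by
    have h3 : Tendsto (fun s => ‖A (finiteProj b s f - f)‖) atTop (𝓝 0) := by
      have h4 := (A.continuous.tendsto _).comp ((tendsto_finiteProj b f).sub_const f)
      rw [sub_self, map_zero] at h4
      have := h4.norm
      simpa using this
    exact squeeze_zero_norm (fun s => norm_finiteProj_apply_le b.orthonormal s _) h3
  have h5 := h2.add h1
  rw [zero_add] at h5
  refine h5.congr fun s => ?_
  rw [← map_add, ← map_add, sub_add_cancel]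
  rfl

end FiniteProjection

/-! ### Polynomials of degree at most two and their normal form. -/

namespace FermionSystem

variable {H : Type*} [NormedAddCommGroup H] [InnerProductSpace ℂ H]
  {F : Type*} [NormedAddCommGroup F] [InnerProductSpace ℂ F] [CompleteSpace F]
  (Φ : FermionSystem H F) {ι : Type*} (φ : ι → H)

/-- The constants and the creation and annihilation operators of the vectors `φ k`. -/
def ladderSet : Set (F →L[ℂ] F) :=
  {1} ∪ Set.range (fun k => Φ.createLM (φ k)) ∪ Set.range (fun k => Φ.ann (φ k))

/-- The polynomials of degree at most `r` in creation and annihilation operators. -/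
def ladder (r : ℕ) : Submodule ℂ (F →L[ℂ] F) := Submodule.span ℂ (Φ.ladderSet φ) ^ r

theorem ladder_two : Φ.ladder φ 2 =
    Submodule.span ℂ (Φ.ladderSet φ) * Submodule.span ℂ (Φ.ladderSet φ) := by
  rw [ladder, Submodule.pow_succ, Submodule.pow_one]

theorem mul_mem_ladder {X Y : F →L[ℂ] F} (hX : X ∈ Submodule.span ℂ (Φ.ladderSet φ))
    (hY : Y ∈ Submodule.span ℂ (Φ.ladderSet φ)) : X * Y ∈ Φ.ladder φ 2 := by
  rw [ladder_two]
  exact Submodule.mul_mem_mul hX hY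

theorem one_mem_span : (1 : F →L[ℂ] F) ∈ Submodule.span ℂ (Φ.ladderSet φ) :=
  Submodule.subset_span (Or.inl (Or.inl rfl))

theorem mem_ladder_of_mem_span {X : F →L[ℂ] F} (hX : X ∈ Submodule.span ℂ (Φ.ladderSet φ)) :
    X ∈ Φ.ladder φ 2 := by
  simpa using Φ.mul_mem_ladder φ hX (Φ.one_mem_span φ)

theorem ladder_le {r : ℕ} (hr : r ≤ 2) : Φ.ladder φ r ≤ Φ.ladder φ 2 := by
  intro X hX
  interval_cases r
  · rw [ladder, Submodule.pow_zero, Submodule.mem_one] at hX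
    obtain ⟨c, rfl⟩ := hX
    rw [Algebra.algebraMap_eq_smul_one]
    exact Submodule.smul_mem _ _ (Φ.mem_ladder_of_mem_span φ (Φ.one_mem_span φ))
  · rw [ladder, Submodule.pow_one] at hX
    exact Φ.mem_ladder_of_mem_span φ hX
  · exact hX

variable {φ}

theorem createLM_mem_span {f : H} (hf : f ∈ Submodule.span ℂ (Set.range φ)) :
    Φ.createLM f ∈ Submodule.span ℂ (Φ.ladderSet φ) := by
  induction hf using Submodule.span_induction with
  | mem x hx =>
    obtain ⟨k, rfl⟩ := hx
    exact Submodule.subset_span (Or.inl (Or.inr ⟨k, rfl⟩))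
  | zero => rw [map_zero]; exact Submodule.zero_mem _
  | add x y _ _ hx hy => rw [map_add]; exact Submodule.add_mem _ hx hy
  | smul c x _ hx => rw [map_smul]; exact Submodule.smul_mem _ _ hx

theorem ann_mem_span {f : H} (hf : f ∈ Submodule.span ℂ (Set.range φ)) :
    Φ.ann f ∈ Submodule.span ℂ (Φ.ladderSet φ) := by
  induction hf using Submodule.span_induction with
  | mem x hx =>
    obtain ⟨k, rfl⟩ := hx
    exact Submodule.subset_span (Or.inr ⟨k, rfl⟩)
  | zero => rw [ann, map_zero, map_zero]; exact Submodule.zero_mem _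
  | add x y _ _ hx hy => rw [ann_add]; exact Submodule.add_mem _ hx hy
  | smul c x _ hx => rw [ann_smul]; exact Submodule.smul_mem _ _ hx

theorem pairCreate_mem_ladder {ξ : H ⊗[ℂ] H}
    (hξ : ξ ∈ Submodule.span ℂ (Set.range fun p : ι × ι => φ p.1 ⊗ₜ[ℂ] φ p.2)) :
    Φ.pairCreate ξ ∈ Φ.ladder φ 2 := by
  induction hξ using Submodule.span_induction with
  | mem x hx =>
    obtain ⟨k, rfl⟩ := hx
    exact Φ.mul_mem_ladder φ (Φ.createLM_mem_span (Submodule.subset_span ⟨_, rfl⟩))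
      (Φ.createLM_mem_span (Submodule.subset_span ⟨_, rfl⟩))
  | zero => rw [map_zero]; exact Submodule.zero_mem _
  | add x y _ _ hx hy => rw [map_add]; exact Submodule.add_mem _ hx hy
  | smul c x _ hx => rw [map_smul]; exact Submodule.smul_mem _ _ hx

theorem star_pairCreate_mem_ladder {ξ : H ⊗[ℂ] H}
    (hξ : ξ ∈ Submodule.span ℂ (Set.range fun p : ι × ι => φ p.1 ⊗ₜ[ℂ] φ p.2)) :
    star (Φ.pairCreate ξ) ∈ Φ.ladder φ 2 := by
  induction hξ using Submodule.span_induction with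
  | mem x hx =>
    obtain ⟨k, rfl⟩ := hx
    rw [star_pairCreate_tmul]
    exact Φ.mul_mem_ladder φ (Φ.ann_mem_span (Submodule.subset_span ⟨_, rfl⟩))
      (Φ.ann_mem_span (Submodule.subset_span ⟨_, rfl⟩))
  | zero => rw [map_zero, star_zero]; exact Submodule.zero_mem _
  | add x y _ _ hx hy => rw [map_add, star_add]; exact Submodule.add_mem _ hx hy
  | smul c x _ hx => rw [map_smul, star_smul]; exact Submodule.smul_mem _ _ hx

variable (φ) in
/-- The normal form of a polynomial of degree at most two. -/
theorem exists_normalForm {P : F →L[ℂ] F} (hP : P ∈ Φ.ladder φ 2) :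
    ∃ (a : ℂ) (f g : H) (ξ η : H ⊗[ℂ] H),
      ∃ D ∈ Submodule.span ℂ (Set.range fun p : H × H => Φ.createLM p.1 * Φ.ann p.2),
      P = (a • 1 + D) + Φ.ann f + Φ.createLM g + star (Φ.pairCreate ξ) + Φ.pairCreate η := by
  rw [ladder_two, Submodule.span_mul_span] at hP
  have ann0 : Φ.ann 0 = 0 := by rw [ann, map_zero, map_zero]
  have hconst : ∀ a : ℂ, ∃ (a' : ℂ) (f g : H) (ξ η : H ⊗[ℂ] H),
      ∃ D ∈ Submodule.span ℂ (Set.range fun p : H × H => Φ.createLM p.1 * Φ.ann p.2),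
      a • (1 : F →L[ℂ] F) = (a' • 1 + D) + Φ.ann f + Φ.createLM g + star (Φ.pairCreate ξ) +
        Φ.pairCreate η := fun a =>
    ⟨a, 0, 0, 0, 0, 0, Submodule.zero_mem _, by simp [ann0]⟩
  have hann : ∀ f : H, ∃ (a : ℂ) (f' g : H) (ξ η : H ⊗[ℂ] H),
      ∃ D ∈ Submodule.span ℂ (Set.range fun p : H × H => Φ.createLM p.1 * Φ.ann p.2),
      Φ.ann f = (a • 1 + D) + Φ.ann f' + Φ.createLM g + star (Φ.pairCreate ξ) +
        Φ.pairCreate η := fun f =>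
    ⟨0, f, 0, 0, 0, 0, Submodule.zero_mem _, by simp⟩
  have hcreate : ∀ f : H, ∃ (a : ℂ) (f' g : H) (ξ η : H ⊗[ℂ] H),
      ∃ D ∈ Submodule.span ℂ (Set.range fun p : H × H => Φ.createLM p.1 * Φ.ann p.2),
      Φ.createLM f = (a • 1 + D) + Φ.ann f' + Φ.createLM g + star (Φ.pairCreate ξ) +
        Φ.pairCreate η := fun f =>
    ⟨0, 0, f, 0, 0, 0, Submodule.zero_mem _, by simp [ann0]⟩
  induction hP using Submodule.span_induction with
  | mem X hX =>
    obtain ⟨Y, hY, Z, hZ, rfl⟩ := Set.mem_mul.1 hX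
    rcases hY with (rfl | ⟨k, rfl⟩) | ⟨k, rfl⟩ <;> rcases hZ with (rfl | ⟨l, rfl⟩) | ⟨l, rfl⟩
    · simpa using hconst 1
    · simpa using hcreate (φ l)
    · simpa using hann (φ l)
    · simpa using hcreate (φ k)
    -- `pairCreate` reverses the order of its two vectors.
    · exact ⟨0, 0, 0, 0, φ l ⊗ₜ φ k, 0, Submodule.zero_mem _, by simp [ann0, pairCreate_tmul]⟩
    · exact ⟨0, 0, 0, 0, 0, _, Submodule.subset_span ⟨(φ k, φ l), rfl⟩, by simp [ann0]⟩
    · simpa using hann (φ k)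
    -- The only one of the nine products that needs reordering: an annihilator to the left of a
    -- creator.
    · refine ⟨inner ℂ (φ k) (φ l), 0, 0, 0, 0, _, Submodule.neg_mem _
        (Submodule.subset_span ⟨(φ l, φ k), rfl⟩), ?_⟩
      rw [Φ.ann_mul_createLM]
      simp [ann0, sub_eq_add_neg]
    · exact ⟨0, 0, 0, φ k ⊗ₜ φ l, 0, 0, Submodule.zero_mem _, by
        rw [star_pairCreate_tmul]; simp [ann0]⟩
  | zero => simpa using hconst 0
  | add X Y _ _ hX hY =>
    obtain ⟨a, f, g, ξ, η, D, hD, rfl⟩ := hX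
    obtain ⟨a', f', g', ξ', η', D', hD', rfl⟩ := hY
    refine ⟨a + a', f + f', g + g', ξ + ξ', η + η', D + D', Submodule.add_mem _ hD hD', ?_⟩
    rw [ann_add, map_add, map_add, map_add, star_add, add_smul]
    abel
  | smul c X _ hX =>
    obtain ⟨a, f, g, ξ, η, D, hD, rfl⟩ := hX
    -- The conjugates on `f` and `ξ` compensate the conjugate-linearity of annihilation.
    refine ⟨c * a, starRingEnd ℂ c • f, c • g, starRingEnd ℂ c • ξ, c • η, c • D,
      Submodule.smul_mem _ _ hD, ?_⟩
    rw [ann_smul, map_smul, map_smul, map_smul, star_smul, Complex.conj_conj]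
    simp [smul_smul]

/-- `X` changes the particle number by `d`. -/
def Shifts (d : ℤ) (X : F →L[ℂ] F) : Prop :=
  (∀ n m : ℕ, (m : ℤ) = n + d → ∀ x ∈ Φ.sec n, X x ∈ Φ.sec m) ∧
    ∀ n : ℕ, (n : ℤ) + d < 0 → ∀ x ∈ Φ.sec n, X x = 0

variable {Φ}

theorem Shifts.add {d : ℤ} {X Y : F →L[ℂ] F} (hX : Φ.Shifts d X) (hY : Φ.Shifts d Y) :
    Φ.Shifts d (X + Y) :=
  ⟨fun n m h x hx => Submodule.add_mem _ (hX.1 n m h x hx) (hY.1 n m h x hx),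
    fun n h x hx => by rw [_root_.add_apply, hX.2 n h x hx, hY.2 n h x hx, add_zero]⟩

theorem Shifts.smul {d : ℤ} (c : ℂ) {X : F →L[ℂ] F} (hX : Φ.Shifts d X) : Φ.Shifts d (c • X) :=
  ⟨fun n m h x hx => Submodule.smul_mem _ _ (hX.1 n m h x hx),
    fun n h x hx => by rw [_root_.smul_apply, hX.2 n h x hx, smul_zero]⟩

theorem Shifts.zero (d : ℤ) : Φ.Shifts d 0 :=
  ⟨fun _ _ _ _ _ => Submodule.zero_mem _, fun _ _ _ _ => rfl⟩

theorem Shifts.one : Φ.Shifts 0 1 :=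
  ⟨fun n m h x hx => by
    obtain rfl : m = n := by omega
    exact hx, fun n h => by omega⟩

theorem Shifts.mul {d d' : ℤ} {X Y : F →L[ℂ] F} (hX : Φ.Shifts d X) (hY : Φ.Shifts d' Y) :
    Φ.Shifts (d + d') (X * Y) := by
  constructor
  · intro n m h x hx
    rw [mul_apply_eq_comp]
    -- If the intermediate particle number would be negative, `Y` already annihilates `x`.
    by_cases h' : (n : ℤ) + d' < 0
    · rw [hY.2 n h' x hx, map_zero]; exact Submodule.zero_mem _
    · obtain ⟨k, hk⟩ := Int.eq_ofNat_of_zero_le (not_lt.1 h')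
      exact hX.1 k m (by omega) _ (hY.1 n k hk.symm x hx)
  · intro n h x hx
    rw [mul_apply_eq_comp]
    by_cases h' : (n : ℤ) + d' < 0
    · rw [hY.2 n h' x hx, map_zero]
    · obtain ⟨k, hk⟩ := Int.eq_ofNat_of_zero_le (not_lt.1 h')
      exact hX.2 k (by omega) _ (hY.1 n k hk.symm x hx)

variable (Φ)

theorem shifts_createLM (f : H) : Φ.Shifts 1 (Φ.createLM f) :=
  ⟨fun n m h x hx => by
    obtain rfl : m = n + 1 := by omega
    exact Φ.createLM_mem f hx, fun n h => by omega⟩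

theorem shifts_ann (f : H) : Φ.Shifts (-1) (Φ.ann f) :=
  ⟨fun n m h x hx => by
    obtain rfl : n = m + 1 := by omega
    exact Φ.annihilate_mem f hx, fun n h x hx => by
    obtain rfl : n = 0 := by omega
    exact Φ.annihilate_eq_zero f hx⟩

theorem shifts_pairCreate (ξ : H ⊗[ℂ] H) : Φ.Shifts 2 (Φ.pairCreate ξ) := by
  induction ξ using TensorProduct.induction_on with
  | zero => rw [map_zero]; exact Shifts.zero _
  | add ξ η h1 h2 => rw [map_add]; exact h1.add h2
  | tmul f g => exact (Φ.shifts_createLM g).mul (Φ.shifts_createLM f)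

theorem shifts_star_pairCreate (ξ : H ⊗[ℂ] H) : Φ.Shifts (-2) (star (Φ.pairCreate ξ)) := by
  induction ξ using TensorProduct.induction_on with
  | zero => rw [map_zero, star_zero]; exact Shifts.zero _
  | add ξ η h1 h2 => rw [map_add, star_add]; exact h1.add h2
  | tmul f g =>
    rw [star_pairCreate_tmul]
    exact (Φ.shifts_ann f).mul (Φ.shifts_ann g)

theorem shifts_of_mem_span {D : F →L[ℂ] F}
    (hD : D ∈ Submodule.span ℂ (Set.range fun p : H × H => Φ.createLM p.1 * Φ.ann p.2)) :
    Φ.Shifts 0 D := by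
  induction hD using Submodule.span_induction with
  | mem x hx =>
    obtain ⟨p, rfl⟩ := hx
    exact (Φ.shifts_createLM p.1).mul (Φ.shifts_ann p.2)
  | zero => exact Shifts.zero _
  | add x y _ _ hx hy => exact hx.add hy
  | smul c x _ hx => exact hx.smul c

theorem exists_sum_of_mem_span {D : F →L[ℂ] F}
    (hD : D ∈ Submodule.span ℂ (Set.range fun p : H × H => Φ.createLM p.1 * Φ.ann p.2)) :
    ∃ (s : Finset (H × H)) (u v : H × H → H), D = ∑ p ∈ s, Φ.createLM (u p) * Φ.ann (v p) := by
  obtain ⟨c, rfl⟩ := Finsupp.mem_span_range_iff_exists_finsupp.1 hD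
  refine ⟨c.support, fun p => c p • p.1, Prod.snd, Finset.sum_congr rfl fun p _ => ?_⟩
  rw [map_smul, smul_mul_assoc]

end FermionSystem

/-! ### Decoupling of the parts of the normal form. -/

namespace NumberExpansion

variable {H : Type*} [NormedAddCommGroup H] [InnerProductSpace ℂ H]
  {F : Type u} [NormedAddCommGroup F] [InnerProductSpace ℂ F] [CompleteSpace F]
  {Φ : FermionSystem H F} {ω : (F →L[ℂ] F) → ℂ} (e : NumberExpansion Φ ω)

/-- Each term is `⟨X y, Y x⟩` with the two vectors in the sectors `n + d` and `n + d'`, which are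
orthogonal. -/
theorem apply_star_mul_eq_zero (e : NumberExpansion Φ ω) {d d' : ℤ} {X Y : F →L[ℂ] F}
    (hX : Φ.Shifts d X) (hY : Φ.Shifts d' Y) (h : d ≠ d') : ω (star X * Y) = 0 := by
  refine e.apply_eq_zero fun n x hx y hy => ?_
  have h1 : inner ℂ y ((star X * Y) x) = (inner ℂ (X y) (Y x) : ℂ) :=
    ContinuousLinearMap.adjoint_inner_right X y (Y x)
  rw [h1]
  by_cases h2 : (n : ℤ) + d < 0
  · rw [hX.2 n h2 y hy, inner_zero_left]
  by_cases h3 : (n : ℤ) + d' < 0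
  · rw [hY.2 n h3 x hx, inner_zero_right]
  obtain ⟨k, hk⟩ := Int.eq_ofNat_of_zero_le (not_lt.1 h2)
  obtain ⟨l, hl⟩ := Int.eq_ofNat_of_zero_le (not_lt.1 h3)
  exact Φ.inner_eq_zero (by omega) (hX.1 n k hk.symm y hy) (hY.1 n l hl.symm x hx)

theorem apply_star_sum_mul_sum (e : NumberExpansion Φ ω) {κ : Type*} [Fintype κ] (d : κ → ℤ)
    (hd : Function.Injective d) (X : κ → F →L[ℂ] F) (hX : ∀ k, Φ.Shifts (d k) (X k)) :
    ω (star (∑ k, X k) * ∑ k, X k) = ∑ k, ω (star (X k) * X k) := by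
  rw [star_sum, Finset.sum_mul_sum, e.map_sum']
  refine Finset.sum_congr rfl fun k _ => ?_
  rw [e.map_sum']
  refine Finset.sum_eq_single k (fun l _ hl => ?_) (by simp)
  exact e.apply_star_mul_eq_zero (hX k) (hX l) (hd.ne hl.symm)

theorem star_sum_createLM_ann {κ : Type*} (Φ : FermionSystem H F) (s : Finset κ) (u v : κ → H) :
    star (∑ k ∈ s, Φ.createLM (u k) * Φ.ann (v k)) = ∑ k ∈ s, Φ.createLM (v k) * Φ.ann (u k) := by
  rw [star_sum]
  refine Finset.sum_congr rfl fun k _ => ?_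
  rw [star_mul, Φ.star_ann, Φ.star_createLM]

/-- The operator `ρ` is not assumed self-adjoint, so `ω` is hermitian on one-body operators only
because `γ` is. -/
theorem apply_star_sum [CompleteSpace H] (e : NumberExpansion Φ ω) {γ : H →L[ℂ] H}
    (hγ : ∀ f g, inner ℂ f (γ g) = ω (Φ.createLM g * Φ.ann f)) (h0 : 0 ≤ γ)
    {κ : Type*} (s : Finset κ) (u v : κ → H) :
    ω (star (∑ k ∈ s, Φ.createLM (u k) * Φ.ann (v k))) =
      starRingEnd ℂ (ω (∑ k ∈ s, Φ.createLM (u k) * Φ.ann (v k))) := by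
  have hs : ContinuousLinearMap.adjoint γ = γ := IsSelfAdjoint.of_nonneg h0
  rw [star_sum_createLM_ann, e.map_sum', e.map_sum', map_sum]
  refine Finset.sum_congr rfl fun k _ => ?_
  rw [← hγ, ← hγ, inner_conj_symm, ← ContinuousLinearMap.adjoint_inner_left, hs]

/-- Completing the square: nonnegativity for all `a` amounts to nonnegativity of the variance of
`D`, attained at `a = -ω D`. -/
theorem apply_star_add_mul_add (e : NumberExpansion Φ ω) (h1 : ω 1 = 1) (a : ℂ) {D : F →L[ℂ] F}
    (hD : ω (star D) = starRingEnd ℂ (ω D)) :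
    ω (star (a • 1 + D) * (a • 1 + D)) =
      ((‖a + ω D‖ ^ 2 : ℝ) : ℂ) + (ω (star D * D) - ((‖ω D‖ ^ 2 : ℝ) : ℂ)) := by
  have h2 : star (a • 1 + D) * (a • 1 + D) = (starRingEnd ℂ a * a) • (1 : F →L[ℂ] F) +
      starRingEnd ℂ a • D + a • star D + star D * D := by
    rw [star_add, star_smul, star_one, add_mul, mul_add, mul_add]
    simp only [smul_mul_assoc, mul_smul_comm, one_mul, mul_one, smul_smul]
    rw [mul_comm a]
    simp only [RCLike.star_def]
    abel
  have h3 : ∀ z : ℂ, ((‖z‖ ^ 2 : ℝ) : ℂ) = starRingEnd ℂ z * z := fun z => by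
    rw [mul_comm, Complex.mul_conj, Complex.normSq_eq_norm_sq]
  rw [h2, e.map_add', e.map_add', e.map_add', e.map_smul', e.map_smul', e.map_smul', h1, hD, h3,
    h3, map_add]
  ring

theorem apply_ann_mul_createLM (e : NumberExpansion Φ ω) (h1 : ω 1 = 1) {γ : H →L[ℂ] H}
    (hγ : ∀ f g, inner ℂ f (γ g) = ω (Φ.createLM g * Φ.ann f)) (f : H) :
    ω (Φ.ann f * Φ.createLM f) = inner ℂ f ((1 - γ) f) := by
  rw [Φ.ann_mul_createLM, e.map_sub', e.map_smul', h1, mul_one, ← hγ, _root_.sub_apply,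
    inner_sub_right]
  rfl

end NumberExpansion

/-! ### The equivalence for a functional with a number expansion. -/

namespace NumberExpansion

variable {H : Type*} [NormedAddCommGroup H] [InnerProductSpace ℂ H]
  {F : Type u} [NormedAddCommGroup F] [InnerProductSpace ℂ F] [CompleteSpace F]
  {Φ : FermionSystem H F} {ω : (F →L[ℂ] F) → ℂ} {γ : H →L[ℂ] H} {Γ : HTensor H →L[ℂ] HTensor H}

theorem hasPairTrace_kappa [CompleteSpace H] (e : NumberExpansion Φ ω)
    (hγ : ∀ f g, inner ℂ f (γ g) = ω (Φ.createLM g * Φ.ann f))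
    (hΓ : ∀ f₁ f₂ g₁ g₂, inner ℂ (pairTensor f₁ f₂) (Γ (pairTensor g₁ g₂)) =
      ω (Φ.createLM g₂ * Φ.createLM g₁ * Φ.ann f₁ * Φ.ann f₂)) (A : H →L[ℂ] H) :
    HasPairTrace (opTensor (star A) A * (Γ + exchange H * opTensor γ 1)) (e.kappa (star A) A) :=
  fun _ b => e.tendsto_pair_sum hγ hΓ b A

theorem hasPairTrace_unique [CompleteSpace H] {T : HTensor H →L[ℂ] HTensor H} {t t' : ℂ}
    (h : HasPairTrace T t) (h' : HasPairTrace T t') : t = t' := by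
  obtain ⟨w, b, -⟩ := exists_hilbertBasis ℂ H
  exact tendsto_nhds_unique (h w b) (h' w b)

theorem isTraceClass_onePDM [CompleteSpace H] (e : NumberExpansion Φ ω)
    (hγ : ∀ f g, inner ℂ f (γ g) = ω (Φ.createLM g * Φ.ann f)) (h0 : 0 ≤ γ) : IsTraceClass γ := by
  refine isTraceClass_of_nonneg (onb H) h0 ?_
  have h := (Complex.hasSum_re (e.hasSum_inner_mul_onePDM hγ (onb H) 1)).summable
  rwa [one_mul] at h

/-- At `A = 1` the pair trace dominates the diagonal of `Γ`: in a product basis, `Ex (γ ⊗ 1)`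
contributes `⟨φ k, γ (φ k)⟩ ≥ 0` when `k = l` and zero otherwise. Hence the diagonal sums are at
most `kappa 1 1`. -/
theorem isTraceClass_twoPDM [CompleteSpace H] {ι : Type*} (φ : HilbertBasis ι ℂ H)
    (e : NumberExpansion Φ ω)
    (hγ : ∀ f g, inner ℂ f (γ g) = ω (Φ.createLM g * Φ.ann f))
    (hΓ : ∀ f₁ f₂ g₁ g₂, inner ℂ (pairTensor f₁ f₂) (Γ (pairTensor g₁ g₂)) =
      ω (Φ.createLM g₂ * Φ.createLM g₁ * Φ.ann f₁ * Φ.ann f₂)) (h0 : 0 ≤ γ) (h1 : 0 ≤ Γ) :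
    IsTraceClass Γ := by
  classical
  have hpos : ∀ p : ι × ι, 0 ≤ (inner ℂ (pairBasis φ p) (Γ (pairBasis φ p)) : ℂ).re := fun p =>
    (Complex.le_def.1 (nonneg_iff_inner.1 h1 _)).1
  have hex : ∀ p : ι × ι, (inner ℂ (pairBasis φ p) (Γ (pairBasis φ p)) : ℂ).re ≤
      (inner ℂ (pairTensor (φ p.1) (φ p.2)) ((opTensor (star 1) 1 *
        (Γ + exchange H * opTensor γ 1) : HTensor H →L[ℂ] HTensor H)
          (pairTensor (φ p.1) (φ p.2))) : ℂ).re := by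
    intro p
    rw [pairBasis_apply, mul_apply_eq_comp, star_one, inner_pairTensor_opTensor]
    have ha : ∀ f : H, ContinuousLinearMap.adjoint (1 : H →L[ℂ] H) f = f := fun f =>
      congrArg (fun T : H →L[ℂ] H => T f) (star_one (H →L[ℂ] H))
    rw [ha, ha, _root_.add_apply, inner_add_right, Complex.add_re, mul_apply_eq_comp,
      opTensor_pairTensor, exchange_pairTensor, inner_pairTensor]
    refine le_add_of_nonneg_right ?_
    change 0 ≤ (inner ℂ (φ p.1) (φ p.2) * (inner ℂ (φ p.2) (γ (φ p.1)) : ℂ)).re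
    rw [orthonormal_iff_ite.1 φ.orthonormal]
    split_ifs with h
    · rw [one_mul, h]
      exact (Complex.le_def.1 (nonneg_iff_inner.1 h0 _)).1
    · simp
  refine isTraceClass_of_nonneg (pairBasis φ) h1 ?_
  refine summable_of_sum_le (c := (e.kappa (star 1) 1).re) hpos fun S => ?_
  have hlim := (Complex.continuous_re.tendsto _).comp (e.tendsto_pair_sum hγ hΓ φ 1)
  refine ge_of_tendsto hlim ?_
  -- Any finite set of index pairs lies in a square `s × s`, the shape of the partial sums in the
  -- pair trace.
  filter_upwards [eventually_ge_atTop (S.image Prod.fst ∪ S.image Prod.snd)] with s hs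
  have hS : S ⊆ s ×ˢ s := fun p hp => Finset.mem_product.2
    ⟨hs (Finset.mem_union_left _ (Finset.mem_image_of_mem _ hp)),
      hs (Finset.mem_union_right _ (Finset.mem_image_of_mem _ hp))⟩
  refine (Finset.sum_le_sum_of_subset_of_nonneg hS fun p _ _ => hpos p).trans ?_
  refine (Finset.sum_le_sum fun p _ => hex p).trans_eq ?_
  rw [Finset.sum_product, Function.comp_apply, Complex.re_sum]
  exact Finset.sum_congr rfl fun k _ => (Complex.re_sum _ _).symm

section Forward

variable {ι : Type*} (φ : HilbertBasis ι ℂ H)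

/-- The test polynomials are `c(f)` here, and `c*(f)`, pair annihilators and pair creators in the
next three lemmas, with amplitudes in the algebraic span of the basis; density does the rest. -/
theorem onePDM_nonneg (hγ : ∀ f g, inner ℂ f (γ g) = ω (Φ.createLM g * Φ.ann f))
    (hpos : ∀ P ∈ Φ.ladder φ 2, 0 ≤ ω (star P * P)) : 0 ≤ γ :=
  nonneg_of_dense φ fun f hf => by
    have h := hpos _ (Φ.mem_ladder_of_mem_span φ (Φ.ann_mem_span hf))
    rwa [Φ.star_ann, ← hγ] at h

theorem onePDM_le_one [CompleteSpace H] (e : NumberExpansion Φ ω) (h1 : ω 1 = 1)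
    (hγ : ∀ f g, inner ℂ f (γ g) = ω (Φ.createLM g * Φ.ann f))
    (hpos : ∀ P ∈ Φ.ladder φ 2, 0 ≤ ω (star P * P)) : γ ≤ 1 :=
  sub_nonneg.1 <| nonneg_of_dense φ fun f hf => by
    have h := hpos _ (Φ.mem_ladder_of_mem_span φ (Φ.createLM_mem_span hf))
    rwa [Φ.star_createLM, e.apply_ann_mul_createLM h1 hγ] at h

theorem twoPDM_nonneg (e : NumberExpansion Φ ω)
    (hΓ : ∀ f₁ f₂ g₁ g₂, inner ℂ (pairTensor f₁ f₂) (Γ (pairTensor g₁ g₂)) =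
      ω (Φ.createLM g₂ * Φ.createLM g₁ * Φ.ann f₁ * Φ.ann f₂))
    (hpos : ∀ P ∈ Φ.ladder φ 2, 0 ≤ ω (star P * P)) : 0 ≤ Γ :=
  nonneg_of_dense (pairBasis φ) fun w hw => by
    obtain ⟨ξ, hξ, rfl⟩ := exists_coe_eq_of_mem_span φ hw
    have h := hpos _ (Φ.star_pairCreate_mem_ladder hξ)
    rwa [star_star, ← e.inner_twoPDM hΓ] at h

theorem twoHole_nonneg (e : NumberExpansion Φ ω) (h1 : ω 1 = 1)
    (hγ : ∀ f g, inner ℂ f (γ g) = ω (Φ.createLM g * Φ.ann f))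
    (hΓ : ∀ f₁ f₂ g₁ g₂, inner ℂ (pairTensor f₁ f₂) (Γ (pairTensor g₁ g₂)) =
      ω (Φ.createLM g₂ * Φ.createLM g₁ * Φ.ann f₁ * Φ.ann f₂))
    (hpos : ∀ P ∈ Φ.ladder φ 2, 0 ≤ ω (star P * P)) : QCondition γ Γ :=
  nonneg_of_dense (pairBasis φ) fun w hw => by
    obtain ⟨ξ, hξ, rfl⟩ := exists_coe_eq_of_mem_span φ hw
    have h := hpos _ (Φ.pairCreate_mem_ladder hξ)
    rwa [← e.inner_twoHole h1 hγ hΓ] at h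

theorem norm_apply_sq_le [CompleteSpace H] (e : NumberExpansion Φ ω) (h1 : ω 1 = 1)
    (hγ : ∀ f g, inner ℂ f (γ g) = ω (Φ.createLM g * Φ.ann f)) (h0 : 0 ≤ γ)
    (hpos : ∀ P ∈ Φ.ladder φ 2, 0 ≤ ω (star P * P)) (s : Finset ι) {v : ι → H}
    (hv : ∀ k, v k ∈ Submodule.span ℂ (Set.range φ)) :
    ((‖ω (∑ k ∈ s, Φ.createLM (φ k) * Φ.ann (v k))‖ ^ 2 : ℝ) : ℂ) ≤
      ω ((∑ k ∈ s, Φ.createLM (v k) * Φ.ann (φ k)) *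
        ∑ k ∈ s, Φ.createLM (φ k) * Φ.ann (v k)) := by
  have hD : ∑ k ∈ s, Φ.createLM (φ k) * Φ.ann (v k) ∈ Φ.ladder φ 2 :=
    Submodule.sum_mem _ fun k _ => Φ.mul_mem_ladder φ
      (Φ.createLM_mem_span (Submodule.subset_span ⟨k, rfl⟩)) (Φ.ann_mem_span (hv k))
  -- The constant `-ω D` makes the square vanish and leaves the variance.
  have h := hpos _ (Submodule.add_mem _ (Submodule.smul_mem _
    (-ω (∑ k ∈ s, Φ.createLM (φ k) * Φ.ann (v k)))
    (Φ.mem_ladder_of_mem_span φ (Φ.one_mem_span φ))) hD)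
  rw [e.apply_star_add_mul_add h1 _ (e.apply_star_sum hγ h0 s φ v), neg_add_cancel, norm_zero,
    star_sum_createLM_ann] at h
  refine sub_nonneg.1 ?_
  simpa using h

/-- Compressing `A` on both sides keeps all vectors in the span of `φ`, so that the second
quantization is a polynomial in the given ladder operators; the inequality then passes to the strong
limit. -/
theorem norm_tau_sq_le [CompleteSpace H] (e : NumberExpansion Φ ω) (h1 : ω 1 = 1)
    (hγ : ∀ f g, inner ℂ f (γ g) = ω (Φ.createLM g * Φ.ann f)) (h0 : 0 ≤ γ)
    (hpos : ∀ P ∈ Φ.ladder φ 2, 0 ≤ ω (star P * P)) (A : H →L[ℂ] H) :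
    ((‖e.tau A‖ ^ 2 : ℝ) : ℂ) ≤ e.kappa (star A) A := by
  have ht := e.tendsto_tau (fun s => norm_compression_le φ.orthonormal A s)
    (tendsto_compression φ A)
  have hk := e.tendsto_kappa (fun s => norm_compression_le φ.orthonormal A s)
    (fun s => norm_compression_le φ.orthonormal (star A) s)
    (tendsto_compression φ A) (tendsto_compression φ (star A))
  have ht' : Tendsto (fun s => ((‖e.tau (compression φ A s)‖ ^ 2 : ℝ) : ℂ)) atTop
      (𝓝 ((‖e.tau A‖ ^ 2 : ℝ) : ℂ)) :=
    (Complex.continuous_ofReal.tendsto _).comp (ht.norm.pow 2)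
  refine le_of_tendsto_of_tendsto' ht' hk fun s => ?_
  let v : ι → H := fun k => finiteProj φ s (ContinuousLinearMap.adjoint A (φ k))
  have hA : ∀ f, compression φ A s f = ∑ k ∈ s, (inner ℂ (v k) f : ℂ) • φ k := fun f => by
    change finiteProj φ s (A (finiteProj φ s f)) = _
    rw [finiteProj_apply]
    refine Finset.sum_congr rfl fun k _ => ?_
    rw [inner_finiteProj_left, ContinuousLinearMap.adjoint_inner_left]
  have hA' : ∀ f, compression φ (star A) s f = ∑ k ∈ s, (inner ℂ (φ k) f : ℂ) • v k := fun f => by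
    change finiteProj φ s (ContinuousLinearMap.adjoint A (finiteProj φ s f)) = _
    rw [finiteProj_apply φ s f, map_sum, map_sum]
    refine Finset.sum_congr rfl fun k _ => ?_
    rw [map_smul, map_smul]
  have h := e.norm_apply_sq_le φ h1 hγ h0 hpos s (v := v) fun k => finiteProj_mem_span _ _ _
  rwa [e.apply_sum_createLM_ann s φ v hA, e.apply_sum_mul_sum s φ v hA s v φ hA'] at h

end Forward

/-- The five parts of the normal form shift the particle number by distinct amounts, so their
contributions separate and each is one of the conditions. -/
theorem apply_star_mul_self_nonneg [CompleteSpace H] {ι : Type*} (φ : ι → H)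
    (e : NumberExpansion Φ ω) (h1 : ω 1 = 1)
    (hγ : ∀ f g, inner ℂ f (γ g) = ω (Φ.createLM g * Φ.ann f))
    (hΓ : ∀ f₁ f₂ g₁ g₂, inner ℂ (pairTensor f₁ f₂) (Γ (pairTensor g₁ g₂)) =
      ω (Φ.createLM g₂ * Φ.createLM g₁ * Φ.ann f₁ * Φ.ann f₂))
    (h0 : 0 ≤ γ) (hle : γ ≤ 1) (hG : ∀ A : H →L[ℂ] H,
      ((‖e.tau A‖ ^ 2 : ℝ) : ℂ) ≤ e.kappa (star A) A) (hP : PCondition Γ) (hQ : QCondition γ Γ)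
    {P : F →L[ℂ] F} (hPol : P ∈ Φ.ladder φ 2) : 0 ≤ ω (star P * P) := by
  obtain ⟨a, f, g, ξ, η, D, hD, rfl⟩ := Φ.exists_normalForm φ hPol
  have hsum := e.apply_star_sum_mul_sum (κ := Fin 5) ![0, -1, 1, -2, 2] (by decide)
    ![a • 1 + D, Φ.ann f, Φ.createLM g, star (Φ.pairCreate ξ), Φ.pairCreate η] (by
      intro k
      fin_cases k
      · exact (FermionSystem.Shifts.one.smul a).add (Φ.shifts_of_mem_span hD)
      · exact Φ.shifts_ann f
      · exact Φ.shifts_createLM g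
      · exact Φ.shifts_star_pairCreate ξ
      · exact Φ.shifts_pairCreate η)
  rw [Fin.sum_univ_five, Fin.sum_univ_five] at hsum
  refine le_of_le_of_eq ?_ hsum.symm
  change 0 ≤ ω (star (a • 1 + D) * (a • 1 + D)) + ω (star (Φ.ann f) * Φ.ann f) +
    ω (star (Φ.createLM g) * Φ.createLM g) +
    ω (star (star (Φ.pairCreate ξ)) * star (Φ.pairCreate ξ)) +
    ω (star (Φ.pairCreate η) * Φ.pairCreate η)
  refine add_nonneg (add_nonneg (add_nonneg (add_nonneg ?_ ?_) ?_) ?_) ?_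
  · obtain ⟨s, u, v, rfl⟩ := Φ.exists_sum_of_mem_span hD
    rw [e.apply_star_add_mul_add h1 a (e.apply_star_sum hγ h0 s u v), star_sum_createLM_ann]
    -- The finite rank operator whose second quantization is `D`; the G-Condition for it bounds the
    -- variance of `D`.
    let A : H →L[ℂ] H := ∑ p ∈ s, InnerProductSpace.rankOne ℂ (u p) (v p)
    have hA : ∀ f, A f = ∑ p ∈ s, (inner ℂ (v p) f : ℂ) • u p := fun f => by simp [A]
    have hA' : ∀ f, (star A) f = ∑ p ∈ s, (inner ℂ (u p) f : ℂ) • v p := fun f => by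
      refine ext_inner_left ℂ fun x => ?_
      have h2 : inner ℂ x ((star A) f) = (inner ℂ (A x) f : ℂ) :=
        ContinuousLinearMap.adjoint_inner_right A x f
      rw [h2, hA, sum_inner, inner_sum]
      refine Finset.sum_congr rfl fun p _ => ?_
      rw [inner_smul_left, inner_smul_right, inner_conj_symm, mul_comm]
    rw [e.apply_sum_createLM_ann s u v hA, e.apply_sum_mul_sum s u v hA s v u hA']
    exact add_nonneg (Complex.zero_le_real.2 (sq_nonneg _)) (sub_nonneg.2 (hG A))
  · rw [Φ.star_ann, ← hγ]
    exact nonneg_iff_inner.1 h0 f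
  · rw [Φ.star_createLM, e.apply_ann_mul_createLM h1 hγ]
    exact nonneg_iff_inner.1 (sub_nonneg.2 hle) g
  · rw [star_star, ← e.inner_twoPDM hΓ]
    exact nonneg_iff_inner.1 hP ξ
  · rw [← e.inner_twoHole h1 hγ hΓ]
    exact nonneg_iff_inner.1 hQ η

theorem forall_nonneg_iff [CompleteSpace H] {ι : Type*} (φ : HilbertBasis ι ℂ H)
    (e : NumberExpansion Φ ω) (h1 : ω 1 = 1)
    (hγ : ∀ f g, inner ℂ f (γ g) = ω (Φ.createLM g * Φ.ann f))
    (hΓ : ∀ f₁ f₂ g₁ g₂, inner ℂ (pairTensor f₁ f₂) (Γ (pairTensor g₁ g₂)) =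
      ω (Φ.createLM g₂ * Φ.createLM g₁ * Φ.ann f₁ * Φ.ann f₂)) :
    (∀ r ≤ 2, ∀ P ∈ Φ.ladder φ r, 0 ≤ ω (star P * P)) ↔
      (IsAdmissible (e.tau 1) γ Γ ∧ GCondition γ Γ ∧ PCondition Γ ∧ QCondition γ Γ) := by
  constructor
  · intro h
    have hpos := h 2 le_rfl
    have h0 := onePDM_nonneg φ hγ hpos
    have hP := e.twoPDM_nonneg φ hΓ hpos
    refine ⟨⟨e.isTraceClass_onePDM hγ h0, h0, e.onePDM_le_one φ h1 hγ hpos, ?_,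
      e.isTraceClass_twoPDM φ hγ hΓ h0 hP, e.exchange_mul_twoPDM hΓ, e.twoPDM_mul_exchange hΓ⟩,
      fun A => ⟨_, e.hasPairTrace_kappa hγ hΓ A, ?_⟩, hP, e.twoHole_nonneg φ h1 hγ hΓ hpos⟩
    · rw [← e.trace_mul_onePDM hγ, one_mul]
    · rw [e.trace_mul_onePDM hγ]
      exact e.norm_tau_sq_le φ h1 hγ h0 hpos A
  · rintro ⟨⟨-, h0, hle, -⟩, hG, hP, hQ⟩ r hr P hPol
    refine e.apply_star_mul_self_nonneg φ h1 hγ hΓ h0 hle (fun A => ?_) hP hQ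
      (Φ.ladder_le φ hr hPol)
    -- The limit `t` is forced to be `kappa (star A) A`, since the latter is also a pair trace of
    -- the same operator.
    obtain ⟨t, ht, h2⟩ := hG A
    rwa [hasPairTrace_unique ht (e.hasPairTrace_kappa hγ hΓ A), e.trace_mul_onePDM hγ] at h2

theorem existsUnique_onePDM [CompleteSpace H] (e : NumberExpansion Φ ω) :
    ∃! γ : H →L[ℂ] H, ∀ f g, inner ℂ f (γ g) = ω (Φ.createLM g * Φ.ann f) := by
  obtain ⟨γ, hγ⟩ := e.exists_onePDM
  refine ⟨γ, hγ, fun γ' hγ' => ?_⟩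
  ext g
  exact ext_inner_left ℂ fun f => (hγ' f g).trans (hγ f g).symm

theorem existsUnique_twoPDM (e : NumberExpansion Φ ω) :
    ∃! Γ : HTensor H →L[ℂ] HTensor H, ∀ f₁ f₂ g₁ g₂, inner ℂ (pairTensor f₁ f₂)
      (Γ (pairTensor g₁ g₂)) = ω (Φ.createLM g₂ * Φ.createLM g₁ * Φ.ann f₁ * Φ.ann f₂) := by
  obtain ⟨Γ, hΓ⟩ := e.exists_twoPDM
  have h : ∀ f₁ f₂ g₁ g₂, inner ℂ (pairTensor f₁ f₂) (Γ (pairTensor g₁ g₂)) =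
      ω (Φ.createLM g₂ * Φ.createLM g₁ * Φ.ann f₁ * Φ.ann f₂) := fun f₁ f₂ g₁ g₂ => by
    rw [mul_assoc, ← Φ.pairCreate_tmul, ← Φ.star_pairCreate_tmul]
    exact hΓ _ _
  exact ⟨Γ, h, fun Γ' hΓ' => ext_pairTensor fun g₁ g₂ => ext_inner_coe fun f₁ f₂ =>
    (hΓ' f₁ f₂ g₁ g₂).trans (h f₁ f₂ g₁ g₂).symm⟩

end NumberExpansion

end FermionFock

end

/-! ### The theorem for density operators on Fock space. -/

open FermionFock in
open scoped ComplexOrder in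
theorem theorem3p1 {H : Type*} [NormedAddCommGroup H] [InnerProductSpace ℂ H] [CompleteSpace H]
    [TopologicalSpace.SeparableSpace H] {ι : Type*} (φ : HilbertBasis ι ℂ H)
    (ρ : Fock H →L[ℂ] Fock H) (hρ : IsTraceClass ρ) (htr : trace ρ = 1)
    (hN2 : FiniteNumberSq ρ) (hcomm : CommutesWithNumber ρ) :
    (∃! γ : H →L[ℂ] H, IsOnePDM ρ γ) ∧
    (∃! Γ : HTensor H →L[ℂ] HTensor H, IsTwoPDM ρ Γ) ∧
    (∀ N : ℕ, HasParticleNumber ρ N → numberExpectation ρ = N) ∧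
    ∀ (γ : H →L[ℂ] H) (Γ : HTensor H →L[ℂ] HTensor H), IsOnePDM ρ γ → IsTwoPDM ρ Γ →
      ((∀ r ≤ 2, ∀ P ∈ ladderPolynomials φ r, 0 ≤ trace (ρ * (star P * P))) ↔
        (IsAdmissible (numberExpectation ρ) γ Γ ∧
          GCondition γ Γ ∧ PCondition Γ ∧ QCondition γ Γ)) := by
  obtain ⟨e, he⟩ := exists_numberExpansion hρ hN2 hcomm
  refine ⟨e.existsUnique_onePDM, e.existsUnique_twoPDM,
    fun N hN => hN.numberExpectation_eq htr, fun γ Γ hγ hΓ => ?_⟩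
  -- The mean particle number is the expectation of `dΓ(1)`, the form in which the trace of `γ` is
  -- computed.
  rw [he, ← e.tau_one]
  exact e.forall_nonneg_iff φ ((congrArg trace (mul_one ρ)).trans htr) hγ hΓ
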